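/- Let $p,q,a,b,c,d,e\in\mathbb{C}$ with $|p|<1$, $q\neq0$, $a\neq0$, let $n\ge 0$ be an integer, and assume $$bcd=a^2q,\qquad de=aq^{n+1}.$$ Write $(x;p)_\infty=\prod_{k\ge0}(1-xp^k)$, $E(x)=E(x;p)=(x;p)_\infty(p/x;p)_\infty$ for $x\ne0$, $(x;q,p)_m=\prod_{k=0}^{m-1}E(xq^k)$ for $m\ge 0$, $(x_1,\dots,x_s;q,p)_m=(x_1;q,p)_m\cdots(x_s;q,p)_m$, and $${}_{10}\omega_9(a_1;a_4,\dots,a_{10};q,p)=\sum_{k=0}^{\infty}\frac{E(a_1q^{2k})}{E(a_1)}\,\frac{(a_1,a_4,\dots,a_{10};q,p)_k\,q^k}{(q,a_1q/a_4,\dots,a_1q/a_{10};q,p)_k},$$ which is used only when some $a_i=q^{-N}$ with an integer $N\ge0$, so that the series terminates and the sum runs over $0\le k\le N$. Let $\sigma\in\{0,1,2\}$ be fixed by $n+\sigma\equiv0\pmod 3$, put $$S=\sum_{k=0}^n\frac{E(aq^{4k})}{E(a)}\frac{(b,c;q^3,p)_k}{(aq/b,aq/c;q,p)_k}\frac{(d;q,p)_{2k}}{(aq/d;q,p)_{2k}}\frac{(e,q^{-n};q,p)_k}{(aq^3/e,aq^{n+3};q^3,p)_k}\,q^k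 ,$$ and put $$f_n=\frac{(aq^{3-\sigma},aq^{3-\sigma}/bc,aq^{3-\sigma}/bd,aq^{3-\sigma}/cd;q^3,p)_{(n+\sigma)/3}}{(aq^{3-\sigma}/b,aq^{3-\sigma}/c,aq^{3-\sigma}/d,aq^{3-\sigma}/bcd;q^3,p)_{(n+\sigma)/3}},$$ $$g_n=\frac{(aq^{3-\sigma},aq^{3-\sigma}/bc,aq^{2-\sigma}/bd,aq^{2-\sigma}/cd;q^3,p)_{(n+\sigma)/3}}{(aq^{3-\sigma}/b,aq^{3-\sigma}/c,aq^{2-\sigma}/d,aq^{2-\sigma}/bcd;q^3,p)_{(n+\sigma)/3}},$$ $$h_n=\frac{E(aq^\sigma)E(aq^\sigma/bc)E(aq/bd)E(aq/cd)}{E(aq^\sigma/b)E(aq^\sigma/c)E(aq/d)E(aq/bcd)}\cdot\frac{(aq^{3-\sigma},aq^{3-\sigma}/bc,aq^{1-\sigma}/bd,aq^{1-\sigma}/cd;q^3,p)_{(n+\sigma)/3}}{(aq^{3-\sigma}/b,aq^{3-\sigma}/c,aq^{1-\sigma}/d,aq^{1-\sigma}/bcd;q^3,p)_{(n+\sigma)/3}}.$$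 Then each of the following identities holds whenever no denominator occurring in $S$ (terms $0\le k\le n$), in the prefactor, or in the terms $0\le k\le\lfloor n/3\rfloor$ of the ${}_{10}\omega_9$ of that identity vanishes (the ${}_{10}\omega_9$ terminates at or before $k=\lfloor n/3\rfloor$): 1. if $n\not\equiv2\pmod3$, then $S=f_n\;{}_{10}\omega_9(a^2/deq;\,a/dq,a/e,b,c,d,q^{1-n},q^{-n};q^3,p)$; 2. if $n\not\equiv1\pmod3$, then $S=g_n\;{}_{10}\omega_9(a^2/de;\,a/d,a/e,b,c,dq,q^{2-n},q^{-n};q^3,p)$; 3. if $n\not\equiv0\pmod3$, then $S=h_n\;{}_{10}\omega_9(a^2q/de;\,aq/d,a/e,b,c,dq^2,q^{2-n},q^{1-n};q^3,p)$. Here $x/yz$ means $x/(yz)$. -/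

import Mathlib

noncomputable section

namespace EllipticSeries

/-- The infinite shifted factorial `(x; p)_∞ = ∏_{k ≥ 0} (1 - x p^k)`, for `|p| < 1`. -/
def pochInf (x p : ℂ) : ℂ := ∏' k : ℕ, (1 - x * p ^ k)

/-- `E(x) = E(x; p) = (x; p)_∞ (p/x; p)_∞`, for `x ≠ 0` and `|p| < 1`. -/
def E (p x : ℂ) : ℂ := pochInf x p * pochInf (p / x) p

/-- The condensed product `E(x₁; p) ⋯ E(x_m; p)`. -/
def EProd (p : ℂ) (xs : List ℂ) : ℂ := (xs.map (E p)).prod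

/-- The elliptic shifted factorial `(x; q, p)_n = ∏_{k=0}^{n-1} E(x q^k; p)`, for `n ≥ 0`. -/
def poch (x q p : ℂ) (n : ℕ) : ℂ := ∏ k ∈ Finset.range n, E p (x * q ^ k)

/-- The condensed product `(x₁, …, x_m; q, p)_n = (x₁; q, p)_n ⋯ (x_m; q, p)_n`. -/
def pochs (xs : List ℂ) (q p : ℂ) (n : ℕ) : ℂ := (xs.map fun x => poch x q p n).prod

/-- The denominator `(q, a₁q/a₄, …, a₁q/a_{r+1}; q, p)_k` of the `k`-th term of a
very-well-poised series; `as` is the list `a₄, …, a_{r+1}`. -/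
def vwpDenom (a₁ : ℂ) (as : List ℂ) (q p : ℂ) (k : ℕ) : ℂ :=
  pochs (q :: as.map fun x => a₁ * q / x) q p k

/-- The very-well-poised elliptic series `_{r+1}ω_r(a₁; a₄, …, a_{r+1}; q, p)`, summed over
all `k ≥ 0`; `as` is the list `a₄, …, a_{r+1}`.  It is used only for terminating series, where
some `a_i` is `q^{-N}` with `N ≥ 0`, so that the terms with `k > N` vanish. -/
def omega (a₁ : ℂ) (as : List ℂ) (q p : ℂ) : ℂ :=
  ∑' k : ℕ, E p (a₁ * q ^ (2 * k)) / E p a₁ *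
    (pochs (a₁ :: as) q p k * q ^ k / vwpDenom a₁ as q p k)

/-- No denominator vanishes in the terms `0 ≤ k ≤ N` of `_{r+1}ω_r(a₁; a₄, …, a_{r+1}; q, p)`
(each denominator with `k ≤ N` divides the one with `k = N`). -/
def OmegaWellDefined (a₁ : ℂ) (as : List ℂ) (q p : ℂ) (N : ℕ) : Prop :=
  E p a₁ ≠ 0 ∧ vwpDenom a₁ as q p N ≠ 0

/-- The cubic sum
`∑_{k=0}^n E(aq^{4k})/E(a) (b,c;q³,p)_k/(aq/b,aq/c;q,p)_k (d;q,p)_{2k}/(aq/d;q,p)_{2k}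
  (e,q^{-n};q,p)_k/(aq³/e,aq^{n+3};q³,p)_k q^k`. -/
def cubicSum (a b c d e q p : ℂ) (n : ℕ) : ℂ :=
  ∑ k ∈ Finset.range (n + 1),
    E p (a * q ^ (4 * k)) / E p a *
    (pochs [b, c] (q ^ 3) p k / pochs [a * q / b, a * q / c] q p k) *
    (poch d q p (2 * k) / poch (a * q / d) q p (2 * k)) *
    (pochs [e, q ^ (-(n : ℤ))] q p k / pochs [a * q ^ 3 / e, a * q ^ (n + 3)] (q ^ 3) p k) *
    q ^ k

end EllipticSeries

end

open EllipticSeries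

/-! Write q = exp h and so on, and replace E by the odd function `sigmaE`, σ(u) = e^{-u/2} E(e^u).
By the balancing conditions all exponential factors cancel, and the algebraic core uses only that σ
is odd and satisfies the three-term addition formula (`SigmaLike`). From the addition formula comes
an elliptic partial fraction expansion (`partial_fraction`).

The condition b + c + d = 2a + h fixes b + c once a, d, h are given, so both sides may be expanded
in partial fractions in b. In the cubic sum the poles are at b = a + jh. After exchanging
summations, the coefficient at node j is an explicit factor times a shorter sum of the same kind,
`nodeSum` of length n - j, with a and d shifted by 4jh and 2jh (`addCubicSum_eq_sum_nodes`). On the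
other side, the prefactor times the very-well-poised series has poles only at nodes j ≡ n mod 3. At
such a node the series degenerates to one with parameters paired at integer distance, which is
summable, again by partial fractions (`very_well_poised_sum`, `vwp_sum_blocks`). The resulting
coefficient is the same explicit factor times a closed product (`node_coefficient`,
`vwp_eq_sum_nodes`).

The transformation is therefore equivalent to the evaluation of `nodeSum`: zero unless 3 divides its
length, and the closed product otherwise. This evaluation follows by strong induction from the
transformation itself at the trivial point b = 0, that is, b = 1 multiplicatively. There both sides
equal 1, so the two node expansions agree. The terms with j ≥ 1 agree by induction, and what remains
is the term j = 0 (`nodeSum_eq_closed`). The three expressions correspond to the choice of a residue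
v different from ν = n mod 3 for the second terminating parameter.

The addition formula for σ comes from the Jacobi triple product: σ(u+w)σ(u-w) is, up to a constant,
a 2 × 2 determinant in two theta series, and the addition formula is the Plücker relation
(`pairW_sigmaE`, `sigmaLike_sigmaE`). The partial fractions need generic parameters. Generic
parameters accumulate at every admissible point along a curve that preserves the constraints, and
continuity gives the general case (`frequently_normIndependent`, `cubicSum_eq`). -/

namespace EllipticSeries

/-! ### Sigma-like functions, shifted factorials, elliptic partial fractions -/

/-- The product `s (x + y) s (x - y)`. -/
def pairW (s : ℂ → ℂ) (x y : ℂ) : ℂ := s (x + y) * s (x - y)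

/-- Odd functions satisfying the three-term addition formula of the Weierstrass sigma function. -/
structure SigmaLike (s : ℂ → ℂ) : Prop where
  odd : ∀ x, s (-x) = -s x
  add : ∀ x y u v, pairW s x y * pairW s u v - pairW s x u * pairW s y v
    + pairW s x v * pairW s y u = 0

/-- The additive shifted factorial `∏_{i<k} s (x + i h)`. -/
def aPoch (s : ℂ → ℂ) (x h : ℂ) (k : ℕ) : ℂ := ∏ i ∈ Finset.range k, s (x + i * h)

section Algebra

variable {s : ℂ → ℂ}

theorem SigmaLike.zero (hs : SigmaLike s) : s 0 = 0 := by
  have := hs.odd 0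
  rw [neg_zero] at this
  exact CharZero.eq_neg_self_iff.mp this

theorem SigmaLike.pairW_swap (hs : SigmaLike s) (x y : ℂ) : pairW s y x = -pairW s x y := by
  unfold pairW
  rw [show y - x = -(x - y) by ring, hs.odd, add_comm y x]; ring

theorem prod_range_erase (f : ℕ → ℂ) (m n : ℕ) :
    ∏ i ∈ (Finset.range (m + n + 1)).erase m, f i =
      (∏ i ∈ Finset.range m, f i) * ∏ i ∈ Finset.range n, f (m + 1 + i) := by
  have : (Finset.range (m + n + 1)).erase m =
      (Finset.range m) ∪ (Finset.range n).map (addLeftEmbedding (m + 1)) := by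
    ext i
    simp only [Finset.mem_erase, Finset.mem_range, Finset.mem_union, Finset.mem_map,
      addLeftEmbedding_apply]
    constructor
    · rintro ⟨h1, h2⟩
      by_cases h : i < m
      · exact Or.inl h
      · exact Or.inr ⟨i - (m + 1), by omega, by omega⟩
    · rintro (h | ⟨j, hj, rfl⟩) <;> omega
  rw [this, Finset.prod_union, Finset.prod_map]
  · rfl
  · rw [Finset.disjoint_left]
    intro i hi hi'
    simp only [Finset.mem_range, Finset.mem_map, addLeftEmbedding_apply] at hi hi'
    omega

/-- Elliptic analogue of Lagrange interpolation: for fixed second argument, `pairW s` behaves like a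
difference of two coordinates, and the addition formula replaces the linear relation used to
separate two poles. -/
theorem partial_fraction (hs : SigmaLike s) (y z : ℕ → ℂ) (k : ℕ) (x : ℂ)
    (hx : ∀ i ≤ k, pairW s (y i) x ≠ 0)
    (hy : ∀ i ≤ k, ∀ j ≤ k, i ≠ j → pairW s (y i) (y j) ≠ 0) :
    (∏ l ∈ Finset.range k, pairW s (z l) x) / ∏ i ∈ Finset.range (k + 1), pairW s (y i) x =
      ∑ j ∈ Finset.range (k + 1), (∏ l ∈ Finset.range k, pairW s (z l) (y j)) /
        (∏ i ∈ (Finset.range (k + 1)).erase j, pairW s (y i) (y j)) / pairW s (y j) x := by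
  induction k generalizing x with
  | zero => simp
  | succ k ih =>
    have ih1 := ih x (fun i hi => hx i (by omega)) (fun i hi j hj => hy i (by omega) j (by omega))
    -- Evaluating the shorter expansion at the new pole rewrites the new coefficient as a sum over
    -- the old poles, so that the identity can be checked separately for each `j`.
    have ih2 := ih (y (k + 1)) (fun i hi => hy i (by omega) (k + 1) le_rfl (by omega))
      (fun i hi j hj => hy i (by omega) j (by omega))
    have hx' := hx (k + 1) le_rfl
    rw [Finset.prod_range_succ, Finset.prod_range_succ _ (k + 1), mul_div_mul_comm, ih1,
      Finset.sum_range_succ _ (k + 1)]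
    have e : (Finset.range (k + 1 + 1)).erase (k + 1) = Finset.range (k + 1) := by
      ext i; simp only [Finset.mem_erase, Finset.mem_range]; omega
    rw [e, Finset.prod_range_succ (fun l => pairW s (z l) (y (k + 1))), mul_div_right_comm, ih2,
      Finset.sum_mul, Finset.sum_mul, Finset.sum_div, ← Finset.sum_add_distrib]
    refine Finset.sum_congr rfl fun j hj => ?_
    have hj' : j < k + 1 := Finset.mem_range.mp hj
    have e2 : ∏ i ∈ (Finset.range (k + 1 + 1)).erase j, pairW s (y i) (y j) =
        (∏ i ∈ (Finset.range (k + 1)).erase j, pairW s (y i) (y j)) *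
          pairW s (y (k + 1)) (y j) := by
      have : (Finset.range (k + 1 + 1)).erase j =
          insert (k + 1) ((Finset.range (k + 1)).erase j) := by
        ext i; simp only [Finset.mem_erase, Finset.mem_range, Finset.mem_insert]; omega
      rw [this, Finset.prod_insert (by simp), mul_comm]
    rw [e2, Finset.prod_range_succ]
    have hxj := hx j (by omega)
    have hyj := hy (k + 1) le_rfl j (by omega) (by omega)
    have hpr : ∏ i ∈ (Finset.range (k + 1)).erase j, pairW s (y i) (y j) ≠ 0 := by
      refine Finset.prod_ne_zero_iff.mpr fun i hi => ?_
      simp only [Finset.mem_erase, Finset.mem_range] at hi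
      exact hy i (by omega) j (by omega) hi.1
    -- This three-term relation separates the poles `y j` and `y (k + 1)` of the extra quotient.
    have hadd := hs.add (z k) x (y (k + 1)) (y j)
    rw [hs.pairW_swap (y j) x, hs.pairW_swap (y (k + 1)) x] at hadd
    rw [hs.pairW_swap (y (k + 1)) (y j)]
    field_simp
    linear_combination
      (∏ l ∈ Finset.range k, pairW s (z l) (y j)) * hadd

theorem aPoch_zero (x h : ℂ) : aPoch s x h 0 = 1 := by simp [aPoch]

theorem aPoch_succ (x h : ℂ) (k : ℕ) : aPoch s x h (k + 1) = aPoch s x h k * s (x + k * h) := by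
  simp [aPoch, Finset.prod_range_succ]

theorem aPoch_add (x h : ℂ) (m n : ℕ) :
    aPoch s x h (m + n) = aPoch s x h m * aPoch s (x + m * h) h n := by
  unfold aPoch
  rw [Finset.prod_range_add]
  congr 1
  refine Finset.prod_congr rfl fun i _ => ?_
  push_cast; ring_nf

theorem aPoch_succ' (x h : ℂ) (k : ℕ) : aPoch s x h (k + 1) = s x * aPoch s (x + h) h k := by
  rw [add_comm, aPoch_add]; simp [aPoch]

theorem SigmaLike.aPoch_reflect (hs : SigmaLike s) (x h : ℂ) (k : ℕ) :
    aPoch s x h k = (-1) ^ k * aPoch s (-x - (k - 1) * h) h k := by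
  unfold aPoch
  rw [← Finset.prod_range_reflect, ← Finset.card_range k, ← Finset.prod_const, Finset.card_range,
    ← Finset.prod_mul_distrib]
  refine Finset.prod_congr rfl fun i hi => ?_
  have : i < k := Finset.mem_range.mp hi
  rw [neg_one_mul, ← hs.odd, Nat.sub_sub, Nat.cast_sub (by omega)]
  push_cast; ring_nf

theorem aPoch_ne_zero {x h : ℂ} {k : ℕ} (H : ∀ i < k, s (x + i * h) ≠ 0) : aPoch s x h k ≠ 0 :=
  Finset.prod_ne_zero_iff.mpr fun i hi => H i (Finset.mem_range.mp hi)

end Algebra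
-- A terminating very-well-poised sum from partial fractions
section Algebra
variable {s : ℂ → ℂ}

/-- With the next lemma, this turns the partial fraction denominators at arithmetic-progression
nodes into the shifted factorials of a very-well-poised term. -/
theorem prod_erase_numbers (hs : SigmaLike s) (h : ℂ) {m N : ℕ} (hm : m ≤ N) :
    (∏ i ∈ (Finset.range (N + 1)).erase m, s ((i - m) * h)) * aPoch s (-(N * h)) h m =
      aPoch s h h N * aPoch s h h m := by
  obtain ⟨n, rfl⟩ := Nat.exists_eq_add_of_le hm
  rw [prod_range_erase]
  have e1 : ∏ i ∈ Finset.range m, s (((i : ℂ) - m) * h) = (-1) ^ m * aPoch s h h m := by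
    rw [show ∏ i ∈ Finset.range m, s (((i : ℂ) - m) * h) = aPoch s (-(m * h)) h m from
      Finset.prod_congr rfl fun i _ => by ring_nf, hs.aPoch_reflect]
    congr 2; ring
  have e2 : ∏ i ∈ Finset.range n, s ((((m + 1 + i : ℕ) : ℂ) - m) * h) = aPoch s h h n :=
    Finset.prod_congr rfl fun i _ => by push_cast; ring_nf
  have e3 : aPoch s (-(((m + n : ℕ) : ℂ) * h)) h m = (-1) ^ m * aPoch s (h + n * h) h m := by
    rw [hs.aPoch_reflect]; congr 2; push_cast; ring
  rw [e1, e2, e3, add_comm m n, aPoch_add h h n m]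
  have : ((-1 : ℂ) ^ m) * (-1) ^ m = 1 := by rw [← mul_pow]; simp
  linear_combination (aPoch s h h m * aPoch s h h n * aPoch s (h + n * h) h m) * this

theorem prod_erase_shifted (A h : ℂ) {m N : ℕ} (hm : m ≤ N) :
    (∏ i ∈ (Finset.range (N + 1)).erase m, s (A + (i + m) * h)) * s (A + 2 * m * h) *
      aPoch s A h m = s A * aPoch s (A + h) h N * aPoch s (A + (N + 1) * h) h m := by
  have e1 : (∏ i ∈ (Finset.range (N + 1)).erase m, s (A + (i + m) * h)) * s (A + 2 * m * h) =
      aPoch s (A + m * h) h (N + 1) := by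
    rw [mul_comm, show s (A + 2 * m * h) = s (A + ((m : ℕ) + m) * h) by ring_nf,
      Finset.mul_prod_erase (Finset.range (N + 1)) (fun i : ℕ => s (A + (i + m) * h))
        (Finset.mem_range.mpr (by omega))]
    exact Finset.prod_congr rfl fun i _ => by ring_nf
  rw [e1, mul_comm, ← aPoch_add, ← aPoch_succ', add_comm m, aPoch_add]
  push_cast; rfl

/-- A terminating very-well-poised sum with two complementary parameters `F`, `A - F`, and `N`
pairs of parameters `z l + h`, `z l`. -/
theorem very_well_poised_sum (hs : SigmaLike s) (A F h : ℂ) (N : ℕ) (z : ℕ → ℂ)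
    (hA : ∀ l : ℕ, s (A + l * h) ≠ 0) (h0 : ∀ l : ℤ, l ≠ 0 → s (l * h) ≠ 0)
    (hF : ∀ l : ℕ, s (F + l * h) ≠ 0) (hG : ∀ l : ℕ, s (A - F + l * h) ≠ 0)
    (hz : ∀ l < N, s (z l) ≠ 0) (hz' : ∀ l < N, s (A - z l) ≠ 0) :
    ∑ m ∈ Finset.range (N + 1), s (A + 2 * m * h) / s A *
        (aPoch s A h m * aPoch s (-(N * h)) h m /
          (aPoch s h h m * aPoch s (A + (N + 1) * h) h m)) *
        (s F * s (A - F) / (s (F + m * h) * s (A - F + m * h))) *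
        ∏ l ∈ Finset.range N, (s (z l + m * h) * s (A - z l + m * h) / (s (z l) * s (A - z l))) =
      aPoch s (A + h) h N * aPoch s h h N / (aPoch s (F + h) h N * aPoch s (A - F + h) h N) *
        ∏ l ∈ Finset.range N, (s (z l - F) * s (A - F - z l) / (s (z l) * s (A - z l))) := by
  have hyx : ∀ i : ℕ, pairW s (A / 2 + i * h) (F - A / 2) = s (F + i * h) * s (A - F + i * h) := by
    intro i; unfold pairW; ring_nf
  have hyy : ∀ i j : ℕ, pairW s (A / 2 + i * h) (A / 2 + j * h) =
      s (A + (i + j) * h) * s ((i - j) * h) := by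
    intro i j; unfold pairW; ring_nf
  have hzx : ∀ l : ℕ, pairW s (z l - A / 2) (F - A / 2) = - (s (z l - F) * s (A - F - z l)) := by
    intro l; unfold pairW
    rw [show A - F - z l = -(z l - A / 2 + (F - A / 2)) by ring, hs.odd]; ring_nf
  have hzy : ∀ l m : ℕ, pairW s (z l - A / 2) (A / 2 + m * h) =
      - (s (z l + m * h) * s (A - z l + m * h)) := by
    intro l m; unfold pairW
    rw [show A - z l + m * h = -(z l - A / 2 - (A / 2 + m * h)) by ring, hs.odd]; ring_nf
  -- Centring at `A / 2` makes every pair well-poised: the two arguments become `F + i h` and `A - F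
  -- + i h`.
  have pf := partial_fraction hs (fun i => A / 2 + i * h) (fun l => z l - A / 2) N (F - A / 2)
    (fun i _ => by rw [hyx]; exact mul_ne_zero (hF i) (hG i))
    (fun i _ j _ hij => by
      rw [hyy]; refine mul_ne_zero ?_ ?_
      · exact_mod_cast hA (i + j)
      · exact_mod_cast h0 (i - j) (by omega))
  simp only [hyx, hzx, hzy, hyy] at pf
  have hnum : ∀ l : ℕ, s ((l + 1) * h) ≠ 0 := fun l => by exact_mod_cast h0 (l + 1) (by omega)
  have pz : ∏ l ∈ Finset.range N, (s (z l) * s (A - z l)) ≠ 0 :=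
    Finset.prod_ne_zero_iff.mpr fun l hl =>
      mul_ne_zero (hz l (Finset.mem_range.mp hl)) (hz' l (Finset.mem_range.mp hl))
  have sA : s A ≠ 0 := by simpa using hA 0
  have sF : s F ≠ 0 := by simpa using hF 0
  have sG : s (A - F) ≠ 0 := by simpa using hG 0
  have pA : aPoch s (A + h) h N ≠ 0 := aPoch_ne_zero fun i _ => by
    have := hA (i + 1); push_cast at this; convert this using 2; ring
  have p1 : ∀ m, aPoch s h h m ≠ 0 := fun m => aPoch_ne_zero fun i _ => by
    convert hnum i using 2; ring
  have pF : aPoch s (F + h) h N ≠ 0 := aPoch_ne_zero fun i _ => by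
    have := hF (i + 1); push_cast at this; convert this using 2; ring
  have pG : aPoch s (A - F + h) h N ≠ 0 := aPoch_ne_zero fun i _ => by
    have := hG (i + 1); push_cast at this; convert this using 2; ring
  have pAN : ∀ m, aPoch s (A + (N + 1) * h) h m ≠ 0 := fun m => aPoch_ne_zero fun i _ => by
    have := hA (N + 1 + i); push_cast at this; convert this using 2; ring
  have eden : ∏ i ∈ Finset.range (N + 1), (s (F + i * h) * s (A - F + i * h)) =
      s F * s (A - F) * (aPoch s (F + h) h N * aPoch s (A - F + h) h N) := by
    rw [Finset.prod_mul_distrib]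
    change aPoch s F h (N + 1) * aPoch s (A - F) h (N + 1) = _
    rw [aPoch_succ', aPoch_succ']; ring
  simp only [Finset.prod_neg, Finset.card_range] at pf
  have hsum : ∀ m ∈ Finset.range (N + 1), s (A + 2 * m * h) / s A *
        (aPoch s A h m * aPoch s (-(N * h)) h m /
          (aPoch s h h m * aPoch s (A + (N + 1) * h) h m)) *
        (s F * s (A - F) / (s (F + m * h) * s (A - F + m * h))) *
        ∏ l ∈ Finset.range N, (s (z l + m * h) * s (A - z l + m * h) / (s (z l) * s (A - z l))) =
      (aPoch s (A + h) h N * aPoch s h h N * (s F * s (A - F)) * (-1) ^ N /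
        ∏ l ∈ Finset.range N, (s (z l) * s (A - z l))) *
      ((-1) ^ N * (∏ l ∈ Finset.range N, s (z l + m * h) * s (A - z l + m * h)) /
        (∏ i ∈ (Finset.range (N + 1)).erase m, s (A + (i + m) * h) * s ((i - m) * h)) /
        (s (F + m * h) * s (A - F + m * h))) := by
    intro m hm
    have hm' : m ≤ N := by have := Finset.mem_range.mp hm; omega
    have hpe : ∏ i ∈ (Finset.range (N + 1)).erase m, s (A + (i + m) * h) ≠ 0 :=
      Finset.prod_ne_zero_iff.mpr fun i _ => by exact_mod_cast hA (i + m)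
    have hpe' : ∏ i ∈ (Finset.range (N + 1)).erase m, s (((i : ℂ) - m) * h) ≠ 0 :=
      Finset.prod_ne_zero_iff.mpr fun i hi => by
        exact_mod_cast h0 (i - m) (by have := (Finset.mem_erase.mp hi).1; omega)
    have k1 := prod_erase_numbers hs h hm'
    have k2 := prod_erase_shifted (s := s) A h hm'
    rw [Finset.prod_div_distrib, Finset.prod_mul_distrib (f := fun i : ℕ => s (A + (i + m) * h))]
    have := p1 m
    have := pAN m
    have := hF m
    have := hG m
    have sq : ((-1 : ℂ) ^ N) * (-1) ^ N = 1 := by rw [← mul_pow]; simp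
    have sq' : ((-1 : ℂ) ^ N) ^ 2 = 1 := by rw [pow_two, sq]
    have k3 : s (A + 2 * m * h) / s A * (aPoch s A h m * aPoch s (-(N * h)) h m /
          (aPoch s h h m * aPoch s (A + (N + 1) * h) h m)) =
        aPoch s (A + h) h N * aPoch s h h N /
          ((∏ i ∈ (Finset.range (N + 1)).erase m, s (A + (i + m) * h)) *
            ∏ i ∈ (Finset.range (N + 1)).erase m, s (((i : ℂ) - m) * h)) := by
      rw [div_mul_div_comm, div_eq_div_iff (mul_ne_zero sA (mul_ne_zero (p1 m) (pAN m)))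
        (mul_ne_zero hpe hpe')]
      linear_combination (aPoch s (-(N * h)) h m *
        ∏ i ∈ (Finset.range (N + 1)).erase m, s (((i : ℂ) - m) * h)) * k2 +
        (s A * aPoch s (A + h) h N * aPoch s (A + (N + 1) * h) h m) * k1
    rw [k3]
    field_simp
    rw [sq', mul_one]
  rw [Finset.sum_congr rfl hsum, ← Finset.mul_sum, ← pf, eden, Finset.prod_div_distrib]
  have sq' : ((-1 : ℂ) ^ N) ^ 2 = 1 := by rw [← pow_mul, mul_comm, pow_mul]; simp
  field_simp
  rw [sq']; try ring

end Algebra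
-- Discrete gamma functions and product identities modulo 3
section Products

/-- `∏_{l<k} f (i + m l)`. -/
def zPoch (f : ℤ → ℂ) (i m : ℤ) (k : ℕ) : ℂ := ∏ l ∈ Finset.range k, f (i + m * l)

theorem exists_gamma_one (f : ℤ → ℂ) (hf : ∀ i, f i ≠ 0) :
    ∃ g : ℤ → ℂ, (∀ i, g i ≠ 0) ∧ ∀ i, g (i + 1) = f i * g i := by
  let g : ℤ → ℂ := fun i => match i with
    | Int.ofNat n => ∏ k ∈ Finset.range n, f k
    | Int.negSucc n => (∏ k ∈ Finset.range (n + 1), f (-(k + 1)))⁻¹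
  refine ⟨g, fun i => ?_, fun i => ?_⟩
  · cases i with
    | ofNat n => exact Finset.prod_ne_zero_iff.mpr fun k _ => hf _
    | negSucc n => exact inv_ne_zero (Finset.prod_ne_zero_iff.mpr fun k _ => hf _)
  · cases i with
    | ofNat n =>
      change ∏ k ∈ Finset.range (n + 1), f k = f n * ∏ k ∈ Finset.range n, f k
      rw [Finset.prod_range_succ, mul_comm]
    | negSucc n =>
      have h1 : g (Int.negSucc n) = (∏ k ∈ Finset.range (n + 1), f (-(k + 1)))⁻¹ := rfl
      have h2 : g (Int.negSucc n + 1) = (∏ k ∈ Finset.range n, f (-(k + 1)))⁻¹ := by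
        cases n with
        | zero => simp [g]
        | succ n => rfl
      have h3 : ∏ k ∈ Finset.range n, f (-(k + 1)) ≠ 0 :=
        Finset.prod_ne_zero_iff.mpr fun k _ => hf _
      have h4 : f (Int.negSucc n) = f (-((n : ℤ) + 1)) := by congr 1
      have h5 := hf (-((n : ℤ) + 1))
      rw [h1, h2, h4, Finset.prod_range_succ]
      generalize f (-((n : ℤ) + 1)) = y at *
      field_simp

/-- Every nowhere vanishing function on `ℤ` is a quotient of shifts by `3` of another one. -/
theorem exists_gamma_three (f : ℤ → ℂ) (hf : ∀ i, f i ≠ 0) :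
    ∃ g : ℤ → ℂ, (∀ i, g i ≠ 0) ∧ (∀ i (k : ℕ), zPoch f i 3 k = g (i + 3 * k) / g i) ∧
      ∀ i (k : ℕ), zPoch f i 1 k =
        g (i + k) * g (i + k + 1) * g (i + k + 2) / (g i * g (i + 1) * g (i + 2)) := by
  -- The recurrence with step 3 decouples into three recurrences with step 1, one for each residue
  -- class.
  choose G hG0 hG using fun r : ℤ => exists_gamma_one (fun k => f (r + 3 * k)) fun _ => hf _
  have key : ∀ i, G ((i + 3) % 3) ((i + 3) / 3) = f i * G (i % 3) (i / 3) := by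
    intro i
    rw [show (i + 3) % 3 = i % 3 by omega, show (i + 3) / 3 = i / 3 + 1 by omega, hG]
    congr 2; omega
  set g : ℤ → ℂ := fun i => G (i % 3) (i / 3) with hg
  have hg0 : ∀ i, g i ≠ 0 := fun i => hG0 _ _
  replace key : ∀ i, g (i + 3) = f i * g i := key
  refine ⟨g, hg0, fun i k => ?_, fun i k => ?_⟩
  · induction k with
    | zero => simp [zPoch, hg0]
    | succ k ih =>
      have : zPoch f i 3 (k + 1) = zPoch f i 3 k * f (i + 3 * k) := Finset.prod_range_succ _ _
      rw [this, ih, show i + 3 * ((k + 1 : ℕ) : ℤ) = i + 3 * k + 3 by push_cast; ring, key]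
      ring
  · induction k with
    | zero => simp [zPoch, hg0]
    | succ k ih =>
      have : zPoch f i 1 (k + 1) = zPoch f i 1 k * f (i + 1 * k) := Finset.prod_range_succ _ _
      rw [this, ih, show i + ((k + 1 : ℕ) : ℤ) = i + k + 1 by push_cast; ring, one_mul,
        show i + (k : ℤ) + 1 + 2 = i + k + 3 by ring, key,
        show i + (k : ℤ) + 1 + 1 = i + k + 2 by ring]
      ring

/-- Products with step 3 or step 1 both telescope in the same `γ`. An identity between quotients of
such products thus becomes a formal linear identity in values of `γ`. -/
theorem exists_log_gamma (f : ℤ → ℂ) (hf : ∀ i, f i ≠ 0) :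
    ∃ γ : ℤ → ℂ, (∀ i, f i = Complex.exp (γ (i + 3) - γ i)) ∧
      (∀ i (k : ℕ), zPoch f i 3 k = Complex.exp (γ (i + 3 * k) - γ i)) ∧
      ∀ i (k : ℕ), zPoch f i 1 k = Complex.exp (γ (i + k) + γ (i + k + 1) + γ (i + k + 2) -
        (γ i + γ (i + 1) + γ (i + 2))) := by
  obtain ⟨g, g0, g3, g1⟩ := exists_gamma_three f hf
  refine ⟨fun i => Complex.log (g i), fun i => ?_, fun i k => ?_, fun i k => ?_⟩
  · have := g3 i 1
    simpa [zPoch, Complex.exp_sub, Complex.exp_log (g0 _)] using this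
  · rw [g3, Complex.exp_sub, Complex.exp_log (g0 _), Complex.exp_log (g0 _)]
  · simp only [g1, Complex.exp_sub, Complex.exp_add, Complex.exp_log (g0 _)]

/-- The admissible residues: `ν = n mod 3` and the residue `v` of the second terminating
parameter. -/
def Residues (ν v : ℕ) : Prop := ν ≤ 2 ∧ v ≤ 2 ∧ ν ≠ v

theorem Residues.cases {ν v : ℕ} (h : Residues ν v) : (ν = 0 ∧ v = 1) ∨ (ν = 0 ∧ v = 2) ∨
    (ν = 1 ∧ v = 0) ∨ (ν = 1 ∧ v = 2) ∨ (ν = 2 ∧ v = 0) ∨ (ν = 2 ∧ v = 1) := by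
  obtain ⟨h1, h2, h3⟩ := h; omega

variable {f : ℤ → ℂ} {ν v : ℕ}

/-- This and the next three lemmas compare the two sides of `node_coefficient` one lattice at a
time: `f i` stands for `s (a + i h)`, `s (d + i h)`, `s (a - d + i h)` and `s (i h)` respectively.
Here `n = 3 (M + r) + ν`, and the node has index `3 M + ν`. Fixing the residues makes the arguments
of `γ` literal enough to match. -/
theorem node_products_a (hf : ∀ i, f i ≠ 0) (hr : Residues ν v) (M r : ℕ) :
    zPoch f ν 3 (M + r + 1) / zPoch f ν 3 M =
      f (4 * (3 * M + ν)) * zPoch f (3 * M + ν) 3 (3 * M + ν) *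
        zPoch f (4 * (3 * M + ν) + 3) 3 r / zPoch f (3 * (M + r) + ν + 3) 3 (3 * M + ν) := by
  obtain ⟨γ, e0, e3, e1⟩ := exists_log_gamma f hf
  simp only [e0, e3, ← Complex.exp_add, ← Complex.exp_sub]
  congr 1
  obtain ⟨rfl, rfl⟩ | ⟨rfl, rfl⟩ | ⟨rfl, rfl⟩ | ⟨rfl, rfl⟩ | ⟨rfl, rfl⟩ | ⟨rfl, rfl⟩ := hr.cases <;>
  · push_cast
    ring_nf

theorem node_products_d (hf : ∀ i, f i ≠ 0) (hr : Residues ν v) (M r : ℕ) :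
    zPoch f (ν + v - 1) 3 M * zPoch f (2 - v) 3 M * f (2 * (3 * M + ν) - 1) /
      (zPoch f (2 - (3 * (M + r) + ν)) 3 (M + r) * zPoch f (3 * M + 2 * ν - 1) 3 (M + r + 1)) =
    zPoch f 0 1 (2 * (3 * M + ν)) / (zPoch f (3 * M + ν - 1) 1 (3 * M + ν) *
      zPoch f (2 - (3 * (M + r) + ν)) 3 (3 * M + ν) * zPoch f (2 * (3 * M + ν) + 2) 3 r *
      zPoch f (2 * (3 * M + ν) + 2 - 3 * r) 3 r) := by
  obtain ⟨γ, e0, e3, e1⟩ := exists_log_gamma f hf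
  simp only [e0, e3, e1, ← Complex.exp_add, ← Complex.exp_sub]
  congr 1
  obtain ⟨rfl, rfl⟩ | ⟨rfl, rfl⟩ | ⟨rfl, rfl⟩ | ⟨rfl, rfl⟩ | ⟨rfl, rfl⟩ | ⟨rfl, rfl⟩ := hr.cases <;>
  · push_cast
    ring_nf

theorem node_products_ad (hf : ∀ i, f i ≠ 0) (hr : Residues ν v) (M r : ℕ) :
    zPoch f (1 - (3 * (M + r) + ν)) 3 (M + r + 1) * zPoch f (3 * (M + r) + 2 * ν + 1) 3 M /
      (f 1 * zPoch f (4 - v) 3 (M + r) * zPoch f (ν + v + 1) 3 (M + r) *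
        zPoch f (1 - (3 * (M + r) + ν)) 3 r) =
    zPoch f (3 * (M + r) + ν + 1) 1 (3 * M + ν) * zPoch f (1 - (3 * M + ν)) 3 (3 * M + ν) /
      (zPoch f 1 1 (2 * (3 * M + ν)) * zPoch f (2 * (3 * M + ν) + 3) 3 r *
        zPoch f (2 * (3 * M + ν) + 2) 3 r) := by
  obtain ⟨γ, e0, e3, e1⟩ := exists_log_gamma f hf
  simp only [e0, e3, e1, ← Complex.exp_add, ← Complex.exp_sub]
  congr 1
  obtain ⟨rfl, rfl⟩ | ⟨rfl, rfl⟩ | ⟨rfl, rfl⟩ | ⟨rfl, rfl⟩ | ⟨rfl, rfl⟩ | ⟨rfl, rfl⟩ := hr.cases <;>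
  · push_cast
    ring_nf

theorem node_products_zero (hf : ∀ i, f i ≠ 0) (hr : Residues ν v) (M r : ℕ) :
    zPoch f (3 * M + 3 + ν - v) 3 (M + r) * zPoch f 3 3 (M + r) *
        zPoch f (3 * M + 2 * ν + v) 3 r /
      (zPoch f (3 * (M + r) + ν + 3 - v) 3 M * zPoch f 3 3 r * zPoch f 3 3 M) =
    zPoch f (3 * r + 1) 1 (3 * M + ν) * zPoch f 1 3 r * zPoch f 2 3 r /
      zPoch f 1 1 (3 * M + ν) := by
  obtain ⟨γ, e0, e3, e1⟩ := exists_log_gamma f hf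
  simp only [e3, e1, ← Complex.exp_add, ← Complex.exp_sub]
  congr 1
  obtain ⟨rfl, rfl⟩ | ⟨rfl, rfl⟩ | ⟨rfl, rfl⟩ | ⟨rfl, rfl⟩ | ⟨rfl, rfl⟩ | ⟨rfl, rfl⟩ := hr.cases <;>
  · push_cast
    ring_nf

end Products
-- Expansion of the cubic sum at its poles in b
noncomputable section Algebra
variable {s : ℂ → ℂ}

theorem SigmaLike.neg_mul_neg (hs : SigmaLike s) (x y : ℂ) : s (-x) * s (-y) = s x * s y := by
  rw [hs.odd, hs.odd]; ring

/-- Partial fractions in `b`, where `b + c` is fixed. -/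
theorem partial_fraction_sum (hs : SigmaLike s) (y z : ℕ → ℂ) (k : ℕ) (b c : ℂ)
    (hb : ∀ i ≤ k, s (y i - b) ≠ 0) (hc : ∀ i ≤ k, s (y i - c) ≠ 0)
    (hy : ∀ i ≤ k, ∀ j ≤ k, i ≠ j → s (y i - y j) ≠ 0)
    (hy' : ∀ i ≤ k, ∀ j ≤ k, i ≠ j → s (y i - (b + c - y j)) ≠ 0) :
    (∏ l ∈ Finset.range k, (s (z l - b) * s (z l - c))) /
        ∏ i ∈ Finset.range (k + 1), (s (y i - b) * s (y i - c)) =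
      ∑ j ∈ Finset.range (k + 1),
        (∏ l ∈ Finset.range k, (s (z l - y j) * s (z l - (b + c - y j)))) /
          (∏ i ∈ (Finset.range (k + 1)).erase j, (s (y i - y j) * s (y i - (b + c - y j)))) /
          (s (y j - b) * s (y j - c)) := by
  have e1 : ∀ u, pairW s (u - (b + c) / 2) ((b - c) / 2) = s (u - b) * s (u - c) := fun u => by
    unfold pairW; ring_nf
  have e2 : ∀ u w, pairW s (u - (b + c) / 2) (w - (b + c) / 2) =
      s (u - w) * s (u - (b + c - w)) := fun u w => by
    unfold pairW; ring_nf
  have := partial_fraction hs (fun i => y i - (b + c) / 2) (fun l => z l - (b + c) / 2) k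
    ((b - c) / 2) (fun i hi => by rw [e1]; exact mul_ne_zero (hb i hi) (hc i hi))
    (fun i hi j hj hij => by rw [e2]; exact mul_ne_zero (hy i hi j hj hij) (hy' i hi j hj hij))
  simpa only [e1, e2] using this

/-- The factors of the cubic summand that do not involve `b` and `c`. -/
def reducedTerm (s : ℂ → ℂ) (n : ℕ) (a d h : ℂ) (k : ℕ) : ℂ :=
  s (a + 4 * k * h) / s a * (aPoch s d h (2 * k) / aPoch s (a + h - d) h (2 * k)) *
    (aPoch s (a + (n + 1) * h - d) h k * aPoch s (-(n * h)) h k /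
      (aPoch s (d + (2 - n) * h) (3 * h) k * aPoch s (a + (n + 3) * h) (3 * h) k))

/-- The coefficient at the node `a + j h` in the partial fraction expansion of
`(b, c; q³)_{j+m} / (aq/b, aq/c; q)_{j+m}`. -/
def nodeCoeff (s : ℂ → ℂ) (a d h : ℂ) (j m : ℕ) : ℂ :=
  aPoch s (a + j * h) (3 * h) (j + m) * aPoch s (a + (1 - j) * h - d) (3 * h) (j + m) /
    (aPoch s (-(j * h)) h j * aPoch s (d + (j - 1) * h) h j *
      (aPoch s h h m * aPoch s (d + 2 * j * h) h m))

/-- The cubic sum with `b = a`. -/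
def nodeSum (s : ℂ → ℂ) (n : ℕ) (a d h : ℂ) : ℂ :=
  ∑ k ∈ Finset.range (n + 1), reducedTerm s n a d h k * nodeCoeff s a d h 0 k

/-- The cubic sum in additive notation. -/
def addCubicSum (s : ℂ → ℂ) (n : ℕ) (a b c d h : ℂ) : ℂ :=
  ∑ k ∈ Finset.range (n + 1), reducedTerm s n a d h k *
    (aPoch s b (3 * h) k * aPoch s c (3 * h) k /
      (aPoch s (a + h - b) h k * aPoch s (a + h - c) h k))

/-- Non-vanishing of `s` on the lattice translates used in the summations. -/
structure GenericParams (s : ℂ → ℂ) (a d h : ℂ) : Prop where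
  num : ∀ l : ℤ, l ≠ 0 → s (l * h) ≠ 0
  ha : ∀ l : ℤ, s (a + l * h) ≠ 0
  hd : ∀ l : ℤ, s (d + l * h) ≠ 0
  had : ∀ l : ℤ, s (a - d + l * h) ≠ 0
  hadd : ∀ l : ℤ, s (a - 2 * d + l * h) ≠ 0

/-- This is the parameter shift occurring at node `j`; it leaves `a - 2 d` unchanged. -/
theorem GenericParams.shift {a d h : ℂ} (H : GenericParams s a d h) (j : ℕ) :
    GenericParams s (a + 4 * j * h) (d + 2 * j * h) h where
  num := H.num
  ha l := by convert H.ha (4 * j + l) using 2; push_cast; ring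
  hd l := by convert H.hd (2 * j + l) using 2; push_cast; ring
  had l := by convert H.had (2 * j + l) using 2; push_cast; ring
  hadd l := by convert H.hadd l using 2; ring

/-- There are `k` pairs in the numerator and, once the factor `s (a - b) * s (a - c)` is put into
the denominator, `k + 1` nodes `a + i h`, exactly the degrees needed for partial fractions in `b`
with `b + c` fixed. -/
theorem bc_partial_fraction (hs : SigmaLike s) {a b c d h : ℂ} (H : GenericParams s a d h)
    (hbc : b + c + d = 2 * a + h) (hb : ∀ l : ℤ, s (a + l * h - b) ≠ 0)
    (hc : ∀ l : ℤ, s (a + l * h - c) ≠ 0) (k : ℕ) :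
    aPoch s b (3 * h) k * aPoch s c (3 * h) k /
      (aPoch s (a + h - b) h k * aPoch s (a + h - c) h k) =
    ∑ j ∈ Finset.range (k + 1), s (a - b) * s (a - c) /
      (s (a + j * h - b) * s (a + j * h - c)) * nodeCoeff s a d h j (k - j) := by
  have hsum : b + c = 2 * a + h - d := by linear_combination hbc
  have hnum : ∀ i j : ℕ, i ≠ j → s (((i : ℂ) - j) * h) ≠ 0 := fun i j hij => by
    exact_mod_cast H.num (i - j) (by omega)
  have pf := partial_fraction_sum hs (fun i => a + i * h) (fun l => -(l * (3 * h))) k b c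
    (fun i _ => by exact_mod_cast hb i) (fun i _ => by exact_mod_cast hc i)
    (fun i _ j _ hij => by convert hnum i j hij using 2; ring)
    (fun i _ j _ _ => by
      rw [hsum]; convert H.hd (i + j - 1) using 2; push_cast; ring)
  have e1 : ∏ l ∈ Finset.range k, (s (-(l * (3 * h)) - b) * s (-(l * (3 * h)) - c)) =
      aPoch s b (3 * h) k * aPoch s c (3 * h) k := by
    unfold aPoch
    rw [← Finset.prod_mul_distrib]
    refine Finset.prod_congr rfl fun l _ => ?_
    rw [← hs.neg_mul_neg]; ring_nf
  have e2 : ∏ i ∈ Finset.range (k + 1), (s (a + i * h - b) * s (a + i * h - c)) =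
      s (a - b) * s (a - c) * (aPoch s (a + h - b) h k * aPoch s (a + h - c) h k) := by
    rw [Finset.prod_mul_distrib,
      show ∏ i ∈ Finset.range (k + 1), s (a + i * h - b) = aPoch s (a - b) h (k + 1) from
        Finset.prod_congr rfl fun i _ => by ring_nf,
      show ∏ i ∈ Finset.range (k + 1), s (a + i * h - c) = aPoch s (a - c) h (k + 1) from
        Finset.prod_congr rfl fun i _ => by ring_nf, aPoch_succ', aPoch_succ']
    ring_nf
  rw [e1, e2] at pf
  have hab : s (a - b) ≠ 0 := by simpa using hb 0
  have hac : s (a - c) ≠ 0 := by simpa using hc 0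
  have : aPoch s b (3 * h) k * aPoch s c (3 * h) k /
      (aPoch s (a + h - b) h k * aPoch s (a + h - c) h k) = s (a - b) * s (a - c) *
      (aPoch s b (3 * h) k * aPoch s c (3 * h) k /
      (s (a - b) * s (a - c) * (aPoch s (a + h - b) h k * aPoch s (a + h - c) h k))) := by
    rw [← div_div _ (s (a - b) * s (a - c)), mul_div_assoc', mul_div_cancel₀]
    exact mul_ne_zero hab hac
  rw [this, pf, Finset.mul_sum]
  refine Finset.sum_congr rfl fun j hj => ?_
  obtain ⟨m, rfl⟩ := Nat.exists_eq_add_of_le (Nat.lt_succ_iff.mp (Finset.mem_range.mp hj))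
  have e3 : ∏ l ∈ Finset.range (j + m), (s (-(l * (3 * h)) - (a + j * h)) *
      s (-(l * (3 * h)) - (b + c - (a + j * h)))) =
      aPoch s (a + j * h) (3 * h) (j + m) * aPoch s (a + (1 - j) * h - d) (3 * h) (j + m) := by
    unfold aPoch
    rw [← Finset.prod_mul_distrib]
    refine Finset.prod_congr rfl fun l _ => ?_
    rw [hsum, ← hs.neg_mul_neg]; ring_nf
  have e4 : ∏ i ∈ (Finset.range (j + m + 1)).erase j, (s (a + i * h - (a + j * h)) *
      s (a + i * h - (b + c - (a + j * h)))) =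
      aPoch s (-(j * h)) h j * aPoch s (d + (j - 1) * h) h j *
      (aPoch s h h m * aPoch s (d + 2 * j * h) h m) := by
    rw [prod_range_erase]
    unfold aPoch
    rw [← Finset.prod_mul_distrib, ← Finset.prod_mul_distrib]
    congr 1
    · refine Finset.prod_congr rfl fun l _ => ?_
      rw [hsum]; ring_nf
    · refine Finset.prod_congr rfl fun l _ => ?_
      rw [hsum]; push_cast; ring_nf
  rw [e3, e4, Nat.add_sub_cancel_left, nodeCoeff]
  ring

/-- Splitting each shifted factorial at index `j` (at `2 j` for the double-length ones) reproduces
the summand for the shifted parameters. This self-similarity makes the coefficient at node `j` a sum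
of the same kind. -/
theorem reducedTerm_mul_nodeCoeff {a d h : ℂ} (H : GenericParams s a d h) (j m k : ℕ) :
    reducedTerm s (j + m) a d h (j + k) * nodeCoeff s a d h j k =
      reducedTerm s (j + m) a d h j * nodeCoeff s a d h j 0 *
        (reducedTerm s m (a + 4 * j * h) (d + 2 * j * h) h k *
          nodeCoeff s (a + 4 * j * h) (d + 2 * j * h) h 0 k) := by
  have h1 : s (a + 4 * j * h) ≠ 0 := by
    convert H.ha (4 * j) using 2; push_cast; ring
  have h2 : s (a + 4 * (j + k : ℕ) * h) / s a =
      s (a + 4 * j * h) / s a * (s (a + 4 * j * h + 4 * k * h) / s (a + 4 * j * h)) := by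
    rw [div_mul_div_comm, mul_comm (s a), mul_div_mul_left _ _ h1]; push_cast; ring_nf
  unfold reducedTerm nodeCoeff
  rw [h2]
  simp only [mul_add 2 j k, aPoch_add, aPoch_zero, add_zero, zero_add]
  push_cast
  rw [show a + h - d + 2 * j * h = a + 4 * j * h + h - (d + 2 * j * h) by ring,
    show a + ((j : ℂ) + m + 1) * h - d + j * h =
      a + 4 * j * h + (m + 1) * h - (d + 2 * j * h) by ring,
    show -(((j : ℂ) + m) * h) + j * h = -(m * h) by ring,
    show d + (2 - ((j : ℂ) + m)) * h + j * (3 * h) = d + 2 * j * h + (2 - m) * h by ring,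
    show a + ((j : ℂ) + m + 3) * h + j * (3 * h) = a + 4 * j * h + (m + 3) * h by ring,
    show a + (j : ℂ) * h + j * (3 * h) = a + 4 * j * h + 0 * h by ring,
    show a + (1 - (j : ℂ)) * h - d + j * (3 * h) =
      a + 4 * j * h + (1 - 0) * h - (d + 2 * j * h) by ring,
    show d + 2 * (j : ℂ) * h + 2 * 0 * h = d + 2 * j * h by ring]
  ring

theorem addCubicSum_eq_sum_nodes (hs : SigmaLike s) {a b c d h : ℂ} (H : GenericParams s a d h)
    (hbc : b + c + d = 2 * a + h) (hb : ∀ l : ℤ, s (a + l * h - b) ≠ 0)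
    (hc : ∀ l : ℤ, s (a + l * h - c) ≠ 0) (n : ℕ) :
    addCubicSum s n a b c d h = ∑ j ∈ Finset.range (n + 1), s (a - b) * s (a - c) /
      (s (a + j * h - b) * s (a + j * h - c)) *
      (reducedTerm s n a d h j * nodeCoeff s a d h j 0 *
        nodeSum s (n - j) (a + 4 * j * h) (d + 2 * j * h) h) := by
  obtain ⟨F, hF⟩ : ∃ F : ℕ → ℕ → ℂ, ∀ j m : ℕ, F j m =
      s (a - b) * s (a - c) / (s (a + j * h - b) * s (a + j * h - c)) *
        (reducedTerm s n a d h (j + m) * nodeCoeff s a d h j m) := ⟨_, fun _ _ => rfl⟩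
  have h1 : addCubicSum s n a b c d h = ∑ k ∈ Finset.range (n + 1),
      ∑ j ∈ Finset.range (k + 1), F j (k - j) := by
    refine Finset.sum_congr rfl fun k _ => ?_
    rw [bc_partial_fraction hs H hbc hb hc, Finset.mul_sum]
    refine Finset.sum_congr rfl fun j hj => ?_
    have : j + (k - j) = k := by have := Finset.mem_range.mp hj; omega
    rw [hF, this]; ring
  rw [h1, Finset.sum_range_diag_flip]
  simp only [hF]
  refine Finset.sum_congr rfl fun j hj => ?_
  obtain ⟨m, rfl⟩ := Nat.exists_eq_add_of_le (Nat.lt_succ_iff.mp (Finset.mem_range.mp hj))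
  rw [← Finset.mul_sum, Nat.add_sub_cancel_left, show j + m + 1 - j = m + 1 by omega, nodeSum]
  congr 1
  rw [Finset.mul_sum]
  exact Finset.sum_congr rfl fun k _ => reducedTerm_mul_nodeCoeff H j m k

end Algebra
-- Very-well-poised series with parameters at integer distance
noncomputable section Algebra
variable {s : ℂ → ℂ}

theorem aPoch_desc (x h : ℂ) (k : ℕ) :
    ∏ l ∈ Finset.range k, s (x - l * h) = aPoch s (x - (k - 1) * h) h k := by
  unfold aPoch
  rw [← Finset.prod_range_reflect]
  refine Finset.prod_congr rfl fun i hi => ?_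
  have : i < k := Finset.mem_range.mp hi
  rw [Nat.sub_sub, Nat.cast_sub (by omega)]
  push_cast; ring_nf

/-- Both sides compute the factorial of length `r + m` at `x`; this exchanges the summation index
with the fixed distance between paired parameters. -/
theorem aPoch_shift_div {x h : ℂ} {r m : ℕ} (hr : aPoch s x h r ≠ 0) (hm : aPoch s x h m ≠ 0) :
    aPoch s (x + m * h) h r / aPoch s x h r = aPoch s (x + r * h) h m / aPoch s x h m := by
  rw [div_eq_div_iff hr hm, mul_comm, ← aPoch_add, mul_comm, ← aPoch_add, add_comm]

/-- A pair of well-poised parameters at integer distance, as a product over nodes. -/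
theorem prod_block {A X h : ℂ} (hX : ∀ l : ℤ, s (X + l * h) ≠ 0)
    (hX' : ∀ l : ℤ, s (A - X + l * h) ≠ 0) (r m : ℕ) :
    ∏ l ∈ Finset.range r, (s (X + l * h + m * h) * s (A - (X + l * h) + m * h) /
        (s (X + l * h) * s (A - (X + l * h)))) =
      aPoch s (X + r * h) h m / aPoch s X h m *
        (aPoch s (A - X + h) h m / aPoch s (A - X - (r - 1) * h) h m) := by
  have h1 : ∀ k, aPoch s X h k ≠ 0 := fun k => aPoch_ne_zero fun i _ => by exact_mod_cast hX i
  have h2 : ∀ k, aPoch s (A - X - (r - 1) * h) h k ≠ 0 := fun k => aPoch_ne_zero fun i _ => by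
    convert hX' (i - (r - 1)) using 2; push_cast; ring
  rw [← aPoch_shift_div (h1 r) (h1 m),
    show A - X + h = A - X - ((r : ℂ) - 1) * h + r * h by ring,
    ← aPoch_shift_div (h2 r) (h2 m), Finset.prod_div_distrib, Finset.prod_mul_distrib,
    Finset.prod_mul_distrib, div_mul_div_comm]
  congr 2
  · exact Finset.prod_congr rfl fun l _ => by ring_nf
  · rw [show A - X - ((r : ℂ) - 1) * h + m * h = A - X + m * h - ((r : ℂ) - 1) * h by ring,
      ← aPoch_desc]
    exact Finset.prod_congr rfl fun l _ => by ring_nf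
  · rw [← aPoch_desc]
    exact Finset.prod_congr rfl fun l _ => by ring_nf

theorem prod_block_eval (A F X h : ℂ) (r : ℕ) :
    ∏ l ∈ Finset.range r, (s (X + l * h - F) * s (A - F - (X + l * h)) /
        (s (X + l * h) * s (A - (X + l * h)))) =
      aPoch s (X - F) h r * aPoch s (A - F - X - (r - 1) * h) h r /
        (aPoch s X h r * aPoch s (A - X - (r - 1) * h) h r) := by
  rw [Finset.prod_div_distrib, Finset.prod_mul_distrib, Finset.prod_mul_distrib, ← aPoch_desc,
    ← aPoch_desc]
  congr 2
  · exact Finset.prod_congr rfl fun l _ => by ring_nf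
  · exact Finset.prod_congr rfl fun l _ => by ring_nf
  · exact Finset.prod_congr rfl fun l _ => by ring_nf

/-- The `m`-th term of a very-well-poised series, in additive notation. -/
def vwpTerm (s : ℂ → ℂ) (A : ℂ) (xs : List ℂ) (h : ℂ) (m : ℕ) : ℂ :=
  s (A + 2 * m * h) / s A * (aPoch s A h m / aPoch s h h m) *
    (xs.map fun x => aPoch s x h m / aPoch s (A + h - x) h m).prod

theorem aPoch_div_step {x h : ℂ} (hx : ∀ l : ℕ, s (x + l * h) ≠ 0) (m : ℕ) :
    aPoch s x h m / aPoch s (x + h) h m = s x / s (x + m * h) := by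
  have h1 : aPoch s (x + h) h m ≠ 0 := aPoch_ne_zero fun i _ => by
    convert hx (i + 1) using 2; push_cast; ring
  rw [div_eq_div_iff h1 (hx m), ← aPoch_succ, ← aPoch_succ']

/-- The parameters `X + r h` and `A - X + h` combine into `r` factors `z l`, and `Y + M h` and `A -
Y + h` into `M` more. Altogether this is the case `N = r + M` of `very_well_poised_sum`. -/
theorem vwp_sum_blocks (hs : SigmaLike s) (A F h X Y : ℂ) (r M : ℕ)
    (hA : ∀ l : ℕ, s (A + l * h) ≠ 0) (h0 : ∀ l : ℤ, l ≠ 0 → s (l * h) ≠ 0)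
    (hF : ∀ l : ℕ, s (F + l * h) ≠ 0) (hG : ∀ l : ℕ, s (A - F + l * h) ≠ 0)
    (hX : ∀ l : ℤ, s (X + l * h) ≠ 0) (hX' : ∀ l : ℤ, s (A - X + l * h) ≠ 0)
    (hY : ∀ l : ℤ, s (Y + l * h) ≠ 0) (hY' : ∀ l : ℤ, s (A - Y + l * h) ≠ 0) :
    ∑ m ∈ Finset.range (r + M + 1), vwpTerm s A [F, A - F, Y + M * h, X + r * h, A - X + h,
        A - Y + h, -((r + M : ℕ) * h)] h m =
      aPoch s (A + h) h (r + M) * aPoch s h h (r + M) /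
        (aPoch s (F + h) h (r + M) * aPoch s (A - F + h) h (r + M)) *
      (aPoch s (X - F) h r * aPoch s (A - F - X - (r - 1) * h) h r /
        (aPoch s X h r * aPoch s (A - X - (r - 1) * h) h r) *
      (aPoch s (Y - F) h M * aPoch s (A - F - Y - (M - 1) * h) h M /
        (aPoch s Y h M * aPoch s (A - Y - (M - 1) * h) h M))) := by
  have key := very_well_poised_sum hs A F h (r + M)
    (fun l => if l < r then X + l * h else Y + (l - r : ℕ) * h) hA h0 hF hG
    (fun l _ => by
      split_ifs
      · exact_mod_cast hX l
      · exact_mod_cast hY (l - r : ℕ))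
    (fun l _ => by
      split_ifs
      · convert hX' (-l) using 2; push_cast; ring
      · convert hY' (-(l - r : ℕ)) using 2; push_cast; ring)
  have hsplit : ∀ f : ℂ → ℂ, ∏ l ∈ Finset.range (r + M),
      f (if l < r then X + l * h else Y + (l - r : ℕ) * h) =
      (∏ l ∈ Finset.range r, f (X + l * h)) * ∏ l ∈ Finset.range M, f (Y + l * h) := by
    intro f
    rw [Finset.prod_range_add]
    congr 1
    · refine Finset.prod_congr rfl fun l hl => ?_
      rw [if_pos (Finset.mem_range.mp hl)]
    · refine Finset.prod_congr rfl fun l _ => ?_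
      rw [if_neg (by omega), Nat.add_sub_cancel_left]
  rw [hsplit (fun z => s (z - F) * s (A - F - z) / (s z * s (A - z))), prod_block_eval,
    prod_block_eval] at key
  rw [← key]
  refine Finset.sum_congr rfl fun m _ => ?_
  rw [hsplit (fun z => s (z + m * h) * s (A - z + m * h) / (s z * s (A - z))),
    prod_block hX hX', prod_block hY hY']
  simp only [vwpTerm, List.map_cons, List.map_nil, List.prod_cons, List.prod_nil]
  rw [show A + h - F = A - F + h by ring, show A + h - (A - F) = F + h by ring,
    show A + h - (Y + M * h) = A - Y - (M - 1) * h by ring,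
    show A + h - (X + r * h) = A - X - (r - 1) * h by ring,
    show A + h - (A - X + h) = X by ring, show A + h - (A - Y + h) = Y by ring,
    show A + h - -((r + M : ℕ) * h) = A + ((r + M : ℕ) + 1) * h by ring,
    mul_div_mul_comm (s F), ← aPoch_div_step hF, ← aPoch_div_step hG]
  ring

end Algebra
-- Comparison of the coefficients at a node
noncomputable section Algebra
variable {s : ℂ → ℂ}

/-- The closed form of `nodeSum s (3 r) a d h`. -/
def nodeSumValue (s : ℂ → ℂ) (a d h : ℂ) (r : ℕ) : ℂ :=
  aPoch s (a + 3 * h) (3 * h) r * aPoch s h (3 * h) r * aPoch s (2 * h) (3 * h) r *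
    aPoch s (a - 2 * d + 2 * h) (3 * h) r /
  (aPoch s (d + 2 * h) (3 * h) r * aPoch s (a + 3 * h - d) (3 * h) r *
    aPoch s (h - d) (3 * h) r * aPoch s (a + 2 * h - d) (3 * h) r)

theorem aPoch_eq_zPoch {x X h : ℂ} {i : ℤ} (hx : x = X + i * h) (m k : ℕ) :
    aPoch s x (m * h) k = zPoch (fun i : ℤ => s (X + i * h)) i m k := by
  unfold aPoch zPoch
  refine Finset.prod_congr rfl fun l _ => ?_
  simp only [hx]; push_cast; ring_nf

theorem aPoch_three_eq {x X h : ℂ} {i : ℤ} (hx : x = X + i * h) (k : ℕ) :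
    aPoch s x (3 * h) k = zPoch (fun i : ℤ => s (X + i * h)) i 3 k := by
  exact_mod_cast aPoch_eq_zPoch hx 3 k

theorem aPoch_one_eq {x X h : ℂ} {i : ℤ} (hx : x = X + i * h) (k : ℕ) :
    aPoch s x h k = zPoch (fun i : ℤ => s (X + i * h)) i 1 k := by
  have := aPoch_eq_zPoch (s := s) hx 1 k
  rwa [Nat.cast_one, one_mul] at this

theorem zPoch_congr_pos {f g : ℤ → ℂ} (hfg : ∀ i, 0 < i → f i = g i) {i m : ℤ} (hi : 0 < i)
    (hm : 0 ≤ m) (k : ℕ) : zPoch f i m k = zPoch g i m k :=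
  Finset.prod_congr rfl fun l _ => hfg _ (by positivity)

theorem cancel_common_factor (k q w y A B C D E₁ E₂ E₃ : ℂ) (hq : q ≠ 0) :
    k * (w * (q * y)) * (A * (B / (C * q) * D)) / (E₁ * (E₂ / E₃)) =
      k * (w * y) * (A * (B / C * D)) * E₃ / (E₁ * E₂) := by
  have h : q * (B / (C * q)) = B / C := by rw [mul_div_assoc', mul_comm C, mul_div_mul_left _ _ hq]
  rw [mul_div_assoc' E₁, div_div_eq_mul_div]
  linear_combination (k * w * y * A * D * E₃ / (E₁ * E₂)) * h

set_option maxHeartbeats 1000000 in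
/-- The node coefficients of the very-well-poised side agree with those of the cubic sum. -/
theorem node_coefficient (hs : SigmaLike s) {a d h : ℂ} (H : GenericParams s a d h) {ν v : ℕ}
    (hr : Residues ν v) (M r n j : ℕ) (hn : n = 3 * (M + r) + ν) (hj : j = 3 * M + ν) :
    aPoch s (a + ν * h) (3 * h) (r + M + 1) * aPoch s (d - a + (ν - 1) * h) (3 * h) (r + M + 1) /
        (s a * s (d - a - h) * aPoch s (d - a + (ν + v - 1 - n) * h) (3 * h) (r + M)) *
      (aPoch s ((v - n - 3 * M) * h) (3 * h) (r + M) *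
        aPoch s (d + (ν + v - 1 - 3 * r) * h) (3 * h) (r + M)) *
      (aPoch s (3 * h) (3 * h) (r + M) /
          (aPoch s (a - d + (ν + v + 1) * h) (3 * h) (r + M) *
            aPoch s (d + (2 - n) * h) (3 * h) (r + M)) *
        (aPoch s ((3 - n - ν - v) * h) (3 * h) r *
            aPoch s (2 * d - a + (1 - 3 * r) * h) (3 * h) r /
          (aPoch s (a - d + (1 - n) * h) (3 * h) r *
            aPoch s (d + (ν + v - 1 - 3 * r) * h) (3 * h) r) *
        (aPoch s (d + (2 - v) * h) (3 * h) M *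
            aPoch s (d - a + (2 - n - ν - 3 * M) * h) (3 * h) M /
          (aPoch s (a + ν * h) (3 * h) M * aPoch s ((v - n - 3 * M) * h) (3 * h) M)))) /
      (aPoch s (-(M * (3 * h))) (3 * h) M * aPoch s (3 * h) (3 * h) r *
        (aPoch s (d + (3 * M + 2 * ν - 1) * h) (3 * h) (r + M + 1) /
          s (d + (6 * M + 2 * ν - 1) * h))) =
    reducedTerm s n a d h j * nodeCoeff s a d h j 0 *
      nodeSumValue s (a + 4 * j * h) (d + 2 * j * h) h r := by
  obtain ⟨hν, hv, hνv⟩ := hr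
  set fa : ℤ → ℂ := fun i => s (a + i * h)
  set fd : ℤ → ℂ := fun i => s (d + i * h)
  set fad : ℤ → ℂ := fun i => s (a - d + i * h)
  set f2 : ℤ → ℂ := fun i => s (a - 2 * d + i * h)
  -- The value at 0 is replaced by 1 because the gamma function argument needs a nowhere vanishing
  -- function. Only positive indices are used after reflection.
  set f0 : ℤ → ℂ := fun i => if i = 0 then 1 else s (i * h) with hf0
  have h0 : ∀ i, f0 i ≠ 0 := fun i => by
    simp only [hf0]; split_ifs with hi
    · exact one_ne_zero
    · exact H.num i hi
  have z3 : ∀ {x : ℂ} (i : ℤ) (k : ℕ), x = i * h → 0 < i →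
      aPoch s x (3 * h) k = zPoch f0 i 3 k := fun {x} i k hx hi => by
    rw [aPoch_three_eq (X := 0) (i := i) (by rw [hx, zero_add])]
    exact zPoch_congr_pos (fun i hi => by simp [hf0, hi.ne']) hi (by norm_num) k
  have z1 : ∀ {x : ℂ} (i : ℤ) (k : ℕ), x = i * h → 0 < i →
      aPoch s x h k = zPoch f0 i 1 k := fun {x} i k hx hi => by
    rw [aPoch_one_eq (X := 0) (i := i) (by rw [hx, zero_add])]
    exact zPoch_congr_pos (fun i hi => by simp [hf0, hi.ne']) hi (by norm_num) k
  have hn' : (n : ℂ) = 3 * (M + r) + ν := by rw [hn]; push_cast; ring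
  have hj' : (j : ℂ) = 3 * M + ν := by rw [hj]; push_cast; ring
  have Ta := node_products_a (f := fa) H.ha ⟨hν, hv, hνv⟩ M r
  have Td := node_products_d (f := fd) H.hd ⟨hν, hv, hνv⟩ M r
  have Tad := node_products_ad (f := fad) H.had ⟨hν, hv, hνv⟩ M r
  have T0 := node_products_zero (f := f0) h0 ⟨hν, hv, hνv⟩ M r
  -- left-hand side
  have l1 : ∀ k, aPoch s (a + ν * h) (3 * h) k = zPoch fa ν 3 k := fun k =>
    aPoch_three_eq (by push_cast; ring) k
  have l2 : aPoch s (d - a + (ν - 1) * h) (3 * h) (r + M + 1) =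
      (-1) ^ (r + M + 1) * zPoch fad (1 - (3 * (M + r) + ν)) 3 (M + r + 1) := by
    rw [hs.aPoch_reflect, aPoch_three_eq (X := a - d) (i := 1 - (3 * (M + r) + ν))
      (by push_cast; ring), add_comm r M]
  have l3 : s (d - a - h) = - fad 1 := by
    rw [← hs.odd]; congr 1; push_cast; ring
  have l4 : aPoch s (d - a + (ν + v - 1 - n) * h) (3 * h) (r + M) =
      (-1) ^ (r + M) * zPoch fad (4 - v) 3 (M + r) := by
    rw [hs.aPoch_reflect, aPoch_three_eq (X := a - d) (i := 4 - v)
      (by rw [hn']; push_cast; ring), add_comm r M]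
  have l5 : aPoch s ((v - n - 3 * M) * h) (3 * h) (r + M) =
      (-1) ^ (r + M) * zPoch f0 (3 * M + 3 + ν - v) 3 (M + r) := by
    rw [hs.aPoch_reflect, z3 (3 * M + 3 + ν - v) _ (by rw [hn']; push_cast; ring) (by omega),
      add_comm r M]
  have l6 : aPoch s (d + (ν + v - 1 - 3 * r) * h) (3 * h) (r + M) =
      aPoch s (d + (ν + v - 1 - 3 * r) * h) (3 * h) r * zPoch fd (ν + v - 1) 3 M := by
    rw [aPoch_add]; congr 1
    exact aPoch_three_eq (by push_cast; ring) M
  have l7 : ∀ k, aPoch s (3 * h) (3 * h) k = zPoch f0 3 3 k := fun k =>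
    z3 3 k (by push_cast; ring) (by norm_num)
  have l8 : aPoch s (a - d + (ν + v + 1) * h) (3 * h) (r + M) =
      zPoch fad (ν + v + 1) 3 (M + r) := by
    rw [add_comm r M]; exact aPoch_three_eq (by push_cast; ring) _
  have l9 : ∀ k, aPoch s (d + (2 - n) * h) (3 * h) k = zPoch fd (2 - (3 * (M + r) + ν)) 3 k :=
    fun k => aPoch_three_eq (by rw [hn']; push_cast; ring) _
  have l10 : aPoch s ((3 - n - ν - v) * h) (3 * h) r =
      (-1) ^ r * zPoch f0 (3 * M + 2 * ν + v) 3 r := by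
    rw [hs.aPoch_reflect, z3 (3 * M + 2 * ν + v) _ (by rw [hn']; push_cast; ring) (by omega)]
  have l11 : aPoch s (2 * d - a + (1 - 3 * r) * h) (3 * h) r = (-1) ^ r * zPoch f2 2 3 r := by
    rw [hs.aPoch_reflect, aPoch_three_eq (X := a - 2 * d) (i := 2) (by push_cast; ring)]
  have l12 : aPoch s (a - d + (1 - n) * h) (3 * h) r =
      zPoch fad (1 - (3 * (M + r) + ν)) 3 r :=
    aPoch_three_eq (by rw [hn']; push_cast; ring) _
  have l13 : aPoch s (d + (2 - v) * h) (3 * h) M = zPoch fd (2 - v) 3 M :=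
    aPoch_three_eq (by push_cast; ring) _
  have l14 : aPoch s (d - a + (2 - n - ν - 3 * M) * h) (3 * h) M =
      (-1) ^ M * zPoch fad (3 * (M + r) + 2 * ν + 1) 3 M := by
    rw [hs.aPoch_reflect, aPoch_three_eq (X := a - d) (i := 3 * (M + r) + 2 * ν + 1)
      (by rw [hn']; push_cast; ring)]
  have l15 : aPoch s ((v - n - 3 * M) * h) (3 * h) M =
      (-1) ^ M * zPoch f0 (3 * (M + r) + ν + 3 - v) 3 M := by
    rw [hs.aPoch_reflect, z3 (3 * (M + r) + ν + 3 - v) _ (by rw [hn']; push_cast; ring) (by omega)]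
  have l16 : aPoch s (-(M * (3 * h))) (3 * h) M = (-1) ^ M * zPoch f0 3 3 M := by
    rw [hs.aPoch_reflect, z3 3 _ (by push_cast; ring) (by norm_num)]
  have l17 : aPoch s (d + (3 * M + 2 * ν - 1) * h) (3 * h) (r + M + 1) =
      zPoch fd (3 * M + 2 * ν - 1) 3 (M + r + 1) := by
    rw [add_comm r M]; exact aPoch_three_eq (by push_cast; ring) _
  have l18 : s (d + (6 * M + 2 * ν - 1) * h) = fd (2 * (3 * M + ν) - 1) := by
    simp only [fd]; congr 1; push_cast; ring
  have p6 : aPoch s (d + (ν + v - 1 - 3 * r) * h) (3 * h) r ≠ 0 := aPoch_ne_zero fun i _ => by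
    convert H.hd (ν + v - 1 - 3 * r + 3 * i) using 2; push_cast; ring
  -- right-hand side
  have r1 : s (a + 4 * j * h) = fa (4 * (3 * M + ν)) := by
    simp only [fa]; congr 1; rw [hj']; push_cast; ring
  have r2 : aPoch s d h (2 * j) = zPoch fd 0 1 (2 * (3 * M + ν)) := by
    rw [hj]; exact aPoch_one_eq (by push_cast; ring) _
  have r3 : aPoch s (a + h - d) h (2 * j) = zPoch fad 1 1 (2 * (3 * M + ν)) := by
    rw [hj]; exact aPoch_one_eq (by push_cast; ring) _
  have r4 : aPoch s (a + (n + 1) * h - d) h j = zPoch fad (3 * (M + r) + ν + 1) 1 (3 * M + ν) := by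
    rw [hj]; exact aPoch_one_eq (by rw [hn']; push_cast; ring) _
  have r5 : aPoch s (-(n * h)) h j = (-1) ^ j * zPoch f0 (3 * r + 1) 1 (3 * M + ν) := by
    rw [hs.aPoch_reflect, z1 (3 * r + 1) _ (by rw [hn', hj']; push_cast; ring) (by omega), hj]
  have r5' : aPoch s (d + (2 - n) * h) (3 * h) j =
      zPoch fd (2 - (3 * (M + r) + ν)) 3 (3 * M + ν) := by rw [l9, hj]
  have r6 : aPoch s (a + (n + 3) * h) (3 * h) j =
      zPoch fa (3 * (M + r) + ν + 3) 3 (3 * M + ν) := by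
    rw [hj]; exact aPoch_three_eq (by rw [hn']; push_cast; ring) _
  have r7 : aPoch s (a + j * h) (3 * h) (j + 0) = zPoch fa (3 * M + ν) 3 (3 * M + ν) := by
    rw [hj]; exact aPoch_three_eq (by push_cast; ring) _
  have r8 : aPoch s (a + (1 - j) * h - d) (3 * h) (j + 0) =
      zPoch fad (1 - (3 * M + ν)) 3 (3 * M + ν) := by
    rw [hj]; exact aPoch_three_eq (by push_cast; ring) _
  have r9 : aPoch s (-(j * h)) h j = (-1) ^ j * zPoch f0 1 1 (3 * M + ν) := by
    rw [hs.aPoch_reflect, z1 1 _ (by push_cast; ring) (by norm_num), hj]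
  have r10 : aPoch s (d + (j - 1) * h) h j = zPoch fd (3 * M + ν - 1) 1 (3 * M + ν) := by
    rw [hj]; exact aPoch_one_eq (by push_cast; ring) _
  have r11 : aPoch s (a + 4 * j * h + 3 * h) (3 * h) r = zPoch fa (4 * (3 * M + ν) + 3) 3 r :=
    aPoch_three_eq (by rw [hj']; push_cast; ring) _
  have r12 : aPoch s h (3 * h) r = zPoch f0 1 3 r := z3 1 _ (by push_cast; ring) (by norm_num)
  have r13 : aPoch s (2 * h) (3 * h) r = zPoch f0 2 3 r :=
    z3 2 _ (by push_cast; ring) (by norm_num)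
  have r14 : aPoch s (a + 4 * j * h - 2 * (d + 2 * j * h) + 2 * h) (3 * h) r = zPoch f2 2 3 r :=
    aPoch_three_eq (by push_cast; ring) _
  have r15 : aPoch s (d + 2 * j * h + 2 * h) (3 * h) r = zPoch fd (2 * (3 * M + ν) + 2) 3 r :=
    aPoch_three_eq (by rw [hj']; push_cast; ring) _
  have r16 : aPoch s (a + 4 * j * h + 3 * h - (d + 2 * j * h)) (3 * h) r =
      zPoch fad (2 * (3 * M + ν) + 3) 3 r :=
    aPoch_three_eq (by rw [hj']; push_cast; ring) _
  have r17 : aPoch s (h - (d + 2 * j * h)) (3 * h) r =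
      (-1) ^ r * zPoch fd (2 * (3 * M + ν) + 2 - 3 * r) 3 r := by
    rw [hs.aPoch_reflect, aPoch_three_eq (X := d) (i := 2 * (3 * M + ν) + 2 - 3 * r)
      (by rw [hj']; push_cast; ring)]
  have r18 : aPoch s (a + 4 * j * h + 2 * h - (d + 2 * j * h)) (3 * h) r =
      zPoch fad (2 * (3 * M + ν) + 2) 3 r :=
    aPoch_three_eq (by rw [hj']; push_cast; ring) _
  unfold reducedTerm nodeCoeff nodeSumValue
  rw [l1, l2, l3, l4, l5, l6, l7, l8, l9, l10, l11, l12, l13, l14, l1, l15, l16, l7, l17, l18,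
    r1, r2, r3, r4, r5, r5', r6, r7, r8, r9, r10, r11, r12, r13, r14, r15, r16, r17, r18,
    aPoch_zero, aPoch_zero, add_comm r M]
  rw [cancel_common_factor _ _ _ _ _ _ _ _ _ _ _ p6]
  -- The factors in `a - 2 d` already coincide, so the four lattice identities suffice. The
  -- reflections leave a total sign `(-1) ^ r` on each side, which the parity cases remove.
  have key := congrArg₂ HMul.hMul (congrArg₂ HMul.hMul Ta Td) (congrArg₂ HMul.hMul Tad T0)
  rcases neg_one_pow_eq_or ℂ r with er | er <;> rcases neg_one_pow_eq_or ℂ M with eM | eM <;>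
    rcases neg_one_pow_eq_or ℂ j with ej | ej <;>
    simp only [pow_add, pow_one, er, eM, ej] <;>
  first
  | linear_combination (zPoch f2 2 3 r / s a) * key
  | linear_combination (-zPoch f2 2 3 r / s a) * key

end Algebra
-- Expansion of the very-well-poised side at its poles in b
noncomputable section Algebra
variable {s : ℂ → ℂ}

/-- The numerator in `b`, `c` of the `m`-th term of a very-well-poised series over its common
denominator; `B` is the first parameter plus the step. -/
def bcNumerator (s : ℂ → ℂ) (B h : ℂ) (N m : ℕ) (b c : ℂ) : ℂ :=
  aPoch s b h m * aPoch s c h m *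
    (aPoch s (B + m * h - b) h (N - m) * aPoch s (B + m * h - c) h (N - m))

theorem bcNumerator_eq {B h b c : ℂ} {N m : ℕ} (hm : m ≤ N) (hb : aPoch s (B - b) h m ≠ 0)
    (hc : aPoch s (B - c) h m ≠ 0) :
    bcNumerator s B h N m b c = aPoch s (B - b) h N * aPoch s (B - c) h N *
      (aPoch s b h m / aPoch s (B - b) h m * (aPoch s c h m / aPoch s (B - c) h m)) := by
  obtain ⟨k, rfl⟩ := Nat.exists_eq_add_of_le hm
  rw [bcNumerator, aPoch_add, aPoch_add, Nat.add_sub_cancel_left, add_sub_right_comm,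
    add_sub_right_comm B]
  generalize aPoch s (B - b) h m = u at *
  generalize aPoch s (B - c) h m = v at *
  generalize aPoch s (B - b + m * h) h k = w at *
  generalize aPoch s (B - c + m * h) h k = x at *
  field_simp

/-- Over the common denominator every term has exactly `N` pairs in `b`, `c`, independently of `m`.
All terms can therefore be expanded over the same `N + 1` nodes. -/
theorem bcNumerator_eq_prod (hs : SigmaLike s) {B h : ℂ} {N m : ℕ} (hm : m ≤ N) (b c : ℂ) :
    bcNumerator s B h N m b c = ∏ l ∈ Finset.range N,
      (s ((if l < m then -(l * h) else B + l * h) - b) *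
        s ((if l < m then -(l * h) else B + l * h) - c)) := by
  obtain ⟨k, rfl⟩ := Nat.exists_eq_add_of_le hm
  rw [Finset.prod_range_add, bcNumerator, Nat.add_sub_cancel_left]
  unfold aPoch
  rw [← Finset.prod_mul_distrib, ← Finset.prod_mul_distrib]
  congr 1
  · refine Finset.prod_congr rfl fun l hl => ?_
    rw [if_pos (Finset.mem_range.mp hl), ← hs.neg_mul_neg]; ring_nf
  · refine Finset.prod_congr rfl fun l hl => ?_
    rw [if_neg (by omega)]; push_cast; ring_nf

/-- Partial fractions are applied termwise, and the two summations are exchanged. The coefficient at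
a node is the same series with `b` set to the node, where `vwp_sum_blocks` sums it. -/
theorem vwp_eq_sum_nodes (hs : SigmaLike s) {a b c d h : ℂ} (H : GenericParams s a d h)
    (hbc : b + c + d = 2 * a + h) (hb : ∀ l : ℤ, s (a + l * h - b) ≠ 0)
    (hc : ∀ l : ℤ, s (a + l * h - c) ≠ 0) {ν v : ℕ} (hr : Residues ν v) (N n : ℕ)
    (hn : n = 3 * N + ν) :
    s (a - b) * s (a - c) / (s a * s (d - a - h)) *
      (aPoch s (a + ν * h) (3 * h) (N + 1) * aPoch s (d - a + (ν - 1) * h) (3 * h) (N + 1) /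
        (aPoch s (a + ν * h - b) (3 * h) (N + 1) * aPoch s (a + ν * h - c) (3 * h) (N + 1))) *
      (aPoch s (a + (v - 3 * N) * h - b) (3 * h) N * aPoch s (a + (v - 3 * N) * h - c) (3 * h) N /
        (aPoch s (a + (v - 3 * N) * h) (3 * h) N *
          aPoch s (d - a + (ν + v - 1 - n) * h) (3 * h) N)) *
      ∑ m ∈ Finset.range (N + 1), vwpTerm s (a + (v - 3 - 3 * N) * h)
        [a - d + (ν + v - 2) * h, d - (n + 1) * h, b, c, d + (ν + v - 1) * h, (v - n) * h,
          (ν - n) * h] (3 * h) m =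
    ∑ M ∈ Finset.range (N + 1), s (a - b) * s (a - c) /
      (s (a + (3 * M + ν : ℕ) * h - b) * s (a + (3 * M + ν : ℕ) * h - c)) *
      (reducedTerm s n a d h (3 * M + ν) * nodeCoeff s a d h (3 * M + ν) 0 *
        nodeSumValue s (a + 4 * (3 * M + ν : ℕ) * h) (d + 2 * (3 * M + ν : ℕ) * h) h (N - M)) := by
  have hsum : b + c = 2 * a + h - d := by linear_combination hbc
  have hn' : (n : ℂ) = 3 * N + ν := by rw [hn]; push_cast; ring
  have hr' := hr
  obtain ⟨hν, hv, hνv⟩ := hr'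
  set B : ℂ := a + (v - 3 * N) * h with hB
  set A : ℂ := a + (v - 3 - 3 * N) * h with hA
  have hAB : A + 3 * h = B := by rw [hA, hB]; ring
  set τ : ℕ → ℂ := fun m => vwpTerm s A [a - d + (ν + v - 2) * h, d - (n + 1) * h,
    d + (ν + v - 1) * h, (v - n) * h, (ν - n) * h] (3 * h) m with hτ
  have term_eq : ∀ b c : ℂ, (∀ l : ℕ, s (B - b + l * (3 * h)) ≠ 0) →
      (∀ l : ℕ, s (B - c + l * (3 * h)) ≠ 0) → ∀ m ∈ Finset.range (N + 1),
      aPoch s (B - b) (3 * h) N * aPoch s (B - c) (3 * h) N *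
        vwpTerm s A [a - d + (ν + v - 2) * h, d - (n + 1) * h, b, c, d + (ν + v - 1) * h,
          (v - n) * h, (ν - n) * h] (3 * h) m = τ m * bcNumerator s B (3 * h) N m b c := by
    intro b c hb hc m hm
    rw [bcNumerator_eq (Nat.lt_succ_iff.mp (Finset.mem_range.mp hm))
      (aPoch_ne_zero fun i _ => hb i) (aPoch_ne_zero fun i _ => hc i)]
    simp only [hτ, vwpTerm, List.map_cons, List.map_nil, List.prod_cons, List.prod_nil, hAB]
    ring
  have sum_eq : ∀ b c : ℂ, (∀ l : ℕ, s (B - b + l * (3 * h)) ≠ 0) →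
      (∀ l : ℕ, s (B - c + l * (3 * h)) ≠ 0) →
      aPoch s (B - b) (3 * h) N * aPoch s (B - c) (3 * h) N *
        ∑ m ∈ Finset.range (N + 1), vwpTerm s A [a - d + (ν + v - 2) * h, d - (n + 1) * h, b, c,
          d + (ν + v - 1) * h, (v - n) * h, (ν - n) * h] (3 * h) m =
      ∑ m ∈ Finset.range (N + 1), τ m * bcNumerator s B (3 * h) N m b c := by
    intro b c hb hc
    rw [Finset.mul_sum]
    exact Finset.sum_congr rfl (term_eq b c hb hc)
  set y : ℕ → ℂ := fun i => a + (ν + 3 * i) * h with hy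
  set Den : ℕ → ℂ := fun M => ∏ i ∈ (Finset.range (N + 1)).erase M,
    (s (y i - y M) * s (y i - (b + c - y M))) with hDen
  have pf : ∀ m ∈ Finset.range (N + 1), bcNumerator s B (3 * h) N m b c /
      (aPoch s (a + ν * h - b) (3 * h) (N + 1) * aPoch s (a + ν * h - c) (3 * h) (N + 1)) =
      ∑ M ∈ Finset.range (N + 1), bcNumerator s B (3 * h) N m (y M) (b + c - y M) / Den M /
        (s (y M - b) * s (y M - c)) := by
    intro m hm
    have hm' := Nat.lt_succ_iff.mp (Finset.mem_range.mp hm)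
    have := partial_fraction_sum hs y
      (fun l => if l < m then -(l * (3 * h)) else B + l * (3 * h)) N b c
      (fun i _ => by convert hb (ν + 3 * i) using 3; push_cast; ring)
      (fun i _ => by convert hc (ν + 3 * i) using 3; push_cast; ring)
      (fun i _ j _ hij => by
        convert H.num (3 * (i - j)) (by omega) using 2; simp only [hy]; push_cast; ring)
      (fun i _ j _ hij => by
        convert H.hd (2 * ν + 3 * i + 3 * j - 1) using 2
        simp only [hy]; rw [hsum]; push_cast; ring)
    simp only [← bcNumerator_eq_prod hs hm'] at this
    rw [← this, Finset.prod_mul_distrib]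
    congr 2
    · exact Finset.prod_congr rfl fun i _ => by simp only [hy]; ring_nf
    · exact Finset.prod_congr rfl fun i _ => by simp only [hy]; ring_nf
  have node : ∀ M ∈ Finset.range (N + 1),
      aPoch s (a + ν * h) (3 * h) (N + 1) * aPoch s (d - a + (ν - 1) * h) (3 * h) (N + 1) /
        (s a * s (d - a - h) *
          (aPoch s B (3 * h) N * aPoch s (d - a + (ν + v - 1 - n) * h) (3 * h) N)) *
      (∑ m ∈ Finset.range (N + 1), τ m * bcNumerator s B (3 * h) N m (y M) (b + c - y M)) /
        Den M =
      reducedTerm s n a d h (3 * M + ν) * nodeCoeff s a d h (3 * M + ν) 0 *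
        nodeSumValue s (a + 4 * (3 * M + ν : ℕ) * h) (d + 2 * (3 * M + ν : ℕ) * h) h (N - M) := by
    intro M hM
    obtain ⟨r, hNr⟩ := Nat.exists_eq_add_of_le' (Nat.lt_succ_iff.mp (Finset.mem_range.mp hM))
    have hN' : (N : ℂ) = r + M := by rw [hNr]; push_cast; ring
    -- Since `v` and `ν` are distinct residues modulo 3, the integer `v - ν + 3 l` never vanishes.
    -- This is where the two terminating parameters must lie in different classes.
    have hne : ∀ l : ℤ, s ((v - ν + 3 * l) * h) ≠ 0 := fun l => by
      exact_mod_cast H.num (v - ν + 3 * l) (by omega)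
    rw [← sum_eq (y M) (b + c - y M)
      (fun l => by
        convert hne (l - N - M) using 2
        simp only [hB, hy]; push_cast; ring)
      (fun l => by
        convert H.hd (v - 3 * N - 1 + ν + 3 * M + 3 * l) using 2
        simp only [hB, hy]; rw [hsum]; push_cast; ring)]
    -- `X` and `Y` are chosen so that `Y + M (3 h)` is the value of `b` at the node and `X + r (3
    -- h)` the value of `c`; their partners are the parameters `(v - n) h` and `d + (ν + v - 1) h`.
    have blocks := vwp_sum_blocks hs A (a - d + (ν + v - 2) * h) (3 * h)
      (a - d + (1 - n) * h) (a + ν * h) r M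
      (fun l => by convert H.ha (v - 3 - 3 * N + 3 * l) using 2; rw [hA]; push_cast; ring)
      (fun l hl => by convert H.num (3 * l) (by omega) using 2; push_cast; ring)
      (fun l => by convert H.had (ν + v - 2 + 3 * l) using 2; push_cast; ring)
      (fun l => by
        convert H.hd (-n - 1 + 3 * l) using 2; rw [hA]; push_cast; rw [hn']; ring)
      (fun l => by convert H.had (1 - n + 3 * l) using 2; push_cast; ring)
      (fun l => by
        convert H.hd (v - 3 - 3 * N - 1 + n + 3 * l) using 2; rw [hA]; push_cast; ring)
      (fun l => by convert H.ha (ν + 3 * l) using 2; push_cast; ring)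
      (fun l => by convert hne (l - 1 - N) using 2; rw [hA]; push_cast; ring)
    rw [show A - (a - d + (ν + v - 2) * h) = d - (n + 1) * h by rw [hA, hn']; ring,
      show a + ν * h + M * (3 * h) = y M by simp only [hy]; ring,
      show a - d + (1 - n) * h + r * (3 * h) = b + c - y M by
        simp only [hy]; rw [hsum, hn', hN']; ring,
      show A - (a - d + (1 - n) * h) + 3 * h = d + (ν + v - 1) * h by rw [hA, hn']; ring,
      show A - (a + ν * h) + 3 * h = (v - n) * h by rw [hA, hn']; ring,
      show -(((r + M : ℕ) : ℂ) * (3 * h)) = (ν - n) * h by rw [hn', hN']; push_cast; ring,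
      ← hNr] at blocks
    have hDenM : Den M = aPoch s (-(M * (3 * h))) (3 * h) M * aPoch s (3 * h) (3 * h) r *
        (aPoch s (d + (3 * M + 2 * ν - 1) * h) (3 * h) (r + M + 1) /
          s (d + (6 * M + 2 * ν - 1) * h)) := by
      have hd0 : s (d + (6 * M + 2 * ν - 1) * h) ≠ 0 := by
        exact_mod_cast H.hd (6 * M + 2 * ν - 1)
      have e1 : ∏ i ∈ (Finset.range (N + 1)).erase M, s (y i - y M) =
          aPoch s (-(M * (3 * h))) (3 * h) M * aPoch s (3 * h) (3 * h) r := by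
        rw [hNr, add_comm r M, prod_range_erase]
        congr 1
        · exact Finset.prod_congr rfl fun i _ => by simp only [hy]; ring_nf
        · exact Finset.prod_congr rfl fun i _ => by simp only [hy]; push_cast; ring_nf
      have e2 : s (d + (6 * M + 2 * ν - 1) * h) *
          ∏ i ∈ (Finset.range (N + 1)).erase M, s (y i - (b + c - y M)) =
          aPoch s (d + (3 * M + 2 * ν - 1) * h) (3 * h) (r + M + 1) := by
        rw [show s (d + (6 * M + 2 * ν - 1) * h) = s (y M - (b + c - y M)) by
            congr 1; simp only [hy]; rw [hsum]; ring,
          Finset.mul_prod_erase (Finset.range (N + 1)) (fun i => s (y i - (b + c - y M))) hM,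
          ← hNr]
        exact Finset.prod_congr rfl fun i _ => by simp only [hy]; rw [hsum]; ring_nf
      rw [hDen, ← e2, mul_div_cancel_left₀ _ hd0, ← e1]
      exact Finset.prod_mul_distrib
    have key := node_coefficient hs H hr M r n (3 * M + ν) (by omega) rfl
    rw [← hDenM, ← hNr] at key
    have hNM : N - M = r := by omega
    rw [hNM, ← key, blocks]
    have hBN : aPoch s B (3 * h) N ≠ 0 := aPoch_ne_zero fun i _ => by
      convert H.ha (v - 3 * N + 3 * i) using 2; rw [hB]; push_cast; ring
    rw [show B - y M = (v - n - 3 * M) * h by simp only [hB, hy]; rw [hn']; ring,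
      show B - (b + c - y M) = d + (ν + v - 1 - 3 * r) * h by
        simp only [hB, hy]; rw [hsum, hN']; ring,
      hAB, show a - d + (ν + v - 2) * h + 3 * h = a - d + (ν + v + 1) * h by ring,
      show d - (n + 1) * h + 3 * h = d + (2 - n) * h by ring,
      show a - d + (1 - n) * h - (a - d + (ν + v - 2) * h) = (3 - n - ν - v) * h by ring,
      show d - (n + 1) * h - (a - d + (1 - n) * h) - (r - 1) * (3 * h) =
        2 * d - a + (1 - 3 * r) * h by ring,
      show A - (a - d + (1 - n) * h) - (r - 1) * (3 * h) = d + (ν + v - 1 - 3 * r) * h by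
        rw [hA, hn']; ring,
      show a + ν * h - (a - d + (ν + v - 2) * h) = d + (2 - v) * h by ring,
      show d - (n + 1) * h - (a + ν * h) - (M - 1) * (3 * h) =
        d - a + (2 - n - ν - 3 * M) * h by ring,
      show A - (a + ν * h) - (M - 1) * (3 * h) = (v - n - 3 * M) * h by rw [hA, hn']; ring]
    generalize aPoch s B (3 * h) N = β at *
    have : ∀ k₁ k₂ k₃ u x y z : ℂ, k₁ / (k₂ * (β * k₃)) * (u * (β * x / y * z)) =
        k₁ / (k₂ * k₃) * u * (x / y * z) := by
      intro k₁ k₂ k₃ u x y z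
      rw [mul_left_comm k₂ β]
      have : k₁ / (β * (k₂ * k₃)) * β = k₁ / (k₂ * k₃) := by
        rw [div_mul_eq_mul_div, mul_comm k₁, mul_div_mul_left _ _ hBN]
      linear_combination (u * x / y * z) * this
    rw [this]
  have main := sum_eq b c
    (fun l => by convert hb (v - 3 * N + 3 * l) using 2; rw [hB]; push_cast; ring)
    (fun l => by convert hc (v - 3 * N + 3 * l) using 2; rw [hB]; push_cast; ring)
  have total : ∑ m ∈ Finset.range (N + 1), τ m * bcNumerator s B (3 * h) N m b c /
      (aPoch s (a + ν * h - b) (3 * h) (N + 1) * aPoch s (a + ν * h - c) (3 * h) (N + 1)) =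
      ∑ M ∈ Finset.range (N + 1), (∑ m ∈ Finset.range (N + 1),
        τ m * bcNumerator s B (3 * h) N m (y M) (b + c - y M)) / Den M /
        (s (y M - b) * s (y M - c)) := by
    simp only [Finset.sum_div]
    rw [Finset.sum_comm]
    refine Finset.sum_congr rfl fun m hm => ?_
    rw [mul_div_assoc, pf m hm, Finset.mul_sum]
    exact Finset.sum_congr rfl fun M _ => by ring
  rw [← Finset.sum_div, ← main] at total
  have hyM : ∀ M : ℕ, a + (3 * M + ν : ℕ) * h = y M := fun M => by
    simp only [hy]; push_cast; ring
  calc _ = s (a - b) * s (a - c) * (aPoch s (a + ν * h) (3 * h) (N + 1) *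
          aPoch s (d - a + (ν - 1) * h) (3 * h) (N + 1) / (s a * s (d - a - h) *
          (aPoch s B (3 * h) N * aPoch s (d - a + (ν + v - 1 - n) * h) (3 * h) N))) *
        (aPoch s (B - b) (3 * h) N * aPoch s (B - c) (3 * h) N *
          (∑ m ∈ Finset.range (N + 1), vwpTerm s A [a - d + (ν + v - 2) * h, d - (n + 1) * h, b, c,
            d + (ν + v - 1) * h, (v - n) * h, (ν - n) * h] (3 * h) m) /
          (aPoch s (a + ν * h - b) (3 * h) (N + 1) *
            aPoch s (a + ν * h - c) (3 * h) (N + 1))) := by ring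
    _ = _ := by
      rw [total, Finset.mul_sum]
      refine Finset.sum_congr rfl fun M hM => ?_
      rw [← node M hM, hyM]
      ring

end Algebra
-- Evaluation of the node sums and the transformation for generic parameters
noncomputable section Algebra
variable {s : ℂ → ℂ}

/-- The value of `nodeSum s n a d h`. -/
def nodeSumClosed (s : ℂ → ℂ) (n : ℕ) (a d h : ℂ) : ℂ :=
  if n % 3 = 0 then nodeSumValue s a d h (n / 3) else 0

/-- The prefactor of the very-well-poised side. -/
def vwpPrefactor (s : ℂ → ℂ) (ν v N : ℕ) (a b c d h : ℂ) : ℂ :=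
  s (a - b) * s (a - c) / (s a * s (d - a - h)) *
    (aPoch s (a + ν * h) (3 * h) (N + 1) * aPoch s (d - a + (ν - 1) * h) (3 * h) (N + 1) /
      (aPoch s (a + ν * h - b) (3 * h) (N + 1) * aPoch s (a + ν * h - c) (3 * h) (N + 1))) *
    (aPoch s (a + (v - 3 * N) * h - b) (3 * h) N * aPoch s (a + (v - 3 * N) * h - c) (3 * h) N /
      (aPoch s (a + (v - 3 * N) * h) (3 * h) N *
        aPoch s (d - a + (v - 1 - 3 * N) * h) (3 * h) N))

/-- The very-well-poised series on the right-hand side. -/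
def vwpSum (s : ℂ → ℂ) (ν v N : ℕ) (a b c d h : ℂ) : ℂ :=
  ∑ m ∈ Finset.range (N + 1), vwpTerm s (a + (v - 3 - 3 * N) * h)
    [a - d + (ν + v - 2) * h, d - (3 * N + ν + 1) * h, b, c, d + (ν + v - 1) * h,
      (v - ν - 3 * N) * h, -(3 * N * h)] (3 * h) m

/-- The expansion is extended to all nodes `j ≤ n`: those with `j` not congruent to `ν` modulo 3
contribute zero, because `nodeSumClosed` vanishes when 3 does not divide `n - j`. This is the form
comparable with the cubic side. -/
theorem vwpSum_eq_sum_nodes (hs : SigmaLike s) {a b c d h : ℂ} (H : GenericParams s a d h)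
    (hbc : b + c + d = 2 * a + h) (hb : ∀ l : ℤ, s (a + l * h - b) ≠ 0)
    (hc : ∀ l : ℤ, s (a + l * h - c) ≠ 0) {ν v : ℕ} (hr : Residues ν v) (N n : ℕ)
    (hn : n = 3 * N + ν) :
    vwpPrefactor s ν v N a b c d h * vwpSum s ν v N a b c d h =
    ∑ j ∈ Finset.range (n + 1), s (a - b) * s (a - c) /
      (s (a + j * h - b) * s (a + j * h - c)) *
      (reducedTerm s n a d h j * nodeCoeff s a d h j 0 *
        nodeSumClosed s (n - j) (a + 4 * j * h) (d + 2 * j * h) h) := by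
  have h1 := vwp_eq_sum_nodes hs H hbc hb hc hr N n hn
  have hn' : (n : ℂ) = 3 * N + ν := by rw [hn]; push_cast; ring
  have e1 : (ν : ℂ) + v - 1 - n = v - 1 - 3 * N := by rw [hn']; ring
  have e2 : (n : ℂ) + 1 = 3 * N + ν + 1 := by rw [hn']
  have e3 : (v : ℂ) - n = v - ν - 3 * N := by rw [hn']; ring
  have e4 : ((ν : ℂ) - n) * h = -(3 * N * h) := by rw [hn']; ring
  rw [e1, e2, e3, e4] at h1
  rw [vwpPrefactor, vwpSum, h1]
  have hinj : Set.InjOn (fun M : ℕ => 3 * M + ν) (Finset.range (N + 1)) :=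
    fun x _ y _ hxy => by simp only at hxy; omega
  have hsub : (Finset.range (N + 1)).image (fun M : ℕ => 3 * M + ν) ⊆ Finset.range (n + 1) := by
    intro j hj
    obtain ⟨M, hM, rfl⟩ := Finset.mem_image.mp hj
    have := Finset.mem_range.mp hM
    exact Finset.mem_range.mpr (by omega)
  rw [← Finset.sum_subset hsub, Finset.sum_image hinj]
  · refine Finset.sum_congr rfl fun M hM => ?_
    have := Finset.mem_range.mp hM
    rw [nodeSumClosed, if_pos (by omega), show (n - (3 * M + ν)) / 3 = N - M by omega]
  · intro j hj hj'
    rw [nodeSumClosed, if_neg, mul_zero, mul_zero]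
    intro h3
    have := Finset.mem_range.mp hj
    have := hr.1
    exact hj' (Finset.mem_image.mpr ⟨j / 3, Finset.mem_range.mpr (by omega), by omega⟩)

theorem aPoch_zero_left (hs : SigmaLike s) (h : ℂ) {k : ℕ} (hk : k ≠ 0) : aPoch s 0 h k = 0 := by
  obtain ⟨k, rfl⟩ := Nat.exists_eq_succ_of_ne_zero hk
  rw [Nat.succ_eq_add_one, aPoch_succ', hs.zero, zero_mul]

theorem reducedTerm_zero {a d h : ℂ} (ha : s a ≠ 0) (n : ℕ) : reducedTerm s n a d h 0 = 1 := by
  simp [reducedTerm, aPoch_zero, ha]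

theorem addCubicSum_zero (hs : SigmaLike s) {a c d h : ℂ} (ha : s a ≠ 0) (n : ℕ) :
    addCubicSum s n a 0 c d h = 1 := by
  rw [addCubicSum, Finset.sum_eq_single 0]
  · simp [reducedTerm_zero ha, aPoch_zero]
  · intro k _ hk
    rw [aPoch_zero_left hs _ hk]; simp
  · simp

theorem vwpSum_zero (hs : SigmaLike s) {a c d h : ℂ} (ν v N : ℕ)
    (hA : s (a + (v - 3 - 3 * N) * h) ≠ 0) : vwpSum s ν v N a 0 c d h = 1 := by
  rw [vwpSum, Finset.sum_eq_single 0]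
  · simp [vwpTerm, aPoch_zero, hA]
  · intro k _ hk
    simp [vwpTerm, aPoch_zero_left hs _ hk]
  · simp

/-- Any admissible `v` serves for the induction, since the closed form of the node sums does not
involve `v`. -/
theorem Residues.exists (n : ℕ) : ∃ N ν v, n = 3 * N + ν ∧ Residues ν v := by
  by_cases h : n % 3 = 0
  · exact ⟨n / 3, n % 3, 1, by omega, by unfold Residues; omega⟩
  · exact ⟨n / 3, n % 3, 0, by omega, by unfold Residues; omega⟩

/-- The node sums do not depend on `b` and `c`, so one convenient choice determines them. At `b = 0`
both sides of the transformation reduce to 1, and comparing the node expansions expresses the sum of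
length `n` through shorter ones. -/
theorem nodeSum_eq_closed (hs : SigmaLike s) {h : ℂ} (n : ℕ) : ∀ {a d : ℂ},
    GenericParams s a d h → nodeSum s n a d h = nodeSumClosed s n a d h := by
  induction n using Nat.strong_induction_on with
  | _ n ih =>
  intro a d H
  obtain ⟨N, ν, v, hn, hr⟩ := Residues.exists n
  -- With `b = 0` the balancing condition forces `c = 2 a + h - d`; then `a - c = d - a - h`, which
  -- makes the prefactor equal to 1.
  have hbc : 0 + (2 * a + h - d) + d = 2 * a + h := by ring
  have ha0 : s a ≠ 0 := by simpa using H.ha 0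
  have hb : ∀ l : ℤ, s (a + l * h - 0) ≠ 0 := fun l => by rw [sub_zero]; exact H.ha l
  have had' : ∀ l : ℤ, s (d - a + l * h) ≠ 0 := fun l => by
    rw [show d - a + l * h = -(a - d + ((-l : ℤ) : ℂ) * h) by push_cast; ring, hs.odd]
    exact neg_ne_zero.mpr (H.had _)
  have hc : ∀ l : ℤ, s (a + l * h - (2 * a + h - d)) ≠ 0 := fun l => by
    convert had' (l - 1) using 2; push_cast; ring
  have e1 := addCubicSum_eq_sum_nodes hs H hbc hb hc n
  have e2 := vwpSum_eq_sum_nodes hs H hbc hb hc hr N n hn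
  rw [addCubicSum_zero hs ha0] at e1
  rw [vwpSum_zero hs _ _ _ (by
    convert H.ha (v - 3 - 3 * N) using 2; push_cast; ring), mul_one] at e2
  have e3 : vwpPrefactor s ν v N a 0 (2 * a + h - d) d h = 1 := by
    have p1 : ∀ (x : ℤ) k, aPoch s (a + x * h) (3 * h) k ≠ 0 := fun x k =>
      aPoch_ne_zero fun i _ => by convert H.ha (x + 3 * i) using 2; push_cast; ring
    have p2 : ∀ (x : ℤ) k, aPoch s (d - a + x * h) (3 * h) k ≠ 0 := fun x k =>
      aPoch_ne_zero fun i _ => by convert had' (x + 3 * i) using 2; push_cast; ring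
    have q1 := p1 ν (N + 1)
    have q2 := p2 (ν - 1) (N + 1)
    have q3 := p1 (v - 3 * N) N
    have q4 := p2 (v - 1 - 3 * N) N
    have q5 := had' (-1)
    push_cast at q1 q2 q3 q4 q5
    rw [show d - a + -1 * h = d - a - h by ring] at q5
    rw [vwpPrefactor]
    simp only [sub_zero]
    rw [show a - (2 * a + h - d) = d - a - h by ring,
      show a + (ν : ℂ) * h - (2 * a + h - d) = d - a + (ν - 1) * h by ring,
      show a + (v - 3 * (N : ℂ)) * h - (2 * a + h - d) =
        d - a + (v - 1 - 3 * (N : ℂ)) * h by ring,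
      div_self (mul_ne_zero ha0 q5)]
    rw [div_self (mul_ne_zero q1 q2), div_self (mul_ne_zero q3 q4)]
    ring
  rw [e3, e1, Finset.sum_range_succ', Finset.sum_range_succ' _ n] at e2
  have e4 : ∀ j ∈ Finset.range n, nodeSum s (n - (j + 1)) (a + 4 * (j + 1 : ℕ) * h)
      (d + 2 * (j + 1 : ℕ) * h) h = nodeSumClosed s (n - (j + 1)) (a + 4 * (j + 1 : ℕ) * h)
      (d + 2 * (j + 1 : ℕ) * h) h := fun j hj => by
    have := Finset.mem_range.mp hj
    exact ih (n - (j + 1)) (by omega) (H.shift (j + 1))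
  rw [Finset.sum_congr rfl fun j hj => by rw [e4 j hj]] at e2
  -- The nodes `j ≥ 1` cancel by the induction hypothesis at the shifted parameters, leaving the
  -- node `j = 0`, whose explicit factors are all 1.
  have e5 := add_left_cancel e2
  have hW : s (a - 0) * s (a - (2 * a + h - d)) ≠ 0 := by
    have := mul_ne_zero (hb 0) (hc 0)
    simpa using this
  have e6 : nodeCoeff s a d h 0 0 = 1 := by simp [nodeCoeff, aPoch_zero]
  simp only [Nat.cast_zero, zero_mul, mul_zero, add_zero, Nat.sub_zero, reducedTerm_zero ha0, e6,
    div_self hW, one_mul] at e5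
  exact e5

/-- The cubic transformation for generic parameters. -/
theorem addCubicSum_eq_vwpSum (hs : SigmaLike s) {a b c d h : ℂ} (H : GenericParams s a d h)
    (hbc : b + c + d = 2 * a + h) (hb : ∀ l : ℤ, s (a + l * h - b) ≠ 0)
    (hc : ∀ l : ℤ, s (a + l * h - c) ≠ 0) {ν v : ℕ} (hr : Residues ν v) (N n : ℕ)
    (hn : n = 3 * N + ν) :
    addCubicSum s n a b c d h = vwpPrefactor s ν v N a b c d h * vwpSum s ν v N a b c d h := by
  rw [vwpSum_eq_sum_nodes hs H hbc hb hc hr N n hn, addCubicSum_eq_sum_nodes hs H hbc hb hc n]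
  exact Finset.sum_congr rfl fun j _ => by rw [nodeSum_eq_closed hs _ (H.shift j)]

end Algebra
-- Infinite products: zeros, continuity, finite q-binomial theorem
noncomputable section Theta

open Filter Topology

theorem summable_norm_mul_pow {p : ℂ} (hp : ‖p‖ < 1) (x : ℂ) :
    Summable fun k : ℕ => ‖-(x * p ^ k)‖ := by
  simp only [norm_neg, norm_mul, norm_pow]
  exact (summable_geometric_of_lt_one (norm_nonneg p) hp).mul_left _

theorem multipliable_pochInf {p : ℂ} (hp : ‖p‖ < 1) (x : ℂ) :
    Multipliable fun k : ℕ => 1 - x * p ^ k := by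
  simpa only [sub_eq_add_neg] using multipliable_one_add_of_summable (summable_norm_mul_pow hp x)

theorem tendsto_pochInf {p : ℂ} (hp : ‖p‖ < 1) (x : ℂ) :
    Tendsto (fun N => ∏ k ∈ Finset.range N, (1 - x * p ^ k)) atTop (𝓝 (pochInf x p)) :=
  (multipliable_pochInf hp x).hasProd.tendsto_prod_nat

theorem pochInf_step {p : ℂ} (hp : ‖p‖ < 1) (x : ℂ) :
    pochInf x p = (1 - x) * pochInf (p * x) p := by
  have h1 := (tendsto_pochInf hp x).comp (tendsto_add_atTop_nat 1)
  have h2 := (tendsto_pochInf hp (p * x)).const_mul (1 - x)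
  refine tendsto_nhds_unique h1 (h2.congr fun N => ?_)
  simp only [Function.comp_apply]
  rw [Finset.prod_range_succ', mul_comm, pow_zero, mul_one]
  congr 1
  exact Finset.prod_congr rfl fun k _ => by ring

theorem pochInf_ne_zero {p : ℂ} (hp : ‖p‖ < 1) {x : ℂ} (hx : ∀ k : ℕ, x * p ^ k ≠ 1) :
    pochInf x p ≠ 0 := by
  have := tprod_one_add_ne_zero_of_summable (f := fun k : ℕ => -(x * p ^ k))
    (fun k => by rw [← sub_eq_add_neg]; exact sub_ne_zero.mpr (hx k).symm)
    (summable_norm_mul_pow hp x)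
  simpa only [pochInf, sub_eq_add_neg] using this

theorem E_inv {p : ℂ} (hp : ‖p‖ < 1) {x : ℂ} (hx : x ≠ 0) : E p x⁻¹ = -(E p x) / x := by
  unfold E
  rw [pochInf_step hp x, pochInf_step hp x⁻¹, div_inv_eq_mul, div_eq_mul_inv p x]
  field_simp
  ring

/-- A vanishing factor would force `x` to be an integral power of `p`. Comparing only norms is
cruder, but it is what the genericity argument controls. -/
theorem E_ne_zero {p : ℂ} (hp : ‖p‖ < 1) {x : ℂ} (hx : x ≠ 0) (h : ∀ m : ℤ, ‖x‖ ≠ ‖p‖ ^ m) :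
    E p x ≠ 0 := by
  refine mul_ne_zero (pochInf_ne_zero hp fun k hk => ?_) (pochInf_ne_zero hp fun k hk => ?_)
  · apply h (-k)
    have := congrArg norm hk
    rw [norm_mul, norm_pow, norm_one] at this
    rw [zpow_neg, zpow_natCast]
    exact eq_inv_of_mul_eq_one_left this
  · apply h (k + 1 : ℕ)
    rw [zpow_natCast, ← norm_pow]
    congr 1
    field_simp at hk
    rw [pow_succ', hk]

theorem E_one {p : ℂ} (hp : ‖p‖ < 1) : E p 1 = 0 := by
  unfold E; rw [pochInf_step hp 1]; simp

theorem continuous_pochInf {p : ℂ} (hp : ‖p‖ < 1) : Continuous fun x => pochInf x p := by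
  rw [continuous_iff_continuousAt]
  intro x₀
  set K : Set ℂ := Metric.ball 0 (‖x₀‖ + 1)
  have hK : IsOpen K := Metric.isOpen_ball
  have hx₀ : x₀ ∈ K := by simp [K]
  have h := Summable.hasProdLocallyUniformlyOn_nat_one_add (f := fun (k : ℕ) (x : ℂ) => -(x * p ^ k)) hK
    (u := fun k : ℕ => (‖x₀‖ + 1) * ‖p‖ ^ k)
    ((summable_geometric_of_lt_one (norm_nonneg p) hp).mul_left _)
    (Eventually.of_forall fun k x hx => by
      rw [norm_neg, norm_mul, norm_pow]
      have : ‖x‖ < ‖x₀‖ + 1 := by simpa [K] using hx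
      gcongr)
    (fun k => by fun_prop)
  have hc : ContinuousOn (fun x => ∏' k : ℕ, (1 + -(x * p ^ k))) K :=
    TendstoLocallyUniformlyOn.continuousOn h
      (Frequently.of_forall fun s => by fun_prop)
  have := hc.continuousAt (hK.mem_nhds hx₀)
  simpa only [pochInf, sub_eq_add_neg] using this

theorem continuousAt_E {p : ℂ} (hp : ‖p‖ < 1) {x : ℂ} (hx : x ≠ 0) : ContinuousAt (E p) x := by
  have := continuous_pochInf hp
  exact this.continuousAt.mul (this.continuousAt.comp (continuousAt_const.div continuousAt_id hx))

/-- `(p; p)_m`. -/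
def qFactorial (p : ℂ) (m : ℕ) : ℂ := ∏ k ∈ Finset.range m, (1 - p * p ^ k)

theorem qFactorial_ne_zero {p : ℂ} (hp : ‖p‖ < 1) (m : ℕ) : qFactorial p m ≠ 0 :=
  Finset.prod_ne_zero_iff.mpr fun k _ hk => by
    have h1 : p ^ (k + 1) = 1 := by rw [pow_succ']; exact (sub_eq_zero.mp hk).symm
    have h2 : ‖p‖ ^ (k + 1) < 1 := pow_lt_one₀ (norm_nonneg p) hp (by omega)
    rw [← norm_pow, h1, norm_one] at h2
    exact lt_irrefl _ h2

theorem qFactorial_succ (p : ℂ) (m : ℕ) :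
    qFactorial p (m + 1) = qFactorial p m * (1 - p ^ (m + 1)) := by
  rw [qFactorial, Finset.prod_range_succ, ← qFactorial, pow_succ']

/-- Rothe's `q`-binomial theorem. -/
theorem rothe {p : ℂ} (hp : ‖p‖ < 1) (x : ℂ) (t : ℕ → ℂ) (h0 : t 0 = 1)
    (ht : ∀ m, t (m + 1) = -(x * p ^ m) * t m) (M : ℕ) :
    ∏ k ∈ Finset.range M, (1 - x * p ^ k) = ∑ m ∈ Finset.range (M + 1),
      t m * (qFactorial p M / (qFactorial p m * qFactorial p (M - m))) := by
  have hq := qFactorial_ne_zero hp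
  induction M with
  | zero => simp [h0, qFactorial]
  | succ M ih =>
    set g : ℕ → ℂ := fun m => t m * (qFactorial p M / (qFactorial p m * qFactorial p (M - m)))
      with hg
    have s1 : ∑ m ∈ Finset.range (M + 1), g m = ∑ m ∈ Finset.range M, g (m + 1) + g 0 :=
      Finset.sum_range_succ' _ _
    have s2 : (∑ m ∈ Finset.range (M + 1), g m) * (x * p ^ M) =
        ∑ m ∈ Finset.range M, g m * (x * p ^ M) + g M * (x * p ^ M) := by
      rw [Finset.sum_range_succ, add_mul, Finset.sum_mul]
    rw [Finset.prod_range_succ, ih, mul_sub, mul_one, s2, s1, Finset.sum_range_succ' _ (M + 1),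
      Finset.sum_range_succ _ M]
    have e1 : ∀ m ∈ Finset.range M,
        t (m + 1) * (qFactorial p (M + 1) / (qFactorial p (m + 1) * qFactorial p (M + 1 - (m + 1))))
        = t (m + 1) * (qFactorial p M / (qFactorial p (m + 1) * qFactorial p (M - (m + 1)))) -
          t m * (qFactorial p M / (qFactorial p m * qFactorial p (M - m))) * (x * p ^ M) := by
      intro m hm
      obtain ⟨k, rfl⟩ := Nat.exists_eq_add_of_lt (Finset.mem_range.mp hm)
      have hk := hq (k + 1)
      have hm1 := hq (m + 1)
      rw [show m + k + 1 + 1 - (m + 1) = k + 1 by omega, show m + k + 1 - (m + 1) = k by omega,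
        show m + k + 1 - m = k + 1 by omega, ht, qFactorial_succ p (m + k + 1)]
      rw [qFactorial_succ] at hk hm1
      rw [qFactorial_succ p k, qFactorial_succ p m]
      have a1 := left_ne_zero_of_mul hk
      have a2 := right_ne_zero_of_mul hk
      have a3 := left_ne_zero_of_mul hm1
      have a4 := right_ne_zero_of_mul hm1
      have a5 := hq (m + k + 1)
      field_simp
      ring
    have c1 : qFactorial p 0 = 1 := by simp [qFactorial]
    have g0 : g 0 = 1 := by simp [hg, c1, h0, hq M]
    have gM : g M = t M := by simp [hg, c1, hq M]
    have G0 : t 0 * (qFactorial p (M + 1) / (qFactorial p 0 * qFactorial p (M + 1 - 0))) = 1 := by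
      simp [c1, h0, hq (M + 1)]
    have GM : t (M + 1) * (qFactorial p (M + 1) /
        (qFactorial p (M + 1) * qFactorial p (M + 1 - (M + 1)))) = -(x * p ^ M) * t M := by
      simp [c1, hq (M + 1), ht]
    rw [Finset.sum_congr rfl e1, Finset.sum_sub_distrib, G0, GM, g0, gM]
    ring

end Theta
-- The Jacobi triple product and the addition formula
noncomputable section JacobiProduct

open Filter Topology Complex

theorem summable_gaussian {κ : ℂ} (hκ : κ.re < 0) (A B : ℂ) :
    Summable fun n : ℤ => exp (κ * n ^ 2 + A * n + B) := by
  have hpi : (Real.pi : ℂ) ≠ 0 := by exact_mod_cast Real.pi_ne_zero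
  have h := (summable_jacobiTheta₂_term_iff (A / (2 * Real.pi * I)) (-(I * κ) / Real.pi)).mpr (by
    rw [div_ofReal_im]
    simp only [neg_im, mul_im, I_re, I_im]
    exact div_pos (by linarith) Real.pi_pos)
  refine (h.mul_right (exp B)).congr fun n => ?_
  rw [jacobiTheta₂_term, ← exp_add]
  congr 1
  have h2 : 2 * (Real.pi : ℂ) * I * n * (A / (2 * Real.pi * I)) = A * n := by
    field_simp
  have h3 : (Real.pi : ℂ) * I * n ^ 2 * (-(I * κ) / Real.pi) = κ * n ^ 2 := by
    field_simp
    rw [I_sq]; ring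
  rw [h2, h3]; ring

/-- The terms of the theta series for `E`. -/
def thetaTerm (ω z : ℂ) (n : ℤ) : ℂ := exp (ω * ((n : ℂ) ^ 2 - n) / 2 + n * (z + Real.pi * I))

theorem summable_thetaTerm {ω : ℂ} (hω : ω.re < 0) (z : ℂ) : Summable (thetaTerm ω z) := by
  refine (summable_gaussian (κ := ω / 2) ?_ (z + Real.pi * I - ω / 2) 0).congr fun n => ?_
  · rw [show ω / 2 = ω / (2 : ℝ) by norm_num, div_ofReal_re]; linarith
  · rw [thetaTerm]; congr 1; ring

/-- The reciprocal of `(p; p)_m`, extended by zero to negative `m`. -/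
def invQFactorial (p : ℂ) (m : ℤ) : ℂ := if 0 ≤ m then (qFactorial p m.toNat)⁻¹ else 0

/-- This is the q-binomial theorem with `2 N` factors, recentred at its middle term. The sum is
written over all integers, with vanishing outer terms, so that dominated convergence applies
directly. -/
theorem finite_triple_product {ω : ℂ} (hp : ‖exp ω‖ < 1) (z : ℂ) (N : ℕ) :
    (∏ k ∈ Finset.range N, (1 - exp z * exp ω ^ k)) *
      ∏ k ∈ Finset.range N, (1 - exp ω / exp z * exp ω ^ k) =
    ∑' n : ℤ, thetaTerm ω z n * (qFactorial (exp ω) (2 * N) *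
      (invQFactorial (exp ω) (N + n) * invQFactorial (exp ω) (N - n))) := by
  set p := exp ω with hpdef
  let t : ℕ → ℂ := fun m => exp (m * (z - N * ω + Real.pi * I) + ω * ((m : ℂ) ^ 2 - m) / 2)
  -- Starting at `e^z p^{-N}`, the last `N` factors give the product in `e^z`, while the first `N`,
  -- inverted, give the product in `p / e^z` times `t N`.
  have hR := rothe hp (exp (z - N * ω)) t (by simp [t]) (fun m => by
    rw [show -(exp (z - N * ω) * p ^ m) = exp (z - N * ω) * p ^ m * exp (Real.pi * I) by
      rw [exp_pi_mul_I]; ring, hpdef]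
    simp only [t]
    rw [← exp_nat_mul, ← exp_add, ← exp_add, ← exp_add]
    congr 1; push_cast; ring) (2 * N)
  have hP : ∏ k ∈ Finset.range (2 * N), (1 - exp (z - N * ω) * p ^ k) =
      t N * ((∏ k ∈ Finset.range N, (1 - exp z * p ^ k)) *
        ∏ k ∈ Finset.range N, (1 - p / exp z * p ^ k)) := by
    rw [two_mul, Finset.prod_range_add, mul_comm (∏ k ∈ Finset.range N, (1 - exp z * p ^ k)),
      ← mul_assoc]
    congr 1
    · have ht : ∀ M : ℕ, ∏ k ∈ Finset.range M, -(exp z * exp (-(k + 1) * ω)) =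
          exp (M * (z + Real.pi * I) - ω * ((M : ℂ) ^ 2 + M) / 2) := by
        intro M
        induction M with
        | zero => simp
        | succ M ih =>
          rw [Finset.prod_range_succ, ih,
            show -(exp z * exp (-((M : ℂ) + 1) * ω)) =
              exp z * exp (-((M : ℂ) + 1) * ω) * exp (Real.pi * I) by rw [exp_pi_mul_I]; ring,
            ← exp_add, ← exp_add, ← exp_add]
          congr 1; push_cast; ring
      have htN : t N = exp (N * (z + Real.pi * I) - ω * ((N : ℂ) ^ 2 + N) / 2) := by
        simp only [t]; congr 1; ring
      rw [htN, ← ht N, ← Finset.prod_mul_distrib, ← Finset.prod_range_reflect]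
      refine Finset.prod_congr rfl fun k hk => ?_
      have hk' : k < N := Finset.mem_range.mp hk
      have e1 : exp (z - N * ω) * p ^ (N - 1 - k) = exp z * exp (-(k + 1) * ω) := by
        rw [hpdef, ← exp_nat_mul, ← exp_add, ← exp_add, Nat.sub_sub, Nat.cast_sub (by omega)]
        congr 1; push_cast; ring
      have e2 : exp z * exp (-(k + 1) * ω) * (p / exp z * p ^ k) = 1 := by
        rw [hpdef, ← exp_nat_mul, ← exp_sub, ← exp_add, ← exp_add, ← exp_add]
        convert exp_zero using 2; ring
      rw [e1]
      linear_combination -e2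
    · refine Finset.prod_congr rfl fun k _ => ?_
      rw [hpdef, ← exp_nat_mul, ← exp_nat_mul, ← exp_add, ← exp_add]
      congr 2; push_cast; ring
  have htN : t N ≠ 0 := exp_ne_zero _
  have hinj : Function.Injective fun m : ℕ => (m : ℤ) - N := fun x y h => by
    simp only at h; omega
  rw [hP] at hR
  apply mul_left_cancel₀ htN
  rw [hR, tsum_eq_sum (s := (Finset.range (2 * N + 1)).map ⟨_, hinj⟩), Finset.sum_map, Finset.mul_sum]
  · refine Finset.sum_congr rfl fun m hm => ?_
    have hm' : m < 2 * N + 1 := Finset.mem_range.mp hm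
    have e1 : t m = t N * thetaTerm ω z (m - N) := by
      simp only [t, thetaTerm, ← exp_add]; congr 1; push_cast; ring
    simp only [Function.Embedding.coeFn_mk]
    rw [e1, invQFactorial, invQFactorial, if_pos (by omega), if_pos (by omega),
      show ((N : ℤ) + (m - N)).toNat = m by omega,
      show ((N : ℤ) - (m - N)).toNat = 2 * N - m by omega]
    rw [div_eq_mul_inv, mul_inv]; ring
  · intro n hn
    have : ¬ (0 ≤ (N : ℤ) + n ∧ 0 ≤ (N : ℤ) - n) := fun h => hn (by
      simp only [Finset.mem_map, Finset.mem_range, Function.Embedding.coeFn_mk]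
      exact ⟨((N : ℤ) + n).toNat, by omega, by omega⟩)
    rw [not_and_or] at this
    rcases this with h | h <;> simp only [invQFactorial, if_neg h, mul_zero, zero_mul]

theorem tendsto_qFactorial {p : ℂ} (hp : ‖p‖ < 1) :
    Tendsto (qFactorial p) atTop (𝓝 (pochInf p p)) := tendsto_pochInf hp p

theorem pochInf_self_ne_zero {p : ℂ} (hp : ‖p‖ < 1) : pochInf p p ≠ 0 :=
  pochInf_ne_zero hp fun k hk => by
    have h2 : ‖p‖ ^ (k + 1) < 1 := pow_lt_one₀ (norm_nonneg p) hp (by omega)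
    rw [← norm_pow, pow_succ', hk, norm_one] at h2
    exact lt_irrefl _ h2

/-- The Jacobi triple product. -/
theorem jacobi_triple_product {ω : ℂ} (hω : ω.re < 0) (z : ℂ) :
    pochInf (exp ω) (exp ω) * E (exp ω) (exp z) = ∑' n, thetaTerm ω z n := by
  have hp : ‖exp ω‖ < 1 := by rw [norm_exp]; simpa using hω
  set p := exp ω with hpdef
  set c := pochInf p p
  have hc : c ≠ 0 := pochInf_self_ne_zero hp
  have hq := tendsto_qFactorial hp
  have hqi : Tendsto (fun m => (qFactorial p m)⁻¹) atTop (𝓝 c⁻¹) := hq.inv₀ hc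
  -- Convergence of `(p; p)_m` to a nonzero limit bounds it and its reciprocal uniformly, so a
  -- multiple of the theta term dominates.
  obtain ⟨C₁, hC₁⟩ := (Metric.isBounded_range_of_tendsto _ hq).exists_norm_le
  obtain ⟨C₂, hC₂⟩ := (Metric.isBounded_range_of_tendsto _ hqi).exists_norm_le
  have hC₂' : 0 ≤ C₂ := (norm_nonneg _).trans (hC₂ _ ⟨0, rfl⟩)
  have hinv : ∀ m : ℤ, ‖invQFactorial p m‖ ≤ C₂ := fun m => by
    unfold invQFactorial
    split_ifs
    · exact hC₂ _ ⟨_, rfl⟩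
    · simpa using hC₂'
  have hlim : ∀ g : ℕ → ℤ, Tendsto g atTop atTop →
      Tendsto (fun N => invQFactorial p (g N)) atTop (𝓝 c⁻¹) := fun g hg => by
    have h1 : Tendsto (fun N => (g N).toNat) atTop atTop :=
      tendsto_atTop.mpr fun b => by
        filter_upwards [hg.eventually_ge_atTop (b : ℤ)] with N hN
        omega
    refine (hqi.comp h1).congr' ?_
    filter_upwards [hg.eventually_ge_atTop 0] with N hN
    simp [invQFactorial, hN]
  have hcast : Tendsto (fun N : ℕ => (N : ℤ)) atTop atTop := tendsto_natCast_atTop_atTop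
  have key := tendsto_tsum_of_dominated_convergence (𝓕 := atTop)
    (f := fun (N : ℕ) (n : ℤ) => thetaTerm ω z n * (qFactorial p (2 * N) *
      (invQFactorial p (N + n) * invQFactorial p (N - n))))
    (g := fun n => thetaTerm ω z n * (c * (c⁻¹ * c⁻¹)))
    (bound := fun n => ‖thetaTerm ω z n‖ * (C₁ * (C₂ * C₂)))
    ((summable_thetaTerm hω z).norm.mul_right _)
    (fun n => ((hq.comp (tendsto_id.const_mul_atTop' (by norm_num : 0 < 2))).mul
      ((hlim _ (tendsto_atTop_add_const_right _ n hcast)).mul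
        (hlim _ (by simpa [sub_eq_add_neg] using tendsto_atTop_add_const_right _ (-n) hcast)))).const_mul _)
    (Eventually.of_forall fun N n => by
      rw [norm_mul, norm_mul, norm_mul]
      gcongr
      · exact (norm_nonneg _).trans (hC₁ _ ⟨0, rfl⟩)
      · exact hC₁ _ ⟨_, rfl⟩
      · exact hinv _
      · exact hinv _)
  have lhs := (tendsto_pochInf hp (exp z)).mul (tendsto_pochInf hp (p / exp z))
  have heq := tendsto_nhds_unique (lhs.congr fun N => finite_triple_product hp z N) key
  rw [tsum_mul_right] at heq
  rw [E, heq]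
  field_simp

/-- The odd function `e^{-u/2} E(e^u)`. -/
def sigmaE (p u : ℂ) : ℂ := exp (-u / 2) * E p (exp u)

/-- `∑ p^{j²} e^{2ju}`. -/
def thetaEven (ω u : ℂ) (j : ℤ) : ℂ := exp (ω * (j : ℂ) ^ 2 + 2 * j * u)

/-- `∑ p^{j² - j} e^{(2j-1)u}`. -/
def thetaOdd (ω u : ℂ) (j : ℤ) : ℂ := exp (ω * ((j : ℂ) ^ 2 - j) + (2 * j - 1) * u)

theorem summable_thetaEven {ω : ℂ} (hω : ω.re < 0) (u : ℂ) :
    Summable fun j => ‖thetaEven ω u j‖ :=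
  (Summable.congr (summable_gaussian hω (2 * u) 0) fun j => by
    rw [thetaEven]; congr 1; ring).norm

theorem summable_thetaOdd {ω : ℂ} (hω : ω.re < 0) (u : ℂ) :
    Summable fun j => ‖thetaOdd ω u j‖ :=
  (Summable.congr (summable_gaussian hω (2 * u - ω) (-u)) fun j => by
    rw [thetaOdd]; congr 1; ring).norm

/-- The pairs of integers as `(i + j, i - j)` and `(i + j, i - j + 1)`, according to the parity of
the sum. -/
def paritySplit : (ℤ × ℤ) ⊕ (ℤ × ℤ) ≃ ℤ × ℤ :=
  Equiv.ofBijective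
    (Sum.elim (fun x => (x.1 + x.2, x.1 - x.2)) (fun x => (x.1 + x.2, x.1 - x.2 + 1)))
    ⟨by
      rintro (⟨i, j⟩ | ⟨i, j⟩) (⟨k, l⟩ | ⟨k, l⟩) h <;>
        simp only [Sum.elim_inl, Sum.elim_inr, Prod.mk.injEq, Sum.inl.injEq, Sum.inr.injEq,
          reduceCtorEq] at h ⊢ <;> omega, by
      rintro ⟨m, n⟩
      rcases Int.even_or_odd' (m + n) with ⟨i, hi | hi⟩
      · exact ⟨Sum.inl (i, m - i), by simp only [Sum.elim_inl, Prod.mk.injEq]; omega⟩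
      · exact ⟨Sum.inr (i, m - i), by simp only [Sum.elim_inr, Prod.mk.injEq]; omega⟩⟩

theorem paritySplit_inl (x : ℤ × ℤ) : paritySplit (Sum.inl x) = (x.1 + x.2, x.1 - x.2) := rfl

theorem paritySplit_inr (x : ℤ × ℤ) : paritySplit (Sum.inr x) = (x.1 + x.2, x.1 - x.2 + 1) := rfl

/-- In the product of the two theta series, index pairs of even and odd sum separate the variables
`u` and `w`; odd sums carry the sign -1. The result is a 2 × 2 determinant in the even and odd theta
series. -/
theorem pairW_sigmaE {ω : ℂ} (hω : ω.re < 0) (u w : ℂ) :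
    pochInf (exp ω) (exp ω) ^ 2 * pairW (sigmaE (exp ω)) u w =
      (∑' j, thetaOdd ω u j) * (∑' j, thetaEven ω w j) -
        (∑' j, thetaEven ω u j) * ∑' j, thetaOdd ω w j := by
  have hT := fun z => (summable_thetaTerm hω z).norm
  have e1 : pochInf (exp ω) (exp ω) ^ 2 * pairW (sigmaE (exp ω)) u w =
      exp (-u) * ((∑' n, thetaTerm ω (u + w) n) * ∑' n, thetaTerm ω (u - w) n) := by
    rw [← jacobi_triple_product hω, ← jacobi_triple_product hω, pairW, sigmaE, sigmaE,
      show exp (-u) = exp (-(u + w) / 2) * exp (-(u - w) / 2) by rw [← exp_add]; congr 1; ring]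
    ring
  have hsum := (summable_mul_of_summable_norm (hT (u + w)) (hT (u - w))).hasSum.mul_left (exp (-u))
  rw [← tsum_mul_tsum_of_summable_norm (hT _) (hT _), ← e1, ← paritySplit.hasSum_iff] at hsum
  have h1 := (summable_mul_of_summable_norm (summable_thetaOdd hω u)
    (summable_thetaEven hω w)).hasSum
  have h2 := (summable_mul_of_summable_norm (summable_thetaEven hω u)
    (summable_thetaOdd hω w)).hasSum.neg
  rw [← tsum_mul_tsum_of_summable_norm (summable_thetaOdd hω u) (summable_thetaEven hω w)] at h1
  rw [← tsum_mul_tsum_of_summable_norm (summable_thetaEven hω u) (summable_thetaOdd hω w)] at h2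
  rw [sub_eq_add_neg]
  refine hsum.unique (HasSum.sum ?_ ?_)
  · refine Eq.mpr (congrArg (HasSum · _) (funext fun x => ?_)) h1
    simp only [Function.comp_apply, paritySplit_inl, thetaTerm, thetaOdd, thetaEven]
    rw [← exp_add, ← exp_add, ← exp_add, exp_eq_exp_iff_exists_int]
    exact ⟨x.1, by push_cast; ring⟩
  · refine Eq.mpr (congrArg (HasSum · _) (funext fun x => ?_)) h2
    simp only [Function.comp_apply, paritySplit_inr, thetaTerm, thetaOdd, thetaEven]
    rw [← exp_add, ← exp_add, ← exp_add, ← exp_add_pi_mul_I, exp_eq_exp_iff_exists_int]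
    exact ⟨x.1, by push_cast; ring⟩

theorem pairW_sigmaE_zero (u w : ℂ) :
    pairW (sigmaE 0) u w = exp u + exp (-u) - (exp w + exp (-w)) := by
  have h : ∀ z, sigmaE 0 z = exp (-z / 2) - exp (z / 2) := fun z => by
    have h0 : ∀ x, pochInf x 0 = 1 - x := fun x => by
      rw [pochInf_step (by simp), zero_mul]; simp [pochInf]
    rw [sigmaE, E, h0, h0, zero_div, sub_zero, mul_one, mul_sub, mul_one, ← exp_add]
    congr 2; ring
  rw [pairW, h, h, sub_mul, mul_sub, mul_sub, ← exp_add, ← exp_add, ← exp_add, ← exp_add]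
  ring_nf

/-- Once `pairW` is a 2 × 2 determinant, the addition formula is the Plücker relation. For `p = 0`,
where `log p` is not available, the difference of two hyperbolic cosines plays the same role. -/
theorem sigmaLike_sigmaE {p : ℂ} (hp : ‖p‖ < 1) : SigmaLike (sigmaE p) where
  odd u := by
    have h := exp_ne_zero u
    rw [sigmaE, sigmaE, exp_neg, E_inv hp h, show -(-u) / 2 = -u / 2 + u by ring, exp_add]
    field_simp
  add x y u v := by
    rcases eq_or_ne p 0 with rfl | hp0
    · simp only [pairW_sigmaE_zero]; ring
    · have hω : (log p).re < 0 := by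
        rw [log_re]; exact Real.log_neg (norm_pos_iff.mpr hp0) hp
      have h := pairW_sigmaE hω
      rw [exp_log hp0] at h
      have hc := pow_ne_zero 2 (pochInf_self_ne_zero hp)
      apply mul_left_cancel₀ (mul_ne_zero hc hc)
      rw [mul_zero, show ∀ A B C D F G c : ℂ, c * c * (A * B - C * D + F * G) =
        (c * A) * (c * B) - (c * C) * (c * D) + (c * F) * (c * G) from fun _ _ _ _ _ _ _ => by ring]
      simp only [h]
      ring

end JacobiProduct
-- Translation between multiplicative and additive notation
noncomputable section Translation

open Complex

variable {p : ℂ}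

theorem E_exp (p u : ℂ) : E p (exp u) = exp (u / 2) * sigmaE p u := by
  rw [sigmaE, ← mul_assoc, ← exp_add, neg_div, add_neg_cancel, exp_zero, one_mul]

theorem sigmaE_ne_zero_iff (p u : ℂ) : sigmaE p u ≠ 0 ↔ E p (exp u) ≠ 0 := by
  rw [E_exp, mul_ne_zero_iff, and_iff_right (exp_ne_zero _)]

/-- The logarithm of the factor by which `poch` and `aPoch` differ. -/
def pochWeight (x h : ℂ) (k : ℕ) : ℂ := (k * x + ((k : ℂ) ^ 2 - k) / 2 * h) / 2

theorem poch_exp (p x h : ℂ) (k : ℕ) :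
    poch (exp x) (exp h) p k = exp (pochWeight x h k) * aPoch (sigmaE p) x h k := by
  induction k with
  | zero => simp [poch, pochWeight, aPoch]
  | succ k ih =>
    rw [poch, Finset.prod_range_succ, ← poch, ih, aPoch_succ, ← exp_nat_mul, ← exp_add, E_exp,
      show pochWeight x h (k + 1) = pochWeight x h k + (x + k * h) / 2 by
        simp only [pochWeight]; push_cast; ring, exp_add]
    ring

theorem pochs_cons (x : ℂ) (xs : List ℂ) (q : ℂ) (k : ℕ) :
    pochs (x :: xs) q p k = poch x q p k * pochs xs q p k := by simp [pochs]

theorem pochs_nil (q : ℂ) (k : ℕ) : pochs [] q p k = 1 := by simp [pochs]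

theorem cubicSum_exp (p : ℂ) (n : ℕ) {a b c d e h : ℂ} (hbc : b + c + d = 2 * a + h)
    (he : d + e = a + (n + 1) * h) :
    cubicSum (exp a) (exp b) (exp c) (exp d) (exp e) (exp h) p n =
      addCubicSum (sigmaE p) n a b c d h := by
  refine Finset.sum_congr rfl fun k _ => ?_
  obtain rfl : e = a + (n + 1) * h - d := by linear_combination he
  obtain rfl : c = 2 * a + h - b - d := by linear_combination hbc
  have e1 : exp a * exp h ^ (4 * k) = exp (a + 4 * k * h) := by
    rw [← exp_nat_mul, ← exp_add]; push_cast; rfl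
  have e2 : exp h ^ 3 = exp (3 * h) := by rw [← exp_nat_mul]; rfl
  have e3 : ∀ x, exp a * exp h / exp x = exp (a + h - x) := fun x => by rw [← exp_add, ← exp_sub]
  have e4 : exp h ^ (-(n : ℤ)) = exp (-(n * h)) := by rw [← exp_int_mul]; congr 1; push_cast; ring
  have e5 : exp a * exp h ^ 3 / exp (a + (n + 1) * h - d) = exp (d + (2 - n) * h) := by
    rw [e2, ← exp_add, ← exp_sub]; congr 1; ring
  have e6 : exp a * exp h ^ (n + 3) = exp (a + (n + 3) * h) := by
    rw [← exp_nat_mul, ← exp_add]; push_cast; rfl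
  rw [e1, e3, e3, e3, e4, e5, e6, e2, ← exp_nat_mul]
  simp only [pochs_cons, pochs_nil, mul_one, poch_exp, E_exp, reducedTerm]
  -- The exponential weights, including `q^k`, cancel in each term; the relations for `c` and `e`
  -- have already been substituted.
  have key : exp ((a + 4 * k * h) / 2) / exp (a / 2) *
      (exp (pochWeight b (3 * h) k) * exp (pochWeight (2 * a + h - b - d) (3 * h) k) /
        (exp (pochWeight (a + h - b) h k) *
          exp (pochWeight (a + h - (2 * a + h - b - d)) h k))) *
      (exp (pochWeight d h (2 * k)) / exp (pochWeight (a + h - d) h (2 * k))) *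
      (exp (pochWeight (a + (n + 1) * h - d) h k) * exp (pochWeight (-(n * h)) h k) /
        (exp (pochWeight (d + (2 - n) * h) (3 * h) k) *
          exp (pochWeight (a + (n + 3) * h) (3 * h) k))) * exp (k * h) = 1 := by
    simp only [← exp_add, ← exp_sub]
    convert exp_zero using 2
    simp only [pochWeight]; push_cast; ring
  refine Eq.trans ?_ ((congrArg (· * _) key).trans (one_mul _))
  simp only [div_eq_mul_inv, mul_inv]
  ring

/-- The first `N + 1` terms of `omega`. -/
def omegaPartial (a₁ : ℂ) (as : List ℂ) (q p : ℂ) (N : ℕ) : ℂ :=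
  ∑ k ∈ Finset.range (N + 1), E p (a₁ * q ^ (2 * k)) / E p a₁ *
    (pochs (a₁ :: as) q p k * q ^ k / vwpDenom a₁ as q p k)

/-- Beyond `N` the numerator contains the factor `E(1) = 0`. The finite form is needed for
continuity in the parameters. -/
theorem omega_eq_omegaPartial (hp : ‖p‖ < 1) {a₁ q : ℂ} (hq : q ≠ 0) {as : List ℂ} {N : ℕ}
    (h : q ^ (-N : ℤ) ∈ as) : omega a₁ as q p = omegaPartial a₁ as q p N := by
  refine tsum_eq_sum fun k hk => ?_
  have hk' : N < k := by simpa using hk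
  have h0 : poch (q ^ (-N : ℤ)) q p k = 0 :=
    Finset.prod_eq_zero (Finset.mem_range.mpr hk') (by
      rw [zpow_neg, zpow_natCast, inv_mul_cancel₀ (pow_ne_zero _ hq), E_one hp])
  have h1 : pochs (a₁ :: as) q p k = 0 :=
    List.prod_eq_zero (List.mem_map.mpr ⟨_, List.mem_cons_of_mem _ h, h0⟩)
  rw [h1]; simp

theorem omega_perm {as bs : List ℂ} (h : as.Perm bs) (a₁ q p : ℂ) :
    omega a₁ as q p = omega a₁ bs q p := by
  unfold omega vwpDenom pochs
  simp only [List.map_cons, List.prod_cons, (h.map _).prod_eq, ((h.map _).map _).prod_eq]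

theorem pochs_div_pochs_exp (p A h : ℂ) (k : ℕ) (xs : List ℂ) :
    pochs (xs.map exp) (exp h) p k / pochs ((xs.map exp).map fun x => exp A * exp h / x) (exp h) p k =
      exp (k * (xs.sum - xs.length * (A + h) / 2)) *
        (xs.map fun x => aPoch (sigmaE p) x h k / aPoch (sigmaE p) (A + h - x) h k).prod := by
  induction xs with
  | nil => simp [pochs]
  | cons x xs ih =>
    simp only [List.map_cons, pochs_cons, List.prod_cons, List.sum_cons, List.length_cons]
    rw [mul_div_mul_comm, ih, ← exp_add, ← exp_sub, poch_exp, poch_exp, mul_div_mul_comm,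
      ← exp_sub, mul_mul_mul_comm, ← exp_add]
    congr 2
    simp only [pochWeight]; push_cast; ring

/-- The condition on the sum of the seven parameters is the elliptic balancing condition; it makes
the exponential weights, including the power of q, cancel in each term. -/
theorem omega_exp (hp : ‖p‖ < 1) {A H : ℂ} {xs : List ℂ} (hlen : xs.length = 7)
    (hsum : xs.sum = 3 * A + 2 * H) {N : ℕ} (hN : -(N * H) ∈ xs) :
    omega (exp A) (xs.map exp) (exp H) p =
      ∑ m ∈ Finset.range (N + 1), vwpTerm (sigmaE p) A xs H m := by
  rw [omega_eq_omegaPartial hp (exp_ne_zero H) (N := N)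
    (List.mem_map.mpr ⟨_, hN, by rw [← exp_int_mul]; congr 1; push_cast; ring⟩)]
  refine Finset.sum_congr rfl fun k _ => ?_
  have h1 := pochs_div_pochs_exp p A H k xs
  rw [hlen, hsum] at h1
  rw [vwpDenom, pochs_cons, pochs_cons, mul_right_comm, mul_div_mul_comm, h1, vwpTerm,
    ← exp_nat_mul, ← exp_nat_mul, ← exp_add, E_exp, E_exp, poch_exp, poch_exp]
  have key : exp ((A + (2 * k : ℕ) * H) / 2) / exp (A / 2) *
      (exp (pochWeight A H k) * exp (k * H) / exp (pochWeight H H k)) *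
      exp (k * (3 * A + 2 * H - (7 : ℕ) * (A + H) / 2)) = 1 := by
    simp only [← exp_add, ← exp_sub]
    convert exp_zero using 2
    simp only [pochWeight]; push_cast; ring
  rw [show A + ((2 * k : ℕ) : ℂ) * H = A + 2 * k * H by push_cast; ring] at key ⊢
  rw [← one_mul (_ * _ * (List.prod _)), ← key]
  simp only [div_eq_mul_inv, mul_inv]
  ring

theorem pochs_ratio_exp (p h : ℂ) (k : ℕ) {x₁ x₂ x₃ x₄ y₁ y₂ y₃ y₄ : ℂ}
    (hxy : x₁ + x₂ + x₃ + x₄ = y₁ + y₂ + y₃ + y₄) :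
    pochs [exp x₁, exp x₂, exp x₃, exp x₄] (exp h) p k /
        pochs [exp y₁, exp y₂, exp y₃, exp y₄] (exp h) p k =
      aPoch (sigmaE p) x₁ h k * aPoch (sigmaE p) x₂ h k * aPoch (sigmaE p) x₃ h k *
          aPoch (sigmaE p) x₄ h k /
        (aPoch (sigmaE p) y₁ h k * aPoch (sigmaE p) y₂ h k * aPoch (sigmaE p) y₃ h k *
          aPoch (sigmaE p) y₄ h k) := by
  simp only [pochs_cons, pochs_nil, mul_one, poch_exp]
  have key : exp (pochWeight x₁ h k) * exp (pochWeight x₂ h k) * exp (pochWeight x₃ h k) *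
      exp (pochWeight x₄ h k) / (exp (pochWeight y₁ h k) * exp (pochWeight y₂ h k) *
        exp (pochWeight y₃ h k) * exp (pochWeight y₄ h k)) = 1 := by
    simp only [← exp_add, ← exp_sub]
    convert exp_zero using 2
    simp only [pochWeight]
    linear_combination (k : ℂ) / 2 * hxy
  rw [← one_mul (_ / (aPoch _ _ _ _ * _ * _ * _)), ← key]
  simp only [div_eq_mul_inv, mul_inv]
  ring

theorem EProd_eq_pochs (p q : ℂ) (xs : List ℂ) : EProd p xs = pochs xs q p 1 := by
  simp [EProd, pochs, poch]

end Translation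
-- Identification of the prefactors; the identity for generic parameters
noncomputable section Generic

open Complex

variable {s : ℂ → ℂ} {p : ℂ}

/-- The numerator of the factor in front of the very-well-poised series, in additive notation,
divided by its denominator. -/
def addPrefactor (s : ℂ → ℂ) (κ l : ℤ) (a b c d h H : ℂ) (M : ℕ) : ℂ :=
  aPoch s (a + κ * h) H M * aPoch s (d - a + (κ - 1) * h) H M *
      aPoch s (c - a + (l - 1) * h) H M * aPoch s (b - a + (l - 1) * h) H M /
    (aPoch s (a - b + κ * h) H M * aPoch s (a - c + κ * h) H M * aPoch s (a - d + l * h) H M *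
      aPoch s (-a + (l - 1) * h) H M)

theorem vwpPrefactor_reflect (hs : SigmaLike s) (ν v N : ℕ) (a b c d h : ℂ) :
    vwpPrefactor s ν v N a b c d h = s (a - b) * s (a - c) / (s a * s (d - a - h)) *
      (aPoch s (a + ν * h) (3 * h) (N + 1) * aPoch s (d - a + (ν - 1) * h) (3 * h) (N + 1) /
        (aPoch s (a - b + ν * h) (3 * h) (N + 1) * aPoch s (a - c + ν * h) (3 * h) (N + 1))) *
      (aPoch s (b - a + (3 - v) * h) (3 * h) N * aPoch s (c - a + (3 - v) * h) (3 * h) N /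
        (aPoch s (-a + (3 - v) * h) (3 * h) N * aPoch s (a - d + (4 - v) * h) (3 * h) N)) := by
  rw [vwpPrefactor, hs.aPoch_reflect (a + (v - 3 * N) * h - b),
    hs.aPoch_reflect (a + (v - 3 * N) * h - c), hs.aPoch_reflect (a + (v - 3 * N) * h),
    hs.aPoch_reflect (d - a + (v - 1 - 3 * N) * h)]
  have h1 : ((-1 : ℂ) ^ N) ≠ 0 := pow_ne_zero _ (by norm_num)
  rw [mul_mul_mul_comm ((-1 : ℂ) ^ N) (aPoch _ _ _ _),
    mul_mul_mul_comm ((-1 : ℂ) ^ N) (aPoch _ _ _ _),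
    mul_div_mul_left _ _ (mul_ne_zero h1 h1)]
  congr 1
  · congr 2; congr 1 <;> congr 1 <;> ring
  · congr 2 <;> congr 1 <;> ring

/-- For `ν = 0` the isolated factor of the prefactor cancels the first factors of the products of
length `N + 1`, leaving length `N` and starting shift 3. -/
theorem vwpPrefactor_zero (hs : SigmaLike s) {a b c d h : ℂ} (H : GenericParams s a d h)
    (hb : ∀ l : ℤ, s (a + l * h - b) ≠ 0) (hc : ∀ l : ℤ, s (a + l * h - c) ≠ 0) (v N : ℕ) :
    vwpPrefactor s 0 v N a b c d h = addPrefactor s 3 (4 - v) a b c d h (3 * h) N := by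
  have n1 : s (a - b) ≠ 0 := by simpa using hb 0
  have n2 : s (a - c) ≠ 0 := by simpa using hc 0
  have n3 : s a ≠ 0 := by simpa using H.ha 0
  have n4 : s (d - a - h) ≠ 0 := by
    rw [← neg_ne_zero, ← hs.odd]; convert H.had 1 using 2; push_cast; ring
  rw [vwpPrefactor_reflect hs, addPrefactor, aPoch_succ', aPoch_succ', aPoch_succ', aPoch_succ']
  push_cast
  rw [show a + 0 * h = a by ring, show d - a + (0 - 1) * h = d - a - h by ring,
    show a - b + 0 * h = a - b by ring, show a - c + 0 * h = a - c by ring,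
    show d - a - h + 3 * h = d - a + (3 - 1) * h by ring,
    show (4 : ℂ) - v - 1 = 3 - v by ring]
  generalize aPoch s (a + 3 * h) (3 * h) N = x₁
  generalize aPoch s (d - a + (3 - 1) * h) (3 * h) N = x₂
  generalize aPoch s (a - b + 3 * h) (3 * h) N = x₃
  generalize aPoch s (a - c + 3 * h) (3 * h) N = x₄
  rw [mul_mul_mul_comm (s a), mul_mul_mul_comm (s (a - b)), mul_div_mul_comm (s a * _), ← mul_assoc,
    div_mul_div_cancel₀ (mul_ne_zero n3 n4), div_self (mul_ne_zero n1 n2), one_mul]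
  simp only [div_eq_mul_inv, mul_inv]
  ring

/-- The products of length `N` are completed to length `N + 1` by a factor in front; together with
the isolated factors these give the quotient of four E's in `h_n`. -/
theorem vwpPrefactor_pos (hs : SigmaLike s) {a b c d h : ℂ} (H : GenericParams s a d h)
    (hb : ∀ l : ℤ, s (a + l * h - b) ≠ 0) (hc : ∀ l : ℤ, s (a + l * h - c) ≠ 0) (ν v N : ℕ) :
    vwpPrefactor s ν v N a b c d h = addPrefactor s v 1 a b c d h h 1 *
      addPrefactor s ν (1 - v) a b c d h (3 * h) (N + 1) := by
  have n1 : s (a + v * h - b) ≠ 0 := by simpa using hb v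
  have n2 : s (a + v * h - c) ≠ 0 := by simpa using hc v
  have n3 : s (a + v * h) ≠ 0 := by simpa using H.ha v
  have n4 : s (a - d + (1 - v) * h) ≠ 0 := by simpa using H.had (1 - v)
  have one : ∀ x h, aPoch s x h 1 = s x := fun x h => by simp [aPoch]
  rw [vwpPrefactor_reflect hs]
  simp only [addPrefactor, one]
  push_cast
  rw [show (1 : ℂ) - v - 1 = -v by ring, aPoch_succ' (x := c - a + -v * h),
    aPoch_succ' (x := b - a + -v * h), aPoch_succ' (x := a - d + (1 - v) * h),
    aPoch_succ' (x := -a + -v * h),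
    show c - a + -v * h = -(a + v * h - c) by ring, show b - a + -v * h = -(a + v * h - b) by ring,
    show -a + -v * h = -(a + v * h) by ring, show d - a + (v - 1) * h = -(a - d + (1 - v) * h) by ring,
    show c - a + (1 - 1) * h = -(a - c) by ring, show b - a + (1 - 1) * h = -(a - b) by ring,
    show -a + (1 - 1) * h = -a by ring, show a - d + 1 * h = -(d - a - h) by ring,
    show a - b + v * h = a + v * h - b by ring, show a - c + v * h = a + v * h - c by ring,
    show -(a + v * h - c) + 3 * h = c - a + (3 - v) * h by ring,
    show -(a + v * h - b) + 3 * h = b - a + (3 - v) * h by ring,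
    show -(a + v * h) + 3 * h = -a + (3 - v) * h by ring,
    show a - d + (1 - v) * h + 3 * h = a - d + (4 - v) * h by ring]
  simp only [hs.odd]
  generalize s (a + v * h - b) = z₁ at *
  generalize s (a + v * h - c) = z₂ at *
  generalize s (a + v * h) = z₃ at *
  generalize s (a - d + (1 - v) * h) = z₄ at *
  have key : z₁ * z₁⁻¹ * (z₂ * z₂⁻¹) * (z₃ * z₃⁻¹) * (z₄ * z₄⁻¹) = 1 := by
    rw [mul_inv_cancel₀ n1, mul_inv_cancel₀ n2, mul_inv_cancel₀ n3, mul_inv_cancel₀ n4]; norm_num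
  refine ((congrArg (· * _) key).trans (one_mul _)).symm.trans ?_
  generalize s (a - b) = w₁
  generalize s (a - c) = w₂
  generalize s a = w₃
  generalize s (d - a - h) = w₄
  simp only [div_eq_mul_inv, mul_inv, inv_neg]
  ring

/-- The list of numerator parameters of the factor in front of the very-well-poised series. -/
def prefactorNum (a b c d q : ℂ) (κ l : ℤ) : List ℂ :=
  [a * q ^ κ, a * q ^ κ / (b * c), a * q ^ l / (b * d), a * q ^ l / (c * d)]

/-- The list of denominator parameters of the factor in front of the very-well-poised series. -/
def prefactorDen (a b c d q : ℂ) (κ l : ℤ) : List ℂ :=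
  [a * q ^ κ / b, a * q ^ κ / c, a * q ^ l / d, a * q ^ l / (b * c * d)]

theorem prefactor_exp (p : ℂ) (κ l : ℤ) {a b c d h : ℂ} (H : ℂ) (M : ℕ)
    (hbc : b + c + d = 2 * a + h) :
    pochs (prefactorNum (exp a) (exp b) (exp c) (exp d) (exp h) κ l) (exp H) p M /
        pochs (prefactorDen (exp a) (exp b) (exp c) (exp d) (exp h) κ l) (exp H) p M =
      addPrefactor (sigmaE p) κ l a b c d h H M := by
  obtain rfl : c = 2 * a + h - b - d := by linear_combination hbc
  simp only [prefactorNum, prefactorDen, ← exp_int_mul, ← exp_add, ← exp_sub]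
  rw [pochs_ratio_exp p H M (by ring), addPrefactor]
  have hmul : ∀ {x₁ x₂ x₃ x₄ y₁ y₂ y₃ y₄ : ℂ}, x₁ = y₁ → x₂ = y₂ → x₃ = y₃ → x₄ = y₄ →
      x₁ * x₂ * x₃ * x₄ = y₁ * y₂ * y₃ * y₄ := by
    rintro _ _ _ _ _ _ _ _ rfl rfl rfl rfl; rfl
  refine congrArg₂ (· / ·) (hmul ?_ ?_ ?_ ?_) (hmul ?_ ?_ ?_ ?_) <;> (congr 1 <;> ring)

/-- The parameters of the very-well-poised series. -/
def omegaParams (a b c d e q : ℂ) (n : ℕ) (t i j : ℤ) : List ℂ :=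
  [a * q ^ (t - 1) / d, a / e, b, c, d * q ^ t, q ^ (i - n), q ^ (j - n)]

theorem omegaParams_perm (a b c d e q : ℂ) (n : ℕ) (t i j : ℤ) :
    (omegaParams a b c d e q n t i j).Perm (omegaParams a b c d e q n t j i) := by
  unfold omegaParams
  iterate 5 apply List.Perm.cons
  exact List.Perm.swap _ _ _

theorem omega_eq_vwpSum (hp : ‖p‖ < 1) {ν v N n : ℕ} (hn : n = 3 * N + ν)
    {a b c d e h : ℂ} (hbc : b + c + d = 2 * a + h) (he : d + e = a + (n + 1) * h) :
    omega (exp a ^ 2 * exp h ^ ((ν + v - 1 : ℤ) - 1) / (exp d * exp e))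
      (omegaParams (exp a) (exp b) (exp c) (exp d) (exp e) (exp h) n (ν + v - 1) v ν)
      (exp h ^ 3) p = vwpSum (sigmaE p) ν v N a b c d h := by
  obtain rfl : e = a + (n + 1) * h - d := by linear_combination he
  obtain rfl : c = 2 * a + h - b - d := by linear_combination hbc
  subst hn
  rw [vwpSum, ← omega_exp hp rfl ?_ ?_]
  · congr 1
    · rw [← exp_nat_mul, ← exp_int_mul, ← exp_add, ← exp_add, ← exp_sub]
      congr 1; push_cast; ring
    · simp only [omegaParams, List.map_cons, List.map_nil, ← exp_int_mul, ← exp_add, ← exp_sub]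
      congr 1
      · congr 1; push_cast; ring
      congr 1
      · congr 1; push_cast; ring
      congr 3
      · congr 1; push_cast; ring
      congr 1
      · congr 1; push_cast; ring
      congr 1
      · congr 1; push_cast; ring
    · rw [← exp_nat_mul]; rfl
  · simp only [List.sum_cons, List.sum_nil]; ring
  · simp only [List.mem_cons]
    right; right; right; right; right; right; left; ring

/-- The exponent `m` switches the extra quotient of `h_n` on or off. It may be dropped when `ν = 0`,
by the telescoped prefactor, and when `v = 0`, where the quotient is 1. -/
theorem cubicSum_eq_of_generic (hp : ‖p‖ < 1) {ν v N n m M : ℕ} {κ l : ℤ} (hr : Residues ν v)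
    (hn : n = 3 * N + ν)
    (hcase : (ν = 0 ∧ κ = 3 ∧ l = 4 - v ∧ M = N ∧ m = 0) ∨
      (κ = ν ∧ l = 1 - v ∧ M = N + 1 ∧ (v = 0 ∧ m = 0 ∨ m = 1)))
    {a b c d e h : ℂ} (H : GenericParams (sigmaE p) a d h)
    (hb : ∀ l : ℤ, sigmaE p (a + l * h - b) ≠ 0) (hc : ∀ l : ℤ, sigmaE p (a + l * h - c) ≠ 0)
    (hbc : b + c + d = 2 * a + h) (he : d + e = a + (n + 1) * h) :
    cubicSum (exp a) (exp b) (exp c) (exp d) (exp e) (exp h) p n =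
      pochs (prefactorNum (exp a) (exp b) (exp c) (exp d) (exp h) v 1) (exp h) p m /
        pochs (prefactorDen (exp a) (exp b) (exp c) (exp d) (exp h) v 1) (exp h) p m *
      (pochs (prefactorNum (exp a) (exp b) (exp c) (exp d) (exp h) κ l) (exp h ^ 3) p M /
        pochs (prefactorDen (exp a) (exp b) (exp c) (exp d) (exp h) κ l) (exp h ^ 3) p M) *
      omega (exp a ^ 2 * exp h ^ ((ν + v - 1 : ℤ) - 1) / (exp d * exp e))
        (omegaParams (exp a) (exp b) (exp c) (exp d) (exp e) (exp h) n (ν + v - 1) v ν)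
        (exp h ^ 3) p := by
  have hs := sigmaLike_sigmaE hp
  have e3 : exp h ^ 3 = exp (3 * h) := by rw [← exp_nat_mul]; rfl
  rw [omega_eq_vwpSum hp hn hbc he, cubicSum_exp p n hbc he,
    addCubicSum_eq_vwpSum hs H hbc hb hc hr N n hn, e3, prefactor_exp p κ l _ _ hbc,
    prefactor_exp p v 1 _ _ hbc]
  congr 1
  have zero : ∀ κ l : ℤ, addPrefactor (sigmaE p) κ l a b c d h h 0 = 1 := fun κ l => by
    simp [addPrefactor, aPoch]
  rcases hcase with ⟨rfl, rfl, rfl, rfl, rfl⟩ | ⟨rfl, rfl, rfl, hvm⟩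
  · rw [zero, one_mul, vwpPrefactor_zero hs H hb hc]
  · rw [vwpPrefactor_pos hs H hb hc]
    rcases hvm with ⟨rfl, rfl⟩ | rfl
    · congr 1
      have n1 : sigmaE p (a - b) ≠ 0 := by simpa using hb 0
      have n2 : sigmaE p (a - c) ≠ 0 := by simpa using hc 0
      have n3 : sigmaE p a ≠ 0 := by simpa using H.ha 0
      have n4 : sigmaE p (a - d + h) ≠ 0 := by simpa using H.had 1
      rw [zero]
      simp only [addPrefactor, aPoch, Finset.prod_range_one]
      push_cast
      simp only [zero_mul, add_zero, sub_self, one_mul]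
      rw [show d - a + (0 - 1) * h = -(a - d + h) by ring, show c - a = -(a - c) by ring,
        show b - a = -(a - b) by ring]
      simp only [hs.odd]
      rw [div_eq_one_iff_eq]
      · ring
      · exact mul_ne_zero (mul_ne_zero (mul_ne_zero n1 n2) n4) (neg_ne_zero.mpr n3)
    · rfl

end Generic
-- Removal of the genericity assumptions by continuity
noncomputable section Continuity

open Complex Filter Topology

variable {p : ℂ}

/-- Multiplicative independence of `a, b, d, q` modulo powers of `p`, on the level of norms. -/
def NormIndependent (p a b d q : ℂ) : Prop :=
  ∀ i j k l m : ℤ, ¬(i = 0 ∧ j = 0 ∧ k = 0 ∧ l = 0) → ‖a ^ i * b ^ j * d ^ k * q ^ l‖ ≠ ‖p‖ ^ m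

theorem NormIndependent.sigmaE_ne_zero (hp : ‖p‖ < 1) {a b d q : ℂ}
    (h : NormIndependent p (exp a) (exp b) (exp d) (exp q)) {i j k l : ℤ}
    (hne : ¬(i = 0 ∧ j = 0 ∧ k = 0 ∧ l = 0)) :
    sigmaE p (i * a + j * b + k * d + l * q) ≠ 0 := by
  rw [sigmaE_ne_zero_iff]
  refine E_ne_zero hp (exp_ne_zero _) fun m => ?_
  have := h i j k l m hne
  rwa [← exp_int_mul, ← exp_int_mul, ← exp_int_mul, ← exp_int_mul, ← exp_add, ← exp_add,
    ← exp_add] at this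

/-- Continuous curves of nonzero complex numbers. -/
structure UnitCurve (x : ℝ → ℂ) : Prop where
  continuous : Continuous x
  ne_zero : ∀ t, x t ≠ 0

namespace UnitCurve

variable {x y : ℝ → ℂ}

theorem mul (hx : UnitCurve x) (hy : UnitCurve y) : UnitCurve fun t => x t * y t :=
  ⟨hx.1.mul hy.1, fun t => mul_ne_zero (hx.2 t) (hy.2 t)⟩

theorem div (hx : UnitCurve x) (hy : UnitCurve y) : UnitCurve fun t => x t / y t :=
  ⟨hx.1.div hy.1 hy.2, fun t => div_ne_zero (hx.2 t) (hy.2 t)⟩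

theorem pow (hx : UnitCurve x) (n : ℕ) : UnitCurve fun t => x t ^ n :=
  ⟨hx.1.pow n, fun t => pow_ne_zero n (hx.2 t)⟩

theorem zpow (hx : UnitCurve x) (n : ℤ) : UnitCurve fun t => x t ^ n :=
  ⟨hx.1.zpow₀ n fun t => Or.inl (hx.2 t), fun t => zpow_ne_zero n (hx.2 t)⟩

theorem continuous_E (hp : ‖p‖ < 1) (hx : UnitCurve x) : Continuous fun t => E p (x t) :=
  continuous_iff_continuousAt.mpr fun t =>
    (continuousAt_E hp (hx.2 t)).comp (f := x) hx.1.continuousAt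

theorem continuous_poch (hp : ‖p‖ < 1) (hx : UnitCurve x) (hy : UnitCurve y) (k : ℕ) :
    Continuous fun t => poch (x t) (y t) p k :=
  continuous_finsetProd _ fun i _ => (hx.mul (hy.pow i)).continuous_E hp

theorem continuous_pochs (hp : ‖p‖ < 1) {L : List (ℝ → ℂ)} (hL : ∀ x ∈ L, UnitCurve x)
    (hy : UnitCurve y) (k : ℕ) : Continuous fun t => pochs (L.map fun x => x t) (y t) p k := by
  induction L with
  | nil => simpa [pochs] using continuous_const
  | cons x L ih =>
    rw [List.forall_mem_cons] at hL
    simp only [List.map_cons, pochs_cons]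
    exact (hL.1.continuous_poch hp hy k).mul (ih hL.2)

end UnitCurve

theorem poch_ne_zero_of_le {x q : ℂ} {k n : ℕ} (hk : k ≤ n) (h : poch x q p n ≠ 0) :
    poch x q p k ≠ 0 := by
  rw [poch, Finset.prod_ne_zero_iff] at h ⊢
  exact fun i hi => h i (Finset.mem_range.mpr (lt_of_lt_of_le (Finset.mem_range.mp hi) hk))

theorem pochs_ne_zero_of_le {xs : List ℂ} {q : ℂ} {k n : ℕ} (hk : k ≤ n)
    (h : pochs xs q p n ≠ 0) : pochs xs q p k ≠ 0 := by
  induction xs with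
  | nil => simp [pochs]
  | cons x xs ih =>
    rw [pochs_cons] at h ⊢
    exact mul_ne_zero (poch_ne_zero_of_le hk (left_ne_zero_of_mul h))
      (ih (right_ne_zero_of_mul h))

theorem continuousAt_omegaPartial (hp : ‖p‖ < 1) {x y : ℝ → ℂ} (hx : UnitCurve x)
    (hy : UnitCurve y) {L : List (ℝ → ℂ)} (hL : ∀ x ∈ L, UnitCurve x) {N : ℕ} {t₀ : ℝ}
    (hw : OmegaWellDefined (x t₀) (L.map fun x => x t₀) (y t₀) p N) :
    ContinuousAt (fun t => omegaPartial (x t) (L.map fun x => x t) (y t) p N) t₀ := by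
  refine tendsto_finsetSum _ fun k hk => ?_
  have hk' : k ≤ N := by have := Finset.mem_range.mp hk; omega
  have hden : Continuous fun t => vwpDenom (x t) (L.map fun x => x t) (y t) p k := by
    have := UnitCurve.continuous_pochs hp
      (L := y :: L.map fun z t => x t * y t / z t) (y := y) (by
        rw [List.forall_mem_cons]
        refine ⟨hy, fun z hz => ?_⟩
        obtain ⟨w, hw, rfl⟩ := List.mem_map.mp hz
        exact (hx.mul hy).div (hL w hw)) hy k
    simpa only [vwpDenom, List.map_cons, List.map_map, Function.comp_def] using this
  have hnum : Continuous fun t => pochs (x t :: L.map fun x => x t) (y t) p k :=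
    UnitCurve.continuous_pochs hp (L := x :: L) (by
      rw [List.forall_mem_cons]; exact ⟨hx, hL⟩) hy k
  exact (((hx.mul (hy.pow _)).continuous_E hp).continuousAt.div (hx.continuous_E hp).continuousAt
    hw.1).mul ((hnum.mul (hy.pow k).continuous).continuousAt.div hden.continuousAt
      (pochs_ne_zero_of_le hk' hw.2))

theorem continuousAt_cubicSum (hp : ‖p‖ < 1) {a b c d e q : ℝ → ℂ} (ha : UnitCurve a)
    (hb : UnitCurve b) (hc : UnitCurve c) (hd : UnitCurve d) (he : UnitCurve e)
    (hq : UnitCurve q) {n : ℕ} {t₀ : ℝ} (hE : E p (a t₀) ≠ 0)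
    (hL₁ : pochs [a t₀ * q t₀ / b t₀, a t₀ * q t₀ / c t₀] (q t₀) p n ≠ 0)
    (hL₂ : poch (a t₀ * q t₀ / d t₀) (q t₀) p (2 * n) ≠ 0)
    (hL₃ : pochs [a t₀ * q t₀ ^ 3 / e t₀, a t₀ * q t₀ ^ (n + 3)] (q t₀ ^ 3) p n ≠ 0) :
    ContinuousAt (fun t => cubicSum (a t) (b t) (c t) (d t) (e t) (q t) p n) t₀ := by
  refine tendsto_finsetSum _ fun k hk => ?_
  have hk' : k ≤ n := by have := Finset.mem_range.mp hk; omega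
  have two : ∀ {x y z : ℝ → ℂ}, UnitCurve x → UnitCurve y → UnitCurve z →
      ContinuousAt (fun t => pochs [x t, y t] (z t) p k) t₀ := fun {x y z} hx hy hz =>
    (UnitCurve.continuous_pochs hp (L := [x, y]) (by
      simp only [List.forall_mem_cons]; exact ⟨hx, hy, by simp⟩) hz k).continuousAt
  refine ((((((ha.mul (hq.pow _)).continuous_E hp).continuousAt.div
    (ha.continuous_E hp).continuousAt hE).mul
    ((two hb hc (hq.pow 3)).div (two ((ha.mul hq).div hb) ((ha.mul hq).div hc) hq)
      (pochs_ne_zero_of_le hk' hL₁))).mul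
    ((hd.continuous_poch hp hq _).continuousAt.div
      (((ha.mul hq).div hd).continuous_poch hp hq _).continuousAt
      (poch_ne_zero_of_le (by omega) hL₂))).mul
    ((two he (hq.zpow _) hq).div (two ((ha.mul (hq.pow 3)).div he) (ha.mul (hq.pow _)) (hq.pow 3))
      (pochs_ne_zero_of_le hk' hL₃))).mul (hq.pow k).continuous.continuousAt

/-- Each forbidden relation confines `t` to the zeros of a nonzero polynomial: the exponents 2, 3,
4, 1 are distinct and positive, so `i, j, k, l` are its nonconstant coefficients. The union over
integer tuples is countable, hence has dense complement. -/
theorem frequently_normIndependent (p : ℂ) {a b d q : ℂ} (ha : a ≠ 0) (hb : b ≠ 0) (hd : d ≠ 0)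
    (hq : q ≠ 0) : ∃ᶠ t : ℝ in 𝓝 0, NormIndependent p (a * exp (t ^ 2 : ℝ)) (b * exp (t ^ 3 : ℝ))
      (d * exp (t ^ 4 : ℝ)) (q * exp (t : ℝ)) := by
  let bad : ℤ × ℤ × ℤ × ℤ × ℤ → Set ℝ := fun x =>
    if x.1 = 0 ∧ x.2.1 = 0 ∧ x.2.2.1 = 0 ∧ x.2.2.2.1 = 0 then ∅ else
      {t | ‖(a * exp (t ^ 2 : ℝ)) ^ x.1 * (b * exp (t ^ 3 : ℝ)) ^ x.2.1 *
        (d * exp (t ^ 4 : ℝ)) ^ x.2.2.1 * (q * exp (t : ℝ)) ^ x.2.2.2.1‖ = ‖p‖ ^ x.2.2.2.2}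
  have hfin : ∀ x, (bad x).Countable := by
    rintro ⟨i, j, k, l, m⟩
    simp only [bad]
    split_ifs with h
    · exact Set.countable_empty
    · set A : ℝ := ‖a ^ i * b ^ j * d ^ k * q ^ l‖
      have hA : A ≠ 0 := norm_ne_zero_iff.mpr (mul_ne_zero (mul_ne_zero (mul_ne_zero
        (zpow_ne_zero _ ha) (zpow_ne_zero _ hb)) (zpow_ne_zero _ hd)) (zpow_ne_zero _ hq))
      let P : Polynomial ℝ := Polynomial.C (i : ℝ) * Polynomial.X ^ 2 +
        Polynomial.C (j : ℝ) * Polynomial.X ^ 3 + Polynomial.C (k : ℝ) * Polynomial.X ^ 4 +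
        Polynomial.C (l : ℝ) * Polynomial.X - Polynomial.C (Real.log (‖p‖ ^ m / A))
      have hP : P ≠ 0 := fun h0 => h (by
        have hc : ∀ r, P.coeff r = 0 := fun r => by rw [h0, Polynomial.coeff_zero]
        have h1 := hc 1
        have h2 := hc 2
        have h3 := hc 3
        have h4 := hc 4
        simp only [P, Polynomial.coeff_sub, Polynomial.coeff_add, Polynomial.coeff_C_mul,
          Polynomial.coeff_X_pow, Polynomial.coeff_X, Polynomial.coeff_C] at h1 h2 h3 h4
        norm_num at h1 h2 h3 h4
        exact ⟨h2, h3, h4, h1⟩)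
      refine ((Polynomial.finite_setOfPred_isRoot hP).subset fun t ht => ?_).countable
      have h1 : (a * exp (t ^ 2 : ℝ)) ^ i * (b * exp (t ^ 3 : ℝ)) ^ j *
          (d * exp (t ^ 4 : ℝ)) ^ k * (q * exp (t : ℝ)) ^ l = (a ^ i * b ^ j * d ^ k * q ^ l) *
          exp ((i * t ^ 2 + j * t ^ 3 + k * t ^ 4 + l * t : ℝ) : ℂ) := by
        rw [mul_zpow, mul_zpow, mul_zpow, mul_zpow, ← exp_int_mul, ← exp_int_mul, ← exp_int_mul,
          ← exp_int_mul]
        push_cast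
        rw [exp_add, exp_add, exp_add]
        ring
      rw [Set.mem_ofPred_eq, h1, norm_mul, norm_exp_ofReal] at ht
      have h2 : Real.log (‖p‖ ^ m / A) = i * t ^ 2 + j * t ^ 3 + k * t ^ 4 + l * t := by
        rw [← ht, mul_div_cancel_left₀ _ hA, Real.log_exp]
      simp [P, h2]
  have hdense : Dense (⋃ x, bad x)ᶜ := (Set.countable_iUnion hfin).dense_compl ℝ
  refine (mem_closure_iff_frequently.mp (hdense 0)).mono fun t ht i j k l m hne heq => ?_
  refine ht (Set.mem_iUnion.mpr ⟨(i, j, k, l, m), ?_⟩)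
  simp only [bad, if_neg hne]
  exact heq

/-- All the additive nonvanishing conditions concern integral monomials in a, b, d, q with a nonzero
exponent, so norm independence gives them at once. -/
theorem cubicSum_eq_of_normIndependent (hp : ‖p‖ < 1) {ν v N n m M : ℕ} {κ l : ℤ}
    (hr : Residues ν v) (hn : n = 3 * N + ν)
    (hcase : (ν = 0 ∧ κ = 3 ∧ l = 4 - v ∧ M = N ∧ m = 0) ∨
      (κ = ν ∧ l = 1 - v ∧ M = N + 1 ∧ (v = 0 ∧ m = 0 ∨ m = 1)))
    {a b c d e q : ℂ} (ha : a ≠ 0) (hb : b ≠ 0) (hd : d ≠ 0) (hq : q ≠ 0)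
    (hgen : NormIndependent p a b d q) (hc : c = a ^ 2 * q / (b * d))
    (he : e = a * q ^ (n + 1) / d) :
    cubicSum a b c d e q p n =
      pochs (prefactorNum a b c d q v 1) q p m / pochs (prefactorDen a b c d q v 1) q p m *
      (pochs (prefactorNum a b c d q κ l) (q ^ 3) p M /
        pochs (prefactorDen a b c d q κ l) (q ^ 3) p M) *
      omega (a ^ 2 * q ^ ((ν + v - 1 : ℤ) - 1) / (d * e))
        (omegaParams a b c d e q n (ν + v - 1) v ν) (q ^ 3) p := by
  obtain ⟨a, rfl⟩ : ∃ x, exp x = a := ⟨_, exp_log ha⟩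
  obtain ⟨b, rfl⟩ : ∃ x, exp x = b := ⟨_, exp_log hb⟩
  obtain ⟨d, rfl⟩ : ∃ x, exp x = d := ⟨_, exp_log hd⟩
  obtain ⟨q, rfl⟩ : ∃ x, exp x = q := ⟨_, exp_log hq⟩
  have hc' : c = exp (2 * a + q - b - d) := by
    rw [hc, ← exp_nat_mul, ← exp_add, ← exp_add, ← exp_sub]; congr 1; push_cast; ring
  have he' : e = exp (a + (n + 1) * q - d) := by
    rw [he, ← exp_nat_mul, ← exp_add, ← exp_sub]; push_cast; rfl
  rw [hc', he']
  have hs := fun i j k l (hne : ¬(i = 0 ∧ j = 0 ∧ k = 0 ∧ l = 0)) =>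
    hgen.sigmaE_ne_zero hp (i := i) (j := j) (k := k) (l := l) hne
  refine cubicSum_eq_of_generic hp hr hn hcase ⟨fun l hl => ?_, fun l => ?_, fun l => ?_,
    fun l => ?_, fun l => ?_⟩ (fun l => ?_) (fun l => ?_) (by ring) (by ring)
  · convert hs 0 0 0 l (by omega) using 2; push_cast; ring
  · convert hs 1 0 0 l (by omega) using 2; push_cast; ring
  · convert hs 0 0 1 l (by omega) using 2; push_cast; ring
  · convert hs 1 0 (-1) l (by omega) using 2; push_cast; ring
  · convert hs 1 0 (-2) l (by omega) using 2; push_cast; ring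
  · convert hs 1 (-1) 0 l (by omega) using 2; push_cast; ring
  · convert hs (-1) 1 1 (l - 1) (by omega) using 2; push_cast; ring

theorem cubicSum_eq (hp : ‖p‖ < 1) {ν v N n m M : ℕ} {κ l : ℤ}
    (hr : Residues ν v) (hn : n = 3 * N + ν)
    (hcase : (ν = 0 ∧ κ = 3 ∧ l = 4 - v ∧ M = N ∧ m = 0) ∨
      (κ = ν ∧ l = 1 - v ∧ M = N + 1 ∧ (v = 0 ∧ m = 0 ∨ m = 1)))
    {a b c d e q : ℂ} (ha : a ≠ 0) (hq : q ≠ 0)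
    (hbcd : b * c * d = a ^ 2 * q) (hde : d * e = a * q ^ (n + 1)) (hE : E p a ≠ 0)
    (hL₁ : pochs [a * q / b, a * q / c] q p n ≠ 0)
    (hL₂ : poch (a * q / d) q p (2 * n) ≠ 0)
    (hL₃ : pochs [a * q ^ 3 / e, a * q ^ (n + 3)] (q ^ 3) p n ≠ 0)
    (hD₁ : pochs (prefactorDen a b c d q v 1) q p m ≠ 0)
    (hD₂ : pochs (prefactorDen a b c d q κ l) (q ^ 3) p M ≠ 0)
    (hw : OmegaWellDefined (a ^ 2 * q ^ ((ν + v - 1 : ℤ) - 1) / (d * e))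
      (omegaParams a b c d e q n (ν + v - 1) v ν) (q ^ 3) p N) :
    cubicSum a b c d e q p n =
      pochs (prefactorNum a b c d q v 1) q p m / pochs (prefactorDen a b c d q v 1) q p m *
      (pochs (prefactorNum a b c d q κ l) (q ^ 3) p M /
        pochs (prefactorDen a b c d q κ l) (q ^ 3) p M) *
      omega (a ^ 2 * q ^ ((ν + v - 1 : ℤ) - 1) / (d * e))
        (omegaParams a b c d e q n (ν + v - 1) v ν) (q ^ 3) p := by
  have hbcd0 : b * c * d ≠ 0 := hbcd ▸ mul_ne_zero (pow_ne_zero 2 ha) hq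
  have hd : d ≠ 0 := right_ne_zero_of_mul hbcd0
  have hb : b ≠ 0 := left_ne_zero_of_mul (left_ne_zero_of_mul hbcd0)
  have curve : ∀ {x : ℂ}, x ≠ 0 → ∀ k : ℕ, UnitCurve fun t => x * exp (t ^ k : ℝ) := fun hx k =>
    ⟨by fun_prop, fun t => mul_ne_zero hx (exp_ne_zero _)⟩
  have exists_curve : ∀ {x : ℂ}, x ≠ 0 → ∀ k : ℕ, k ≠ 0 → ∃ y : ℝ → ℂ, UnitCurve y ∧ y 0 = x ∧
      ∀ t, y t = x * exp (t ^ k : ℝ) := fun hx k hk =>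
    ⟨_, curve hx k, by simp [hk], fun t => rfl⟩
  obtain ⟨A, hA, rfl, hA'⟩ := exists_curve ha 2 (by norm_num)
  obtain ⟨B, hB, rfl, hB'⟩ := exists_curve hb 3 (by norm_num)
  obtain ⟨D, hD, rfl, hD'⟩ := exists_curve hd 4 (by norm_num)
  obtain ⟨Q, hQ, rfl, hQ'⟩ := exists_curve hq 1 (by norm_num)
  -- `c` and `e` are moved along with the other parameters so that both balancing conditions hold on
  -- the whole curve.
  obtain ⟨C, hC, hC₀, hC'⟩ : ∃ y, UnitCurve y ∧ y 0 = c ∧ ∀ t, y t = A t ^ 2 * Q t / (B t * D t) :=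
    ⟨_, ((hA.pow 2).mul hQ).div (hB.mul hD), by
      rw [div_eq_iff (mul_ne_zero hb hd), ← hbcd]; ring, fun t => rfl⟩
  obtain ⟨F, hF, hF₀, hF'⟩ : ∃ y, UnitCurve y ∧ y 0 = e ∧ ∀ t, y t = A t * Q t ^ (n + 1) / D t :=
    ⟨_, (hA.mul (hQ.pow _)).div hD, by
      rw [div_eq_iff hd, ← hde]; ring, fun t => rfl⟩
  subst hC₀ hF₀
  have hmem : ∀ t, (Q t ^ 3) ^ (-N : ℤ) ∈
      omegaParams (A t) (B t) (C t) (D t) (F t) (Q t) n (ν + v - 1) v ν := fun t => by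
    have : (Q t ^ 3) ^ (-N : ℤ) = Q t ^ ((ν : ℤ) - n) := by
      rw [← zpow_natCast, ← zpow_mul]; congr 1; push_cast; omega
    simp [omegaParams, this]
  let W : List (ℝ → ℂ) := [fun t => A t * Q t ^ ((ν + v - 1 : ℤ) - 1) / D t, fun t => A t / F t,
    B, C, fun t => D t * Q t ^ (ν + v - 1 : ℤ), fun t => Q t ^ ((v : ℤ) - n),
    fun t => Q t ^ ((ν : ℤ) - n)]
  have hW : ∀ x ∈ W, UnitCurve x := by
    simp only [W, List.forall_mem_cons]
    exact ⟨(hA.mul (hQ.zpow _)).div hD, hA.div hF, hB, hC, hD.mul (hQ.zpow _), hQ.zpow _,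
      hQ.zpow _, by simp⟩
  have num : ∀ (κ l : ℤ) (r k : ℕ), Continuous fun t =>
      pochs (prefactorNum (A t) (B t) (C t) (D t) (Q t) κ l) (Q t ^ r) p k := fun κ l r k =>
    UnitCurve.continuous_pochs hp (L := [fun t => A t * Q t ^ κ,
      fun t => A t * Q t ^ κ / (B t * C t), fun t => A t * Q t ^ l / (B t * D t),
      fun t => A t * Q t ^ l / (C t * D t)]) (by
        have h1 := hA.mul (hQ.zpow κ)
        have h2 := hA.mul (hQ.zpow l)
        simp only [List.forall_mem_cons]
        exact ⟨h1, h1.div (hB.mul hC), h2.div (hB.mul hD), h2.div (hC.mul hD), by simp⟩)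
      (hQ.pow r) k
  have den : ∀ (κ l : ℤ) (r k : ℕ), Continuous fun t =>
      pochs (prefactorDen (A t) (B t) (C t) (D t) (Q t) κ l) (Q t ^ r) p k := fun κ l r k =>
    UnitCurve.continuous_pochs hp (L := [fun t => A t * Q t ^ κ / B t,
      fun t => A t * Q t ^ κ / C t, fun t => A t * Q t ^ l / D t,
      fun t => A t * Q t ^ l / (B t * C t * D t)]) (by
        have h1 := hA.mul (hQ.zpow κ)
        have h2 := hA.mul (hQ.zpow l)
        simp only [List.forall_mem_cons]
        exact ⟨h1.div hB, h1.div hC, h2.div hD, h2.div ((hB.mul hC).mul hD), by simp⟩)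
      (hQ.pow r) k
  have num₁ := fun κ l k => by simpa only [pow_one] using num κ l 1 k
  have den₁ := fun κ l k => by simpa only [pow_one] using den κ l 1 k
  have cL := continuousAt_cubicSum hp hA hB hC hD hF hQ hE hL₁ hL₂ hL₃
  have cW := continuousAt_omegaPartial hp (((hA.pow 2).mul (hQ.zpow _)).div (hD.mul hF))
    (hQ.pow 3) hW hw
  have cR := (((num₁ v 1 m).continuousAt.div (den₁ v 1 m).continuousAt hD₁).mul
    ((num κ l 3 M).continuousAt.div (den κ l 3 M).continuousAt hD₂)).mul cW
  rw [omega_eq_omegaPartial hp (pow_ne_zero 3 hq) (hmem 0)]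
  -- If the sides differed at 0 they would, by continuity, differ for all small `t`, contradicting
  -- the identity at generic `t` arbitrarily close to 0.
  by_contra hne
  have hev := (cL.sub cR).eventually_ne (sub_ne_zero.mpr hne)
  obtain ⟨t, hgen, ht⟩ := ((frequently_normIndependent p ha hb hd hq).and_eventually hev).exists
  refine ht (sub_eq_zero.mpr ?_)
  have key := cubicSum_eq_of_normIndependent hp hr hn hcase (hA.2 t) (hB.2 t) (hD.2 t) (hQ.2 t)
    (by rw [hA' t, hB' t, hD' t, hQ' t, pow_one]; exact hgen) (hC' t) (hF' t)
  rw [omega_eq_omegaPartial hp (pow_ne_zero 3 (hQ.2 t)) (hmem t)] at key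
  exact key

end Continuity

/-! ### Assembly of the three expressions -/

theorem OmegaWellDefined.perm {a₁ q p : ℂ} {as bs : List ℂ} {N : ℕ} (h : as.Perm bs)
    (hw : OmegaWellDefined a₁ as q p N) : OmegaWellDefined a₁ bs q p N := by
  refine ⟨hw.1, ?_⟩
  have := hw.2
  unfold vwpDenom pochs at this ⊢
  simpa only [List.map_cons, List.prod_cons, ((h.map _).map _).prod_eq] using this

theorem cubicSum_eq_omega {p : ℂ} (hp : ‖p‖ < 1) {ν v N n m M : ℕ} {κ l t i j : ℤ}
    (hr : Residues ν v) (hn : n = 3 * N + ν)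
    (hcase : (ν = 0 ∧ κ = 3 ∧ l = 4 - v ∧ M = N ∧ m = 0) ∨
      (κ = ν ∧ l = 1 - v ∧ M = N + 1 ∧ (v = 0 ∧ m = 0 ∨ m = 1)))
    (ht : t = ν + v - 1) (hij : i = v ∧ j = ν ∨ i = ν ∧ j = v)
    {a b c d e q : ℂ} (ha : a ≠ 0) (hq : q ≠ 0)
    (hbcd : b * c * d = a ^ 2 * q) (hde : d * e = a * q ^ (n + 1)) (hE : E p a ≠ 0)
    (hL₁ : pochs [a * q / b, a * q / c] q p n ≠ 0)
    (hL₂ : poch (a * q / d) q p (2 * n) ≠ 0)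
    (hL₃ : pochs [a * q ^ 3 / e, a * q ^ (n + 3)] (q ^ 3) p n ≠ 0)
    (hD₁ : pochs (prefactorDen a b c d q v 1) q p m ≠ 0)
    (hD₂ : pochs (prefactorDen a b c d q κ l) (q ^ 3) p M ≠ 0)
    (hw : OmegaWellDefined (a ^ 2 * q ^ (t - 1) / (d * e))
      (omegaParams a b c d e q n t i j) (q ^ 3) p N) :
    cubicSum a b c d e q p n =
      pochs (prefactorNum a b c d q v 1) q p m / pochs (prefactorDen a b c d q v 1) q p m *
      (pochs (prefactorNum a b c d q κ l) (q ^ 3) p M /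
        pochs (prefactorDen a b c d q κ l) (q ^ 3) p M) *
      omega (a ^ 2 * q ^ (t - 1) / (d * e)) (omegaParams a b c d e q n t i j) (q ^ 3) p := by
  subst ht
  rcases hij with ⟨rfl, rfl⟩ | ⟨rfl, rfl⟩
  · exact cubicSum_eq hp hr hn hcase ha hq hbcd hde hE hL₁ hL₂ hL₃ hD₁ hD₂ hw
  · rw [omega_perm (omegaParams_perm _ _ _ _ _ _ _ _ _ _)]
    exact cubicSum_eq hp hr hn hcase ha hq hbcd hde hE hL₁ hL₂ hL₃ hD₁ hD₂
      (hw.perm (omegaParams_perm _ _ _ _ _ _ _ _ _ _))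

theorem pochs_zero (xs : List ℂ) (q p : ℂ) : pochs xs q p 0 = 1 := by
  simp [pochs, poch]

end EllipticSeries

theorem mainTheorem7 (p q a b c d e : ℂ) (n σ : ℕ)
    (hp : ‖p‖ < 1) (hq : q ≠ 0) (ha : a ≠ 0)
    (hbcd : b * c * d = a ^ 2 * q) (hde : d * e = a * q ^ (n + 1))
    (hσ : σ ≤ 2) (hnσ : 3 ∣ n + σ)
    -- no denominator on the left-hand side vanishes
    (hE : E p a ≠ 0)
    (hL₁ : pochs [a * q / b, a * q / c] q p n ≠ 0)
    (hL₂ : poch (a * q / d) q p (2 * n) ≠ 0)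
    (hL₃ : pochs [a * q ^ 3 / e, a * q ^ (n + 3)] (q ^ 3) p n ≠ 0) :
    -- first expression, with the factor `f_n`
    (¬ n ≡ 2 [MOD 3] →
      pochs [a * q ^ (3 - σ : ℤ) / b, a * q ^ (3 - σ : ℤ) / c,
        a * q ^ (3 - σ : ℤ) / d, a * q ^ (3 - σ : ℤ) / (b * c * d)]
        (q ^ 3) p ((n + σ) / 3) ≠ 0 →
      OmegaWellDefined (a ^ 2 / (d * e * q))
        [a / (d * q), a / e, b, c, d, q ^ (1 - n : ℤ), q ^ (-n : ℤ)] (q ^ 3) p (n / 3) →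
      cubicSum a b c d e q p n =
        pochs [a * q ^ (3 - σ : ℤ), a * q ^ (3 - σ : ℤ) / (b * c),
            a * q ^ (3 - σ : ℤ) / (b * d), a * q ^ (3 - σ : ℤ) / (c * d)]
            (q ^ 3) p ((n + σ) / 3) /
          pochs [a * q ^ (3 - σ : ℤ) / b, a * q ^ (3 - σ : ℤ) / c,
            a * q ^ (3 - σ : ℤ) / d, a * q ^ (3 - σ : ℤ) / (b * c * d)]
            (q ^ 3) p ((n + σ) / 3) *
        omega (a ^ 2 / (d * e * q))
          [a / (d * q), a / e, b, c, d, q ^ (1 - n : ℤ), q ^ (-n : ℤ)] (q ^ 3) p) ∧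
    -- second expression, with the factor `g_n`
    (¬ n ≡ 1 [MOD 3] →
      pochs [a * q ^ (3 - σ : ℤ) / b, a * q ^ (3 - σ : ℤ) / c,
        a * q ^ (2 - σ : ℤ) / d, a * q ^ (2 - σ : ℤ) / (b * c * d)]
        (q ^ 3) p ((n + σ) / 3) ≠ 0 →
      OmegaWellDefined (a ^ 2 / (d * e))
        [a / d, a / e, b, c, d * q, q ^ (2 - n : ℤ), q ^ (-n : ℤ)] (q ^ 3) p (n / 3) →
      cubicSum a b c d e q p n =
        pochs [a * q ^ (3 - σ : ℤ), a * q ^ (3 - σ : ℤ) / (b * c),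
            a * q ^ (2 - σ : ℤ) / (b * d), a * q ^ (2 - σ : ℤ) / (c * d)]
            (q ^ 3) p ((n + σ) / 3) /
          pochs [a * q ^ (3 - σ : ℤ) / b, a * q ^ (3 - σ : ℤ) / c,
            a * q ^ (2 - σ : ℤ) / d, a * q ^ (2 - σ : ℤ) / (b * c * d)]
            (q ^ 3) p ((n + σ) / 3) *
        omega (a ^ 2 / (d * e))
          [a / d, a / e, b, c, d * q, q ^ (2 - n : ℤ), q ^ (-n : ℤ)] (q ^ 3) p) ∧
    -- third expression, with the factor `h_n`
    (¬ n ≡ 0 [MOD 3] →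
      EProd p [a * q ^ σ / b, a * q ^ σ / c, a * q / d, a * q / (b * c * d)] ≠ 0 →
      pochs [a * q ^ (3 - σ : ℤ) / b, a * q ^ (3 - σ : ℤ) / c,
        a * q ^ (1 - σ : ℤ) / d, a * q ^ (1 - σ : ℤ) / (b * c * d)]
        (q ^ 3) p ((n + σ) / 3) ≠ 0 →
      OmegaWellDefined (a ^ 2 * q / (d * e))
        [a * q / d, a / e, b, c, d * q ^ 2, q ^ (2 - n : ℤ), q ^ (1 - n : ℤ)]
        (q ^ 3) p (n / 3) →
      cubicSum a b c d e q p n =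
        EProd p [a * q ^ σ, a * q ^ σ / (b * c), a * q / (b * d), a * q / (c * d)] /
          EProd p [a * q ^ σ / b, a * q ^ σ / c, a * q / d, a * q / (b * c * d)] *
        (pochs [a * q ^ (3 - σ : ℤ), a * q ^ (3 - σ : ℤ) / (b * c),
            a * q ^ (1 - σ : ℤ) / (b * d), a * q ^ (1 - σ : ℤ) / (c * d)]
            (q ^ 3) p ((n + σ) / 3) /
          pochs [a * q ^ (3 - σ : ℤ) / b, a * q ^ (3 - σ : ℤ) / c,
            a * q ^ (1 - σ : ℤ) / d, a * q ^ (1 - σ : ℤ) / (b * c * d)]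
            (q ^ 3) p ((n + σ) / 3)) *
        omega (a ^ 2 * q / (d * e))
          [a * q / d, a / e, b, c, d * q ^ 2, q ^ (2 - n : ℤ), q ^ (1 - n : ℤ)]
          (q ^ 3) p) := by
  obtain ⟨N, ν, hν, hn, hN⟩ : ∃ N ν : ℕ, ν ≤ 2 ∧ n = 3 * N + ν ∧ n / 3 = N :=
    ⟨n / 3, n % 3, by omega, by omega, rfl⟩
  -- Thus `(n + σ) / 3` is `N` for `ν = 0` and `N + 1` otherwise, and `3 - σ` is 3 or `ν`
  -- accordingly. The three expressions take `{ν, v}` to be `{0, 1}`, `{0, 2}` and `{1, 2}`, so that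
  -- `t = ν + v - 1` is 0, 1, 2.
  have hσν : (ν = 0 ∧ σ = 0) ∨ (ν = 1 ∧ σ = 2) ∨ (ν = 2 ∧ σ = 1) := by omega
  rw [hN]
  refine ⟨fun hmod hD hw => ?_, fun hmod hD hw => ?_, fun hmod hD₁ hD hw => ?_⟩
  · have h1 : a ^ 2 / (d * e * q) = a ^ 2 * q ^ ((0 : ℤ) - 1) / (d * e) := by
      rw [zero_sub, zpow_neg_one]; simp only [div_eq_mul_inv, mul_inv]; ring
    have h2 : [a / (d * q), a / e, b, c, d, q ^ (1 - n : ℤ), q ^ (-n : ℤ)] =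
        omegaParams a b c d e q n 0 1 0 := by
      rw [omegaParams, zero_sub, zpow_neg_one, zpow_zero, mul_one, zero_sub]
      simp only [div_eq_mul_inv, mul_inv, mul_assoc, mul_comm q⁻¹]
    rw [h1, h2] at hw ⊢
    refine (cubicSum_eq_omega hp (v := 1 - ν) (m := 0) (κ := 3 - σ) (l := 3 - σ)
      (M := (n + σ) / 3) (N := N) (ν := ν) ?_ hn ?_ ?_ ?_ ha hq hbcd hde hE hL₁ hL₂ hL₃ ?_ hD
      hw).trans ?_
    · unfold Nat.ModEq at hmod; unfold Residues; omega
    · unfold Nat.ModEq at hmod; omega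
    · unfold Nat.ModEq at hmod; omega
    · unfold Nat.ModEq at hmod; omega
    · rw [pochs_zero]; exact one_ne_zero
    · rw [pochs_zero, pochs_zero, div_one, one_mul]; rfl
  · have h1 : a ^ 2 / (d * e) = a ^ 2 * q ^ ((1 : ℤ) - 1) / (d * e) := by
      rw [sub_self, zpow_zero, mul_one]
    have h2 : [a / d, a / e, b, c, d * q, q ^ (2 - n : ℤ), q ^ (-n : ℤ)] =
        omegaParams a b c d e q n 1 2 0 := by
      rw [omegaParams, sub_self, zpow_one, zpow_zero, mul_one, zero_sub]
    rw [h1, h2] at hw ⊢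
    refine (cubicSum_eq_omega hp (v := 2 - ν) (m := 0) (κ := 3 - σ) (l := 2 - σ)
      (M := (n + σ) / 3) (N := N) (ν := ν) ?_ hn ?_ ?_ ?_ ha hq hbcd hde hE hL₁ hL₂ hL₃ ?_ hD
      hw).trans ?_
    · unfold Nat.ModEq at hmod; unfold Residues; omega
    · unfold Nat.ModEq at hmod; omega
    · unfold Nat.ModEq at hmod; omega
    · unfold Nat.ModEq at hmod; omega
    · rw [pochs_zero]; exact one_ne_zero
    · rw [pochs_zero, pochs_zero, div_one, one_mul]; rfl
  · have h1 : a ^ 2 * q / (d * e) = a ^ 2 * q ^ ((2 : ℤ) - 1) / (d * e) := by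
      rw [show (2 : ℤ) - 1 = 1 by norm_num, zpow_one]
    have h2 : [a * q / d, a / e, b, c, d * q ^ 2, q ^ (2 - n : ℤ), q ^ (1 - n : ℤ)] =
        omegaParams a b c d e q n 2 2 1 := by
      rw [omegaParams, show (2 : ℤ) - 1 = 1 by norm_num, zpow_one]
      norm_cast
    have h3 : [a * q ^ σ / b, a * q ^ σ / c, a * q / d, a * q / (b * c * d)] =
        prefactorDen a b c d q σ 1 := by
      rw [prefactorDen, zpow_one, zpow_natCast]
    have h4 : [a * q ^ σ, a * q ^ σ / (b * c), a * q / (b * d), a * q / (c * d)] =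
        prefactorNum a b c d q σ 1 := by
      rw [prefactorNum, zpow_one, zpow_natCast]
    rw [h1, h2] at hw ⊢
    rw [EProd_eq_pochs p q, h3] at hD₁ ⊢
    rw [EProd_eq_pochs p q, h4]
    refine cubicSum_eq_omega hp (v := σ) (m := 1) (κ := 3 - σ) (l := 1 - σ)
      (M := (n + σ) / 3) (N := N) (ν := ν) ?_ hn ?_ ?_ ?_ ha hq hbcd hde hE hL₁ hL₂ hL₃ hD₁ hD hw
    · unfold Nat.ModEq at hmod; unfold Residues; omega
    · unfold Nat.ModEq at hmod; omega
    · unfold Nat.ModEq at hmod; omega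
    · unfold Nat.ModEq at hmod; omega
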